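/- All manifolds are smooth, finite-dimensional and Hausdorff; $M$ and $P$ are also $\sigma$-compact. Let $G$ be a Lie group with Lie algebra $\mathfrak g=T_1G$ and $\pi:P\to M$ a smooth principal $G$-bundle with right action $R_a u=u\cdot a$. For $X\in\mathfrak g$ let $X^*$ be the fundamental vector field, $X^*(u)=T_1(g\mapsto u\cdot g)X$. **Definitions.** A *diffusion operator* $\mathcal L$ on a manifold $N$ is a linear operator on $C^\infty(N)$ of order at most two, with $\mathcal L1=0$, whose *symbol* $\sigma^{\mathcal L}_x:T_x^*N\to T_xN$, given by $$df(\sigma^{\mathcal L}(dg))=\tfrac12\mathcal L(fg)-\tfrac12(\mathcal Lf)g-\tfrac12 f(\mathcal Lg),$$ is positive semi-definite. (No ellipticity is assumed.) $\delta^{\mathcal L}$ is the unique linear operator from $C^1$ one-forms to functions with $\delta^{\mathcal L}(df)=\mathcal Lf$ and $\delta^{\mathcal L}(f\varphi)=df(\sigma^{\mathcal L}(\varphi))+f\,\delta^{\mathcal L}(\varphi)$. For a family $S$ of subspaces $S_x\subset T_xN$, $\mathcal L$ is *along* $S$ if $\delta^{\mathcal L}\varphi=0$ for every $C^1$ one-form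 $\varphi$ which vanishes on $S$. $\mathcal L$ is *cohesive* if $\sigma^{\mathcal L}$ has constant non-zero rank and $\mathcal L$ is along $\operatorname{Im}\sigma^{\mathcal L}$. An operator $\mathcal B$ on $P$ is *over* $\mathcal A$ on $M$ if $\mathcal B(f\circ\pi)=(\mathcal Af)\circ\pi$ for all $f\in C^\infty(M)$; it is *equivariant* if $\mathcal B(f\circ R_a)=(\mathcal Bf)\circ R_a$ for all $f\in C^\infty(P)$, $a\in G$; it is *vertical* if it is along $\ker T\pi$. An *invariant semi-connection* over a smooth sub-bundle $E$ of $TM$ is a smooth sub-bundle $H$ of $TP$ such that $T_u\pi$ maps $H_u$ bijectively onto $E_{\pi(u)}$ and $T_uR_a(H_u)=H_{u\cdot a}$ for all $u\in P$, $a\in G$. **Theorem.** Let $\mathcal B$ be an equivariant diffusion operator on $P$. There is a unique diffusion operator $\mathcal A$ on $M$ such that $\mathcal B$ is over $\mathcal A$. (1) Suppose $\sigma^{\mathcal A}$ has constant rank and put $E=\operatorname{Im}\sigma^{\mathcal A}$. There is a unique family of linear maps $h_u:E_{\pi(u)}\to T_uP$, $u\in P$, with $$h_u\bigl(\sigma^{\mathcal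 A}_{\pi(u)}(\ell)\bigr)=\sigma^{\mathcal B}_u(\ell\circ T_u\pi)\qquad(\ell\in T^*_{\pi(u)}M).$$ It satisfies $T_u\pi\circ h_u=\mathrm{id}$, and $H_u=\operatorname{Im}h_u$ defines an invariant semi-connection over $E$. (2) Suppose moreover that $\mathcal A$ is cohesive. Then there is a unique decomposition $\mathcal B=\mathcal A^H+\mathcal B^V$ into diffusion operators such that $\mathcal A^H$ is over $\mathcal A$ and along $H$, and $\mathcal B^V$ is vertical. There is a unique $\mathfrak g$-valued form $\varpi$, defined on $H+\ker T\pi$ only (the semi-connection form), with $\varpi|_H=0$ and $\varpi(X^*(u))=X$ for $u\in P$, $X\in\mathfrak g$. For every basis $A_1,\dots,A_n$ of $\mathfrak g$ there are smooth functions $\alpha^{ij}=\alpha^{ji}$ and $\beta^k$ on $P$ with $$\mathcal B^V=\sum_{i,j}\alpha^{ij}L_{A_i^*}L_{A_j^*}+\sum_k\beta^kL_{A_k^*},$$ where $L$ denotes Lie differentiation, and $(\alpha,\beta)$ is the only pair of families of functions, with $\alpha$ symmetric, for which this holds. Write $\varpi=\sum_k\varpi^kA_k$. Then $$\alpha^{kl}=\varpi^k(\sigma^{\mathcal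 B}(\varpi^l)),\qquad \beta^l=\delta^{\mathcal B}(\varpi^l).$$ Here $\varpi^l$ may be replaced, inside $\sigma^{\mathcal B}$, by any covector extending it to $T_uP$ (and then $\sigma^{\mathcal B}_u(\varpi^l)\in H_u+\ker T_u\pi$), and inside $\delta^{\mathcal B}$ by any $C^1$ one-form on $P$ extending it; a smooth extension of $\varpi^l$ to a one-form on $P$ always exists. Finally, the maps $\alpha:P\to\mathfrak g\otimes\mathfrak g$ and $\beta:P\to\mathfrak g$, $$\alpha(u)=\sum_{i,j}\alpha^{ij}(u)A_i\otimes A_j,\qquad \beta(u)=\sum_k\beta^k(u)A_k,$$ do not depend on the basis, and for all $u\in P$, $g\in G$ $$\alpha(u\cdot g)=(\mathrm{Ad}(g^{-1})\otimes\mathrm{Ad}(g^{-1}))\,\alpha(u),\qquad \beta(u\cdot g)=\mathrm{Ad}(g^{-1})\,\beta(u).$$ -/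

import Mathlib

open scoped Manifold ContDiff TensorProduct

noncomputable section

open scoped Topology
open Bundle Module

namespace EquivDiff

/-! ### One-forms, vector fields and sub-bundles of the tangent bundle

All manifolds are finite dimensional smooth manifolds without boundary, modelled on a normed
space `E`. -/

section Manifold

variable {E : Type*} [NormedAddCommGroup E] [NormedSpace ℝ E]
  {M : Type*} [TopologicalSpace M] [ChartedSpace E M]

/-- `φ` is a 1-form of class `C^k`: a `C^k` section of the cotangent bundle. -/
def IsOneForm [IsManifold 𝓘(ℝ, E) ∞ M] (k : ℕ∞ω)
    (φ : ∀ x : M, TangentSpace 𝓘(ℝ, E) x →L[ℝ] ℝ) : Prop :=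
  ContMDiff 𝓘(ℝ, E) (𝓘(ℝ, E).prod 𝓘(ℝ, E →L[ℝ] ℝ)) k
    (fun x ↦ TotalSpace.mk' (E →L[ℝ] ℝ)
      (E := fun x : M ↦ TangentSpace 𝓘(ℝ, E) x →L[ℝ] Trivial M ℝ x) x (φ x))

/-- The differential of a real function at a point, as a covector. -/
def differential (f : M → ℝ) (x : M) : TangentSpace 𝓘(ℝ, E) x →L[ℝ] ℝ :=
  mfderiv 𝓘(ℝ, E) 𝓘(ℝ, ℝ) f x

/-- The Lie derivative `L_X f = df(X)` of a function along a vector field. -/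
def lieDeriv (X : ∀ x : M, TangentSpace 𝓘(ℝ, E) x) (f : M → ℝ) (x : M) : ℝ :=
  differential f x (X x)

/-- A family of subspaces `S x` of the tangent spaces is a smooth sub-bundle (of constant rank):
near every point it is spanned by a linearly independent family of smooth vector fields. -/
def IsSmoothSubbundle [IsManifold 𝓘(ℝ, E) ∞ M]
    (S : ∀ x : M, Submodule ℝ (TangentSpace 𝓘(ℝ, E) x)) : Prop :=
  ∃ r : ℕ, ∀ x₀ : M, ∃ U : Set M, IsOpen U ∧ x₀ ∈ U ∧
    ∃ X : Fin r → ∀ x : M, TangentSpace 𝓘(ℝ, E) x,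
      (∀ i, ContMDiffOn 𝓘(ℝ, E) 𝓘(ℝ, E).tangent ∞
        (fun x ↦ (⟨x, X i x⟩ : TangentBundle 𝓘(ℝ, E) M)) U) ∧
      ∀ x ∈ U, LinearIndependent ℝ (fun i ↦ X i x) ∧
        Submodule.span ℝ (Set.range fun i ↦ X i x) = S x

/-- A covector at `x`, read in the preferred chart at `x`, that is, as a linear form on the model
space. -/
def asDual {x : M} (ℓ : TangentSpace 𝓘(ℝ, E) x →L[ℝ] ℝ) : E →L[ℝ] ℝ := ℓ

/-- The globally defined smooth function which is `ℓ (φ y - φ x)` near `x`, where `φ` is the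
preferred chart at `x`; it is cut off away from `x` by a bump function. -/
def coordFun [IsManifold 𝓘(ℝ, E) ∞ M] [FiniteDimensional ℝ E] [T2Space M] (x : M) :
    (TangentSpace 𝓘(ℝ, E) x →L[ℝ] ℝ) →ₗ[ℝ] C^∞⟮𝓘(ℝ, E), M; 𝓘(ℝ, ℝ), ℝ⟯ where
  toFun ℓ := ⟨fun y ↦ (Classical.arbitrary (SmoothBumpFunction 𝓘(ℝ, E) x)) y •
      (asDual ℓ) (extChartAt 𝓘(ℝ, E) x y - extChartAt 𝓘(ℝ, E) x x), by
    apply SmoothBumpFunction.contMDiff_smul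
    have h1 : ContMDiffOn 𝓘(ℝ, E) 𝓘(ℝ, E) ∞ (extChartAt 𝓘(ℝ, E) x) (chartAt E x).source :=
      contMDiffOn_extChartAt
    exact (asDual ℓ).contMDiff.comp_contMDiffOn (h1.sub contMDiffOn_const)⟩
  map_add' ℓ ℓ' := by
    ext y
    exact smul_add (M := ℝ) (A := ℝ) _ (asDual ℓ _) (asDual ℓ' _)
  map_smul' c ℓ := by
    ext y
    exact smul_comm (α := ℝ) _ c (asDual ℓ _)

/-- The coordinate covectors `dx^i` at `x`, dual to the basis `finBasis ℝ E`. -/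
def dualCovector [FiniteDimensional ℝ E] (x : M) (i : Fin (finrank ℝ E)) :
    TangentSpace 𝓘(ℝ, E) x →L[ℝ] ℝ :=
  (((finBasis ℝ E).coord i).toContinuousLinearMap : E →L[ℝ] ℝ)

/-- The coordinate vector field `∂_i` of the preferred chart at `x`, evaluated at `y` near `x`. -/
def coordVector [IsManifold 𝓘(ℝ, E) ∞ M] [FiniteDimensional ℝ E] (x : M)
    (i : Fin (finrank ℝ E)) (y : M) : TangentSpace 𝓘(ℝ, E) y :=
  (trivializationAt E (TangentSpace 𝓘(ℝ, E)) x).symmL ℝ y (finBasis ℝ E i)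

end Manifold

/-! ### Diffusion operators -/

/-- A diffusion operator on `M`: a linear operator on smooth functions which is a differential
operator of order at most two (its value at `x` vanishes on functions that vanish to second order
at `x`), annihilates constants and is semi-elliptic. As it maps smooth functions to smooth
functions, its coefficients in every chart are smooth. -/
@[ext]
structure DiffusionOperator (E : Type*) [NormedAddCommGroup E] [NormedSpace ℝ E]
    (M : Type*) [TopologicalSpace M] [ChartedSpace E M] where
  /-- the operator -/
  op : C^∞⟮𝓘(ℝ, E), M; 𝓘(ℝ, ℝ), ℝ⟯ →ₗ[ℝ] C^∞⟮𝓘(ℝ, E), M; 𝓘(ℝ, ℝ), ℝ⟯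
  order_two : ∀ (f : C^∞⟮𝓘(ℝ, E), M; 𝓘(ℝ, ℝ), ℝ⟯) (x : M),
    f =o[𝓝 x] (fun y ↦ ‖extChartAt 𝓘(ℝ, E) x y - extChartAt 𝓘(ℝ, E) x x‖ ^ 2) → op f x = 0
  map_one : op 1 = 0
  semi_elliptic : ∀ (f : C^∞⟮𝓘(ℝ, E), M; 𝓘(ℝ, ℝ), ℝ⟯) (x : M),
    0 ≤ (1 / 2 : ℝ) * op (f * f) x - (1 / 2 : ℝ) * (op f x * f x) - (1 / 2 : ℝ) * (f x * op f x)

namespace DiffusionOperator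

variable {E : Type*} [NormedAddCommGroup E] [NormedSpace ℝ E]
  {M : Type*} [TopologicalSpace M] [ChartedSpace E M]

/-- The bilinear expression `½ L(fg) - ½ (Lf) g - ½ f (Lg)`. -/
def gamma (L : DiffusionOperator E M) (f g : C^∞⟮𝓘(ℝ, E), M; 𝓘(ℝ, ℝ), ℝ⟯) :
    C^∞⟮𝓘(ℝ, E), M; 𝓘(ℝ, ℝ), ℝ⟯ :=
  (1 / 2 : ℝ) • L.op (f * g) - (1 / 2 : ℝ) • (L.op f * g) - (1 / 2 : ℝ) • (f * L.op g)

lemma gamma_add_right (L : DiffusionOperator E M) (f g h : C^∞⟮𝓘(ℝ, E), M; 𝓘(ℝ, ℝ), ℝ⟯) :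
    L.gamma f (g + h) = L.gamma f g + L.gamma f h := by
  simp only [gamma, mul_add, map_add, smul_add]; abel

lemma gamma_smul_right (L : DiffusionOperator E M) (c : ℝ)
    (f g : C^∞⟮𝓘(ℝ, E), M; 𝓘(ℝ, ℝ), ℝ⟯) :
    L.gamma f (c • g) = c • L.gamma f g := by
  simp only [gamma, mul_smul_comm, map_smul, smul_sub, smul_comm c]

variable [IsManifold 𝓘(ℝ, E) ∞ M] [FiniteDimensional ℝ E] [T2Space M]

/-- The symbol `σ^L_x : T_x^*M → T_xM`. In the coordinates of the chart at `x` it is the matrix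
`½ L(x^i x^j) - ½ (L x^i) x^j - ½ x^i (L x^j)`; it is characterised by
`df (σ^L_x (dg)) = ½ L(fg) - ½ (Lf) g - ½ f (Lg)`, see `differential_symbol`. -/
def symbol (L : DiffusionOperator E M) (x : M) :
    (TangentSpace 𝓘(ℝ, E) x →L[ℝ] ℝ) →ₗ[ℝ] TangentSpace 𝓘(ℝ, E) x where
  toFun ℓ := ∑ i, L.gamma (coordFun x (dualCovector x i)) (coordFun x ℓ) x •
    coordVector x i x
  map_add' ℓ ℓ' := by
    simp only [map_add, gamma_add_right, ContMDiffMap.coe_add, Pi.add_apply, add_smul,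
      Finset.sum_add_distrib]
  map_smul' c ℓ := by
    simp only [map_smul, gamma_smul_right, ContMDiffMap.coe_smul, Pi.smul_apply, smul_assoc,
      Finset.smul_sum, RingHom.id_apply]

/-- The first order operator `δ^L` on 1-forms. For `φ = ∑ φ_i dx^i` near `x` it is
`δ^L φ (x) = ∑ (dφ_i (σ^L_x (dx^i)) + φ_i(x) L(x^i)(x))`; it is characterised by
`δ^L (f φ) = df (σ^L φ) + f δ^L φ` and `δ^L (df) = L f`,
see `delta_smul` and `delta_differential`. -/
def delta (L : DiffusionOperator E M) (φ : ∀ x : M, TangentSpace 𝓘(ℝ, E) x →L[ℝ] ℝ) (x : M) : ℝ :=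
  ∑ i, (differential (fun y ↦ φ y (coordVector x i y)) x (L.symbol x (dualCovector x i)) +
    φ x (coordVector x i x) * L.op (coordFun x (dualCovector x i)) x)

end DiffusionOperator

/-! The facts down to `delta_differential` show that `symbol` and `delta` are the operators
determined by their characteristic properties; later definitions do not depend on them. -/

section Charts
variable {E : Type*} [NormedAddCommGroup E] [NormedSpace ℝ E]
  {M : Type*} [TopologicalSpace M] [ChartedSpace E M]

lemma chart_hasFDerivAt {f : M → ℝ} {x : M} (hf : MDifferentiableAt 𝓘(ℝ, E) 𝓘(ℝ, ℝ) f x) :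
    HasFDerivAt (fun z : E ↦ f ((extChartAt 𝓘(ℝ, E) x).symm z))
      (asDual (differential f x)) (extChartAt 𝓘(ℝ, E) x x) := by
  have h := hf.hasMFDerivAt.2
  rw [ModelWithCorners.range_eq_univ] at h
  exact HasFDerivWithinAt.hasFDerivAt (E := E) (F := ℝ) h Filter.univ_mem

lemma differential_eq_of_chart {f : M → ℝ} {x : M} {l : E →L[ℝ] ℝ} (hc : ContinuousAt f x)
    (h : HasFDerivAt (fun z : E ↦ f ((extChartAt 𝓘(ℝ, E) x).symm z)) l
      (extChartAt 𝓘(ℝ, E) x x)) : differential f x = l := by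
  have : HasMFDerivAt 𝓘(ℝ, E) 𝓘(ℝ, ℝ) f x l := by
    refine ⟨hc, ?_⟩
    exact HasFDerivAt.hasFDerivWithinAt (E := E) (F := ℝ) h
  exact this.mfderiv

lemma eventually_chart (f : M → ℝ) (x : M) :
    ∀ᶠ y in 𝓝 x, f ((extChartAt 𝓘(ℝ, E) x).symm (extChartAt 𝓘(ℝ, E) x y)) = f y := by
  filter_upwards [extChartAt_source_mem_nhds (I := 𝓘(ℝ, E)) x] with y hy
  rw [(extChartAt 𝓘(ℝ, E) x).left_inv hy]

lemma isLittleO_chart {f : M → ℝ} {x : M} (hf : MDifferentiableAt 𝓘(ℝ, E) 𝓘(ℝ, ℝ) f x) :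
    (fun y ↦ f y - f x - (asDual (differential f x))
      (extChartAt 𝓘(ℝ, E) x y - extChartAt 𝓘(ℝ, E) x x)) =o[𝓝 x]
    (fun y ↦ ‖extChartAt 𝓘(ℝ, E) x y - extChartAt 𝓘(ℝ, E) x x‖) := by
  have h := (chart_hasFDerivAt hf).isLittleO.comp_tendsto (continuousAt_extChartAt (I := 𝓘(ℝ, E)) x)
  refine (h.norm_right.congr' ?_ (Filter.Eventually.of_forall fun y ↦ rfl))
  filter_upwards [eventually_chart (E := E) f x] with y hy
  simp only [Function.comp_apply, hy, extChartAt_to_inv]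

lemma isBigO_chart {f : M → ℝ} {x : M} (hf : MDifferentiableAt 𝓘(ℝ, E) 𝓘(ℝ, ℝ) f x) :
    (fun y ↦ f y - f x) =O[𝓝 x]
    (fun y ↦ ‖extChartAt 𝓘(ℝ, E) x y - extChartAt 𝓘(ℝ, E) x x‖) := by
  have h1 := (isLittleO_chart hf).isBigO
  have h2 : (fun y ↦ (asDual (differential f x))
      (extChartAt 𝓘(ℝ, E) x y - extChartAt 𝓘(ℝ, E) x x)) =O[𝓝 x]
    (fun y ↦ ‖extChartAt 𝓘(ℝ, E) x y - extChartAt 𝓘(ℝ, E) x x‖) :=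
    ((asDual (differential f x)).isBigO_comp _ _).norm_right
  exact (h1.add h2).congr_left fun y ↦ by ring

lemma mdiffAt (f : C^∞⟮𝓘(ℝ, E), M; 𝓘(ℝ, ℝ), ℝ⟯) (x : M) :
    MDifferentiableAt 𝓘(ℝ, E) 𝓘(ℝ, ℝ) f x :=
  f.contMDiff.mdifferentiableAt (by simp)

variable [IsManifold 𝓘(ℝ, E) ∞ M] [FiniteDimensional ℝ E] [T2Space M]

lemma coordFun_eventuallyEq (x : M) (l : TangentSpace 𝓘(ℝ, E) x →L[ℝ] ℝ) :
    ∀ᶠ y in 𝓝 x, coordFun x l y =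
      (asDual l) (extChartAt 𝓘(ℝ, E) x y - extChartAt 𝓘(ℝ, E) x x) := by
  filter_upwards [(Classical.arbitrary (SmoothBumpFunction 𝓘(ℝ, E) x)).eventuallyEq_one] with y hy
  change (Classical.arbitrary (SmoothBumpFunction 𝓘(ℝ, E) x)) y • (asDual l _) = _
  rw [hy]; simp

lemma coordFun_self (x : M) (l : TangentSpace 𝓘(ℝ, E) x →L[ℝ] ℝ) : coordFun x l x = 0 := by
  rw [(coordFun_eventuallyEq x l).self_of_nhds, sub_self, map_zero]

lemma differential_coordFun (x : M) (l : TangentSpace 𝓘(ℝ, E) x →L[ℝ] ℝ) :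
    differential (coordFun x l) x = l := by
  refine differential_eq_of_chart (coordFun x l).contMDiff.continuous.continuousAt ?_
  have h : HasFDerivAt (fun z : E ↦ (asDual l) (z - extChartAt 𝓘(ℝ, E) x x)) l
      (extChartAt 𝓘(ℝ, E) x x) := by
    have := (asDual l).hasFDerivAt (x := extChartAt 𝓘(ℝ, E) x x)
    simp only [map_sub]
    exact this.sub_const ((asDual l) (extChartAt 𝓘(ℝ, E) x x))
  refine h.congr_of_eventuallyEq ?_
  have ht : Filter.Tendsto (extChartAt 𝓘(ℝ, E) x).symm (𝓝 (extChartAt 𝓘(ℝ, E) x x)) (𝓝 x) := by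
    have := continuousAt_extChartAt_symm (I := 𝓘(ℝ, E)) x
    simpa [ContinuousAt] using this
  filter_upwards [ht.eventually (coordFun_eventuallyEq x l), extChartAt_target_mem_nhds (I := 𝓘(ℝ, E)) x] with z hz hz'
  rw [hz, (extChartAt 𝓘(ℝ, E) x).right_inv hz']
end Charts

namespace DiffusionOperator
variable {E : Type*} [NormedAddCommGroup E] [NormedSpace ℝ E]
  {M : Type*} [TopologicalSpace M] [ChartedSpace E M]

lemma gamma_comm (L : DiffusionOperator E M) (f g : C^∞⟮𝓘(ℝ, E), M; 𝓘(ℝ, ℝ), ℝ⟯) :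
    L.gamma f g = L.gamma g f := by
  unfold gamma
  rw [mul_comm f g, mul_comm (L.op f) g, mul_comm f (L.op g)]; abel

lemma gamma_sum_right {ι : Type*} (L : DiffusionOperator E M) (s : Finset ι)
    (f : C^∞⟮𝓘(ℝ, E), M; 𝓘(ℝ, ℝ), ℝ⟯) (g : ι → C^∞⟮𝓘(ℝ, E), M; 𝓘(ℝ, ℝ), ℝ⟯) (c : ι → ℝ) (x : M) :
    L.gamma f (∑ i ∈ s, c i • g i) x = ∑ i ∈ s, c i * L.gamma f (g i) x := by
  classical
  induction s using Finset.induction_on with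
  | empty =>
    have := L.gamma_smul_right 0 f f
    simp only [zero_smul] at this
    simp [this]
  | insert a s ha ih =>
    rw [Finset.sum_insert ha, Finset.sum_insert ha, gamma_add_right, gamma_smul_right,
      ContMDiffMap.coe_add, Pi.add_apply, ih]
    simp

lemma gamma_apply (L : DiffusionOperator E M) (f g : C^∞⟮𝓘(ℝ, E), M; 𝓘(ℝ, ℝ), ℝ⟯) (x : M) :
    L.gamma f g x = (1 / 2 : ℝ) * L.op (f * g) x - (1 / 2 : ℝ) * (L.op f x * g x)
      - (1 / 2 : ℝ) * (f x * L.op g x) := rfl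

lemma gamma_eq_zero (L : DiffusionOperator E M) (f g : C^∞⟮𝓘(ℝ, E), M; 𝓘(ℝ, ℝ), ℝ⟯) (x : M)
    (hf : (fun y ↦ f y - f x) =o[𝓝 x]
      (fun y ↦ ‖extChartAt 𝓘(ℝ, E) x y - extChartAt 𝓘(ℝ, E) x x‖)) :
    L.gamma f g x = 0 := by
  have h := L.order_two ((f - f x • 1) * (g - g x • 1)) x (by
    have := hf.mul_isBigO (isBigO_chart (mdiffAt g x))
    refine (this.congr_left fun y ↦ ?_).congr_right fun y ↦ ?_
    · change _ = (f y - f x * 1) * (g y - g x * 1); ring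
    · ring)
  have h2 : (f - f x • 1) * (g - g x • 1) =
      f * g - g x • f - f x • g + (f x * g x) • (1 : C^∞⟮𝓘(ℝ, E), M; 𝓘(ℝ, ℝ), ℝ⟯) := by
    ext y
    change (f y - f x * 1) * (g y - g x * 1) = f y * g y - g x * f y - f x * g y + (f x * g x) * 1
    ring
  rw [h2] at h
  simp only [map_add, map_sub, map_smul, L.map_one] at h
  have h3 : L.op (f * g) x - g x * L.op f x - f x * L.op g x + (f x * g x) * 0 = 0 := h
  rw [gamma_apply]; linarith

lemma symmL_self [IsManifold 𝓘(ℝ, E) ∞ M] (x : M) (v : E) :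
    (trivializationAt E (TangentSpace 𝓘(ℝ, E)) x).symmL ℝ x v = v := by
  rw [TangentBundle.symmL_trivializationAt_eq_core (mem_chart_source E x)]
  exact (tangentBundleCore 𝓘(ℝ, E) M).coordChange_self (achart E x) x (mem_chart_source E x) v

lemma covector_eq_sum [IsManifold 𝓘(ℝ, E) ∞ M] [FiniteDimensional ℝ E] (x : M) (l : TangentSpace 𝓘(ℝ, E) x →L[ℝ] ℝ) :
    l = ∑ i, l (coordVector x i x) • dualCovector x i := by
  refine ContinuousLinearMap.ext fun v ↦ ?_
  have hv : v = ∑ i, (finBasis ℝ E).repr v i • (show TangentSpace 𝓘(ℝ, E) x from finBasis ℝ E i) :=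
    ((finBasis ℝ E).sum_repr v).symm
  have h1 : ∀ i, (coordVector x i x) = (show TangentSpace 𝓘(ℝ, E) x from finBasis ℝ E i) :=
    fun i ↦ symmL_self (E := E) x _
  conv_lhs => rw [hv]
  rw [map_sum, sum_apply]
  refine Finset.sum_congr rfl fun i _ ↦ ?_
  rw [h1, map_smul]
  exact mul_comm _ _

variable [IsManifold 𝓘(ℝ, E) ∞ M] [FiniteDimensional ℝ E] [T2Space M]

lemma gamma_coordFun_left (L : DiffusionOperator E M) (f g : C^∞⟮𝓘(ℝ, E), M; 𝓘(ℝ, ℝ), ℝ⟯) (x : M) :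
    L.gamma (coordFun x (differential f x)) g x = L.gamma f g x := by
  have h : L.gamma (f + (-1 : ℝ) • coordFun x (differential f x)) g x = 0 := by
    apply gamma_eq_zero
    refine (isLittleO_chart (mdiffAt f x)).congr' ?_ (Filter.EventuallyEq.refl _ _)
    filter_upwards [coordFun_eventuallyEq x (differential (E := E) f x)] with y hy
    change _ = (f y + (-1) * coordFun x (differential (E := E) f x) y) -
      (f x + (-1) * coordFun x (differential (E := E) f x) x)
    rw [hy, coordFun_self]; ring
  rw [gamma_comm, gamma_add_right, gamma_smul_right] at h
  have h' : L.gamma g f x + (-1) * L.gamma g (coordFun x (differential f x)) x = 0 := h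
  rw [gamma_comm, gamma_comm L f]; linarith

/-- The symbol is determined by `df (σ^L (dg)) = ½ L(fg) - ½ (Lf) g - ½ f (Lg)`. -/
theorem differential_symbol (L : DiffusionOperator E M) (f g : C^∞⟮𝓘(ℝ, E), M; 𝓘(ℝ, ℝ), ℝ⟯)
    (x : M) :
    differential f x (L.symbol x (differential g x)) =
      (1 / 2 : ℝ) * L.op (f * g) x - (1 / 2 : ℝ) * (L.op f x * g x)
        - (1 / 2 : ℝ) * (f x * L.op g x) := by
  rw [← gamma_apply, ← gamma_coordFun_left, gamma_comm, ← gamma_coordFun_left]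
  conv_rhs => rw [covector_eq_sum x (differential f x), map_sum]
  simp only [map_smul, gamma_sum_right]
  simp only [symbol, LinearMap.coe_mk, AddHom.coe_mk, map_sum, map_smul, smul_eq_mul]
  refine Finset.sum_congr rfl fun i _ ↦ ?_
  rw [L.gamma_comm, mul_comm]

end DiffusionOperator

section Trapezoid
variable {E : Type*} [NormedAddCommGroup E] [NormedSpace ℝ E]

lemma eventually_fderiv_close {G : Type*} [NormedAddCommGroup G] [NormedSpace ℝ G] {D : E → G}
    {a : E} (hD : ContDiffAt ℝ ∞ D a) {ε : ℝ} (hε : 0 < ε) :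
    ∀ᶠ z in 𝓝 a, ‖fderiv ℝ D z - fderiv ℝ D a‖ ≤ ε := by
  have h : ContinuousAt (fderiv ℝ D) a := (hD.fderiv_right (m := ∞) (by simp)).continuousAt
  filter_upwards [Metric.tendsto_nhds.1 h.tendsto ε hε] with z hz
  rw [← dist_eq_norm]
  exact hz.le

/-- The trapezoidal rule is exact to second order. -/
lemma trapezoid_isLittleO {f : E → ℝ} {a : E} (hf : ContDiffAt ℝ ∞ f a) :
    (fun z ↦ f z - f a - (1 / 2 : ℝ) * fderiv ℝ f a (z - a) - (1 / 2 : ℝ) * fderiv ℝ f z (z - a))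
      =o[𝓝 a] (fun z ↦ ‖z - a‖ ^ 2) := by
  set D := fderiv ℝ f with hD
  have hDs : ContDiffAt ℝ ∞ D a := hf.fderiv_right (by simp)
  set D2 := fderiv ℝ D with hD2
  have hsymm : ∀ᶠ z in 𝓝 a, ∀ v w, D2 z v w = D2 z w v := by
    have := (hf.of_le (show (2 : ℕ∞ω) ≤ ∞ from WithTop.coe_le_coe.2 le_top)).eventually (by simp)
    filter_upwards [this] with z hz v w
    exact (hz.isSymmSndFDerivAt (by simp)).eq v w
  have hdf : ∀ᶠ z in 𝓝 a, DifferentiableAt ℝ f z := by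
    have := (hf.of_le (show (1 : ℕ∞ω) ≤ ∞ from WithTop.coe_le_coe.2 le_top)).eventually (by simp)
    filter_upwards [this] with z hz using hz.differentiableAt (by simp)
  have hdD : ∀ᶠ z in 𝓝 a, DifferentiableAt ℝ D z := by
    have := (hDs.of_le (show (1 : ℕ∞ω) ≤ ∞ from WithTop.coe_le_coe.2 le_top)).eventually (by simp)
    filter_upwards [this] with z hz using hz.differentiableAt (by simp)
  have hlo := (hDs.differentiableAt (by simp)).hasFDerivAt.isLittleO
  rw [Asymptotics.isLittleO_iff]
  intro ε hε
  have h1 : ∀ᶠ z in 𝓝 a, ‖D z - D a - D2 a (z - a)‖ ≤ ε * ‖z - a‖ :=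
    (Asymptotics.isLittleO_iff.1 hlo hε)
  have h2 : ∀ᶠ z in 𝓝 a, ‖D2 z - D2 a‖ ≤ ε :=
    eventually_fderiv_close hDs hε
  obtain ⟨r, hr, hball⟩ := Metric.eventually_nhds_iff_ball.1
    (hsymm.and (hdf.and (hdD.and (h1.and h2))))
  filter_upwards [Metric.ball_mem_nhds a hr] with z hz
  set h : E → ℝ := fun z ↦ f z - f a - (1 / 2 : ℝ) * D a (z - a) - (1 / 2 : ℝ) * D z (z - a)
  set h' : E → (E →L[ℝ] ℝ) := fun w ↦ D w - (1 / 2 : ℝ) • D a -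
    (1 / 2 : ℝ) • (D w + (D2 w).flip (w - a))
  have hsub : ∀ w ∈ Metric.closedBall a ‖z - a‖, w ∈ Metric.ball a r := by
    intro w hw
    rw [Metric.mem_closedBall] at hw
    rw [Metric.mem_ball, dist_eq_norm] at hz
    rw [Metric.mem_ball]
    exact hw.trans_lt hz
  have hder : ∀ w ∈ Metric.closedBall a ‖z - a‖, HasFDerivWithinAt h (h' w)
      (Metric.closedBall a ‖z - a‖) w := by
    intro w hw
    obtain ⟨-, hf', hD', -⟩ := hball w (hsub w hw)
    have hs : HasFDerivAt (fun z : E ↦ z - a) (ContinuousLinearMap.id ℝ E) w :=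
      (hasFDerivAt_id w).sub_const a
    have e1 : HasFDerivAt (fun z : E ↦ D a (z - a)) (D a) w := by
      exact (D a).hasFDerivAt.comp w hs
    have e2 : HasFDerivAt (fun z : E ↦ D z (z - a)) (D w + (D2 w).flip (w - a)) w := by
      simpa using hD'.hasFDerivAt.clm_apply hs
    have e3 := ((hf'.hasFDerivAt.sub_const (f a)).sub (e1.const_mul (1 / 2 : ℝ))).sub
      (e2.const_mul (1 / 2 : ℝ))
    exact e3.hasFDerivWithinAt
  have hbound : ∀ w ∈ Metric.closedBall a ‖z - a‖, ‖h' w‖ ≤ ε * ‖z - a‖ := by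
    intro w hw
    obtain ⟨hsy, -, -, b1, b2⟩ := hball w (hsub w hw)
    have hwz : ‖w - a‖ ≤ ‖z - a‖ := by rw [← dist_eq_norm]; exact hw
    have key : h' w = (1 / 2 : ℝ) • ((D w - D a - D2 a (w - a)) - (D2 w - D2 a) (w - a)) := by
      refine ContinuousLinearMap.ext fun v ↦ ?_
      have := hsy v (w - a)
      simp only [h', sub_apply, smul_apply, add_apply, ContinuousLinearMap.flip_apply, smul_eq_mul]
      rw [this]; ring
    rw [key, norm_smul]
    have b3 : ‖(D2 w - D2 a) (w - a)‖ ≤ ε * ‖w - a‖ :=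
      (ContinuousLinearMap.le_opNorm _ _).trans (mul_le_mul_of_nonneg_right b2 (norm_nonneg _))
    have b4 := norm_sub_le (D w - D a - D2 a (w - a)) ((D2 w - D2 a) (w - a))
    have b5 : ε * ‖w - a‖ ≤ ε * ‖z - a‖ := mul_le_mul_of_nonneg_left hwz hε.le
    have : ‖(1 / 2 : ℝ)‖ = 1 / 2 := by norm_num
    rw [this]; linarith
  have := (convex_closedBall a ‖z - a‖).norm_image_sub_le_of_norm_hasFDerivWithin_le hder hbound
    (Metric.mem_closedBall_self (norm_nonneg _)) (y := z) (by simp [dist_eq_norm])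
  have h0 : h a = 0 := by simp [h]
  rw [h0, sub_zero] at this
  rw [norm_pow, norm_norm]
  calc ‖h z‖ ≤ _ := this
    _ = _ := by ring
end Trapezoid

section Chart
variable {E : Type*} [NormedAddCommGroup E] [NormedSpace ℝ E]
  {M : Type*} [TopologicalSpace M] [ChartedSpace E M] [IsManifold 𝓘(ℝ, E) ∞ M]

lemma chart_contDiffOn (f : C^∞⟮𝓘(ℝ, E), M; 𝓘(ℝ, ℝ), ℝ⟯) (x : M) :
    ContDiffOn ℝ ∞ (fun z : E ↦ f ((extChartAt 𝓘(ℝ, E) x).symm z))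
      (extChartAt 𝓘(ℝ, E) x).target := by
  have h := f.contMDiff.comp_contMDiffOn (contMDiffOn_extChartAt_symm (n := ∞) (I := 𝓘(ℝ, E)) x)
  exact h.contDiffOn

lemma differential_symmL (f : C^∞⟮𝓘(ℝ, E), M; 𝓘(ℝ, ℝ), ℝ⟯) {x y : M}
    (hy : y ∈ (chartAt E x).source) (v : E) :
    differential f y ((trivializationAt E (TangentSpace 𝓘(ℝ, E)) x).symmL ℝ y v) =
      fderiv ℝ (fun z : E ↦ f ((extChartAt 𝓘(ℝ, E) x).symm z)) (extChartAt 𝓘(ℝ, E) x y) v := by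
  have hy' : y ∈ (extChartAt 𝓘(ℝ, E) x).source := by simpa using hy
  have hz : extChartAt 𝓘(ℝ, E) x y ∈ (extChartAt 𝓘(ℝ, E) x).target :=
    (extChartAt 𝓘(ℝ, E) x).map_source hy'
  have hinv : (extChartAt 𝓘(ℝ, E) x).symm (extChartAt 𝓘(ℝ, E) x y) = y :=
    (extChartAt 𝓘(ℝ, E) x).left_inv hy'
  rw [TangentBundle.symmL_trivializationAt hy]
  rw [ModelWithCorners.range_eq_univ, mfderivWithin_univ]
  have h1 : MDifferentiableAt 𝓘(ℝ, E) 𝓘(ℝ, E) (extChartAt 𝓘(ℝ, E) x).symm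
      (extChartAt 𝓘(ℝ, E) x y) :=
    ((contMDiffOn_extChartAt_symm (n := ∞) (I := 𝓘(ℝ, E)) x).contMDiffAt
      (extChartAt_target_mem_nhds' hz)).mdifferentiableAt (by simp)
  have h2 := mfderiv_comp_of_eq (g := f) (mdiffAt f y) h1 hinv
  rw [← mfderiv_eq_fderiv]
  have h3 : (fun z : E ↦ f ((extChartAt 𝓘(ℝ, E) x).symm z)) = f ∘ (extChartAt 𝓘(ℝ, E) x).symm := rfl
  rw [h3, h2, hinv]
  rfl
end Chart

section Delta
variable {E : Type*} [NormedAddCommGroup E] [NormedSpace ℝ E]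
  {M : Type*} [TopologicalSpace M] [ChartedSpace E M] [IsManifold 𝓘(ℝ, E) ∞ M]
  [FiniteDimensional ℝ E]

/-- The coefficient `φ_i` of a 1-form in the chart at `x` is differentiable at `x`. -/
lemma mdifferentiableAt_coeff {φ : ∀ x : M, TangentSpace 𝓘(ℝ, E) x →L[ℝ] ℝ}
    (hφ : IsOneForm 1 φ) (x : M) (i : Fin (finrank ℝ E)) :
    MDifferentiableAt 𝓘(ℝ, E) 𝓘(ℝ, ℝ) (fun y ↦ φ y (coordVector x i y)) x := by
  have hv := contMDiffAt_localFrame_of_mem (I := 𝓘(ℝ, E)) 1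
    (trivializationAt E (TangentSpace 𝓘(ℝ, E)) x) (finBasis ℝ E) i
    (mem_baseSet_trivializationAt E (TangentSpace 𝓘(ℝ, E)) x)
  have hv' : ContMDiffAt 𝓘(ℝ, E) 𝓘(ℝ, E).tangent 1
      (fun y ↦ TotalSpace.mk' E y (coordVector x i y)) x := by
    refine hv.congr_of_eventuallyEq ?_
    filter_upwards [(trivializationAt E (TangentSpace 𝓘(ℝ, E)) x).open_baseSet.mem_nhds
      (mem_baseSet_trivializationAt E (TangentSpace 𝓘(ℝ, E)) x)] with y hy
    rw [Trivialization.localFrame_apply_of_mem_baseSet _ _ hy]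
    simp [coordVector, Trivialization.basisAt, Trivialization.symmL_apply _ hy]
  have h := (hφ x).clm_bundle_apply hv'
  rw [contMDiffAt_section] at h
  exact h.mdifferentiableAt (by simp)

namespace DiffusionOperator
variable [T2Space M]

/-- `δ^L (f φ) = df (σ^L φ) + f δ^L φ`. -/
theorem delta_smul (L : DiffusionOperator E M) {f : M → ℝ}
    {φ : ∀ x : M, TangentSpace 𝓘(ℝ, E) x →L[ℝ] ℝ} {x : M}
    (hf : MDifferentiableAt 𝓘(ℝ, E) 𝓘(ℝ, ℝ) f x) (hφ : IsOneForm 1 φ) :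
    L.delta (fun y ↦ f y • φ y) x =
      differential f x (L.symbol x (φ x)) + f x * L.delta φ x := by
  have h1 : ∀ i, differential (E := E) (fun y ↦ (f y • φ y) (coordVector x i y)) x =
      f x • differential (fun y ↦ φ y (coordVector x i y)) x +
        φ x (coordVector x i x) • differential f x := by
    intro i
    have h2 := (hf.hasMFDerivAt.mul (mdifferentiableAt_coeff hφ x i).hasMFDerivAt).mfderiv
    refine h2.trans ?_
    rfl
  have h3 : differential f x (L.symbol x (φ x)) =
      ∑ i, φ x (coordVector x i x) * differential f x (L.symbol x (dualCovector x i)) := by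
    conv_lhs => rw [covector_eq_sum x (φ x)]
    simp only [map_sum, map_smul, smul_eq_mul]
  simp only [delta, h1, h3, Finset.mul_sum, ← Finset.sum_add_distrib]
  refine Finset.sum_congr rfl fun i _ ↦ ?_
  simp only [add_apply, smul_apply, smul_eq_mul]
  ring

/-- `δ^L (df) = L f`. -/
theorem delta_differential (L : DiffusionOperator E M) (f : C^∞⟮𝓘(ℝ, E), M; 𝓘(ℝ, ℝ), ℝ⟯) (x : M) :
    L.delta (fun y ↦ differential f y) x = L.op f x := by
  set c : E → ℝ := fun z : E ↦ f ((extChartAt 𝓘(ℝ, E) x).symm z) with hc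
  have hcs : ContDiffOn ℝ ∞ c (extChartAt 𝓘(ℝ, E) x).target := chart_contDiffOn f x
  have hdc : ContDiffOn ℝ ∞ (fderiv ℝ c) (extChartAt 𝓘(ℝ, E) x).target :=
    hcs.fderiv_of_isOpen (isOpen_extChartAt_target x) (by simp)
  let b := Classical.arbitrary (SmoothBumpFunction 𝓘(ℝ, E) x)
  let F : Fin (finrank ℝ E) → C^∞⟮𝓘(ℝ, E), M; 𝓘(ℝ, ℝ), ℝ⟯ := fun i ↦
    ⟨fun y ↦ (b y : ℝ) • (fderiv ℝ c (extChartAt 𝓘(ℝ, E) x y) (finBasis ℝ E i) : ℝ), by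
      apply SmoothBumpFunction.contMDiff_smul
      have h1 : ContMDiffOn 𝓘(ℝ, E) 𝓘(ℝ, E) ∞ (extChartAt 𝓘(ℝ, E) x) (chartAt E x).source :=
        contMDiffOn_extChartAt
      have h2 : ContDiffOn ℝ ∞ (fun z ↦ fderiv ℝ c z (finBasis ℝ E i))
        (extChartAt 𝓘(ℝ, E) x).target := hdc.clm_apply contDiffOn_const
      refine h2.contMDiffOn.comp h1 fun y hy ↦ ?_
      exact (extChartAt 𝓘(ℝ, E) x).map_source (by simpa using hy)⟩
  have hF : ∀ᶠ y in 𝓝 x, ∀ i, F i y =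
      fderiv ℝ c (extChartAt 𝓘(ℝ, E) x y) (finBasis ℝ E i) := by
    filter_upwards [b.eventuallyEq_one] with y hy i
    change b y • (fderiv ℝ c (extChartAt 𝓘(ℝ, E) x y) (finBasis ℝ E i) : ℝ) = _
    rw [hy]; simp
  have hsrc : ∀ᶠ y in 𝓝 x, y ∈ (chartAt E x).source := (chartAt E x).open_source.mem_nhds
    (mem_chart_source E x)
  have hF' : ∀ i, (fun y ↦ differential (E := E) f y (coordVector x i y)) =ᶠ[𝓝 x] F i := by
    intro i
    filter_upwards [hF, hsrc] with y hy hs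
    rw [hy i]
    exact differential_symmL f hs _
  have hdF : ∀ i, differential (E := E) (fun y ↦ differential (E := E) f y (coordVector x i y)) x =
      differential (E := E) (F i) x := fun i ↦ (hF' i).mfderiv_eq
  set X : Fin (finrank ℝ E) → C^∞⟮𝓘(ℝ, E), M; 𝓘(ℝ, ℝ), ℝ⟯ :=
    fun i ↦ coordFun x (dualCovector x i)
  have hX0 : ∀ i, X i x = 0 := fun i ↦ coordFun_self x _
  have hX : ∀ᶠ y in 𝓝 x, ∀ i, X i y =
      (finBasis ℝ E).repr (extChartAt 𝓘(ℝ, E) x y - extChartAt 𝓘(ℝ, E) x x) i := by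
    rw [Filter.eventually_all]
    exact fun i ↦ coordFun_eventuallyEq x _
  -- the trapezoidal approximation of `f`
  have hz := L.order_two (f - f x • 1 - ∑ i, ((1 / 2 : ℝ) * F i x) • X i -
      ∑ i, (1 / 2 : ℝ) • (F i * X i)) x (by
    have ht := (trapezoid_isLittleO (hcs.contDiffAt (extChartAt_target_mem_nhds (I := 𝓘(ℝ, E)) x))).comp_tendsto
      (continuousAt_extChartAt (I := 𝓘(ℝ, E)) x)
    refine ht.congr' ?_ (Filter.EventuallyEq.refl _ _)
    filter_upwards [hF, hX, hsrc] with y h1 h2 h3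
    have e1 : ∀ l : E →L[ℝ] ℝ, ∀ v : E, l v = ∑ i, l (finBasis ℝ E i) * (finBasis ℝ E).repr v i := by
      intro l v
      conv_lhs => rw [← (finBasis ℝ E).sum_repr v]
      simp only [map_sum, map_smul, smul_eq_mul, mul_comm]
    have e2 : c (extChartAt 𝓘(ℝ, E) x y) = f y := by
      simp only [hc]
      rw [(extChartAt 𝓘(ℝ, E) x).left_inv (by simpa using h3)]
    have e3 : c (extChartAt 𝓘(ℝ, E) x x) = f x := by simp only [hc, extChartAt_to_inv]
    have e4 : (f - f x • 1 - ∑ i, ((1 / 2 : ℝ) * F i x) • X i -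
      ∑ i, (1 / 2 : ℝ) • (F i * X i)) y = f y - f x - ∑ i, ((1 / 2 : ℝ) * F i x) * X i y -
      ∑ i, (1 / 2 : ℝ) * (F i y * X i y) := by
      have s1 : ∀ g : Fin (finrank ℝ E) → C^∞⟮𝓘(ℝ, E), M; 𝓘(ℝ, ℝ), ℝ⟯,
          (∑ i, g i) y = ∑ i, g i y := fun g ↦ by
        exact map_sum (ContMDiffMap.evalRingHom (I := 𝓘(ℝ, E)) (n := ∞) (R := ℝ) (I' := 𝓘(ℝ, ℝ)) y) g _
      change f y - f x * 1 - (∑ i, ((1 / 2 : ℝ) * F i x) • X i) y -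
        (∑ i, (1 / 2 : ℝ) • (F i * X i)) y = _
      rw [s1, s1, mul_one]
      rfl
    rw [e4]
    simp only [Function.comp_apply, e2, e3]
    rw [e1 (fderiv ℝ c (extChartAt 𝓘(ℝ, E) x x)), e1 (fderiv ℝ c (extChartAt 𝓘(ℝ, E) x y))]
    simp only [h1, h2, hF.self_of_nhds, Finset.mul_sum, mul_assoc])
  have s2 : ∀ g : Fin (finrank ℝ E) → C^∞⟮𝓘(ℝ, E), M; 𝓘(ℝ, ℝ), ℝ⟯,
      (∑ i, g i) x = ∑ i, g i x := fun g ↦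
    map_sum (ContMDiffMap.evalRingHom (I := 𝓘(ℝ, E)) (n := ∞) (R := ℝ) (I' := 𝓘(ℝ, ℝ)) x) g _
  simp only [map_sub, map_sum, map_smul, L.map_one] at hz
  have hz' : L.op f x - f x * 0 - (∑ i, ((1 / 2 : ℝ) * F i x) • L.op (X i)) x -
      (∑ i, (1 / 2 : ℝ) • L.op (F i * X i)) x = 0 := hz
  rw [s2, s2] at hz'
  have hz2 : L.op f x = ∑ i, ((1 / 2 : ℝ) * F i x * L.op (X i) x) +
      ∑ i, (1 / 2 : ℝ) * L.op (F i * X i) x := by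
    have : L.op f x - f x * 0 - (∑ i, ((1 / 2 : ℝ) * F i x * L.op (X i) x)) -
      (∑ i, (1 / 2 : ℝ) * L.op (F i * X i) x) = 0 := hz'
    linarith
  rw [hz2, ← Finset.sum_add_distrib, delta]
  refine Finset.sum_congr rfl fun i _ ↦ ?_
  have h5 := L.differential_symbol (F i) (X i) x
  rw [hX0] at h5
  have h6 : differential (X i) x = dualCovector x i := differential_coordFun x _
  rw [h6] at h5
  have h7 : differential (E := E) f x (coordVector x i x) = F i x := (hF' i).self_of_nhds
  have h8 : coordFun x (dualCovector x i) = X i := rfl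
  rw [hdF, h5, h7, h8]
  ring

end DiffusionOperator
end Delta

/-! ### Operators along a distribution, cohesive operators -/

namespace DiffusionOperator

variable {E : Type*} [NormedAddCommGroup E] [NormedSpace ℝ E]
  {M : Type*} [TopologicalSpace M] [ChartedSpace E M]
  [IsManifold 𝓘(ℝ, E) ∞ M] [FiniteDimensional ℝ E] [T2Space M]

/-- `L` is along the distribution `S`: `δ^L φ = 0` for all `C^1` 1-forms `φ` vanishing on `S`. -/
def IsAlong (L : DiffusionOperator E M)
    (S : ∀ x : M, Submodule ℝ (TangentSpace 𝓘(ℝ, E) x)) : Prop :=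
  ∀ φ : ∀ x : M, TangentSpace 𝓘(ℝ, E) x →L[ℝ] ℝ, IsOneForm 1 φ →
    (∀ x, ∀ v ∈ S x, φ x v = 0) → ∀ x, L.delta φ x = 0

/-- The image of the symbol. -/
def symbolRange (L : DiffusionOperator E M) (x : M) : Submodule ℝ (TangentSpace 𝓘(ℝ, E) x) :=
  LinearMap.range (L.symbol x)

/-- The symbol has constant rank. -/
def HasConstantRank (L : DiffusionOperator E M) : Prop :=
  ∃ r : ℕ, ∀ x, finrank ℝ (L.symbolRange x) = r

/-- `L` is cohesive: its symbol has constant non-zero rank and `L` is along the image of its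
symbol. -/
def IsCohesive (L : DiffusionOperator E M) : Prop :=
  (∃ r : ℕ, r ≠ 0 ∧ ∀ x, finrank ℝ (L.symbolRange x) = r) ∧ L.IsAlong L.symbolRange

end DiffusionOperator

/-! ### Principal bundles

The right action of `G` on `P` is written as an action of the opposite group: `u · g` is
`MulOpposite.op g • u`. -/

section LieGroup

variable (EG : Type*) [NormedAddCommGroup EG] [NormedSpace ℝ EG]
  {G : Type*} [TopologicalSpace G] [ChartedSpace EG G] [Group G]

/-- The adjoint action of `g` on the Lie algebra: the derivative at `1` of `h ↦ g h g⁻¹`. -/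
def Ad (g : G) : GroupLieAlgebra 𝓘(ℝ, EG) G →L[ℝ] GroupLieAlgebra 𝓘(ℝ, EG) G :=
  mfderiv 𝓘(ℝ, EG) 𝓘(ℝ, EG) (fun h : G ↦ g * h * g⁻¹) 1

end LieGroup

section Principal

variable {EM : Type*} [NormedAddCommGroup EM] [NormedSpace ℝ EM]
  {M : Type*} [TopologicalSpace M] [ChartedSpace EM M]
  {EP : Type*} [NormedAddCommGroup EP] [NormedSpace ℝ EP]
  {P : Type*} [TopologicalSpace P] [ChartedSpace EP P]
  (EG : Type*) [NormedAddCommGroup EG] [NormedSpace ℝ EG]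
  (G : Type*) [TopologicalSpace G] [ChartedSpace EG G] [Group G] [MulAction Gᵐᵒᵖ P]

/-- `p : P → M` is a smooth principal `G`-bundle: the smooth right action of `G` on `P` preserves
the fibres, and over a neighbourhood `U` of every point of `M` there is a smooth trivialization
`p⁻¹(U) ≅ U × G` which is equivariant for right multiplication on `G`. -/
structure IsPrincipalBundle (p : C^∞⟮𝓘(ℝ, EP), P; 𝓘(ℝ, EM), M⟯) : Prop where
  smooth_action : ContMDiff (𝓘(ℝ, EP).prod 𝓘(ℝ, EG)) 𝓘(ℝ, EP) ∞
    (fun q : P × G ↦ MulOpposite.op q.2 • q.1)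
  proj_smul : ∀ (g : G) (u : P), p (MulOpposite.op g • u) = p u
  locally_trivial : ∀ x : M, ∃ (U : Set M) (e : OpenPartialHomeomorph P (M × G)),
    IsOpen U ∧ x ∈ U ∧ e.source = p ⁻¹' U ∧ e.target = U ×ˢ Set.univ ∧
    ContMDiffOn 𝓘(ℝ, EP) (𝓘(ℝ, EM).prod 𝓘(ℝ, EG)) ∞ e e.source ∧
    ContMDiffOn (𝓘(ℝ, EM).prod 𝓘(ℝ, EG)) 𝓘(ℝ, EP) ∞ e.symm e.target ∧
    (∀ u ∈ e.source, (e u).1 = p u) ∧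
    ∀ u ∈ e.source, ∀ g : G, e (MulOpposite.op g • u) = ((e u).1, (e u).2 * g)

variable {EG G}

/-- Right translation `R_a u = u · a`. -/
def IsPrincipalBundle.rightTranslation {p : C^∞⟮𝓘(ℝ, EP), P; 𝓘(ℝ, EM), M⟯}
    (hp : IsPrincipalBundle EG G p) (a : G) : C^∞⟮𝓘(ℝ, EP), P; 𝓘(ℝ, EP), P⟯ :=
  ⟨fun u ↦ MulOpposite.op a • u, hp.smooth_action.comp (contMDiff_id.prodMk contMDiff_const)⟩

/-- `B` is equivariant: `B (f ∘ R_a) = (B f) ∘ R_a`. -/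
def IsPrincipalBundle.IsEquivariant {p : C^∞⟮𝓘(ℝ, EP), P; 𝓘(ℝ, EM), M⟯}
    (hp : IsPrincipalBundle EG G p) (B : DiffusionOperator EP P) : Prop :=
  ∀ (a : G) (f : C^∞⟮𝓘(ℝ, EP), P; 𝓘(ℝ, ℝ), ℝ⟯),
    B.op (f.comp (hp.rightTranslation a)) = (B.op f).comp (hp.rightTranslation a)

variable (EG) in
/-- `A ↦ A^*(u)`, the value at `u` of the fundamental vector field of `A ∈ 𝔤`: the derivative at
`1` of `g ↦ u · g`, applied to `A`. -/
def fundamental (u : P) : GroupLieAlgebra 𝓘(ℝ, EG) G →L[ℝ] TangentSpace 𝓘(ℝ, EP) u :=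
  mfderiv 𝓘(ℝ, EG) 𝓘(ℝ, EP) (fun g : G ↦ MulOpposite.op g • u) 1

/-- `B` lies over `A`: `B (f ∘ p) = (A f) ∘ p`. -/
def IsOver (p : C^∞⟮𝓘(ℝ, EP), P; 𝓘(ℝ, EM), M⟯) (B : DiffusionOperator EP P)
    (A : DiffusionOperator EM M) : Prop :=
  ∀ f : C^∞⟮𝓘(ℝ, EM), M; 𝓘(ℝ, ℝ), ℝ⟯, B.op (f.comp p) = (A.op f).comp p

/-- The vertical tangent space `ker T_up`. -/
def verticalSpace (p : C^∞⟮𝓘(ℝ, EP), P; 𝓘(ℝ, EM), M⟯) (u : P) :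
    Submodule ℝ (TangentSpace 𝓘(ℝ, EP) u) :=
  LinearMap.ker (mfderiv 𝓘(ℝ, EP) 𝓘(ℝ, EM) p u).toLinearMap

variable [IsManifold 𝓘(ℝ, EM) ∞ M] [IsManifold 𝓘(ℝ, EP) ∞ P]

/-- `H` is an invariant semi-connection over the sub-bundle `S` of `TM`: a smooth sub-bundle of
`TP` which `T_up` maps bijectively onto `S` and which is invariant under right translations. -/
structure IsInvariantSemiConnection {p : C^∞⟮𝓘(ℝ, EP), P; 𝓘(ℝ, EM), M⟯}
    (hp : IsPrincipalBundle EG G p) (S : ∀ x : M, Submodule ℝ (TangentSpace 𝓘(ℝ, EM) x))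
    (H : ∀ u : P, Submodule ℝ (TangentSpace 𝓘(ℝ, EP) u)) : Prop where
  base_subbundle : IsSmoothSubbundle S
  subbundle : IsSmoothSubbundle H
  bijOn : ∀ u : P, Set.BijOn (mfderiv 𝓘(ℝ, EP) 𝓘(ℝ, EM) p u) (H u) (S (p u))
  invariant : ∀ (a : G) (u : P),
    (H u).map (mfderiv 𝓘(ℝ, EP) 𝓘(ℝ, EP) (hp.rightTranslation a) u).toLinearMap =
      H (MulOpposite.op a • u)

variable [FiniteDimensional ℝ EM] [FiniteDimensional ℝ EP] [T2Space M] [T2Space P]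

/-- `h` is the horizontal lift map determined by `B` and `A`: for a tangent vector
`v = σ^A_{p(u)}(ℓ)`, one has `h_u(v) = σ^B_u (ℓ ∘ T_up)`. -/
def IsHorizontalLiftMap (p : C^∞⟮𝓘(ℝ, EP), P; 𝓘(ℝ, EM), M⟯) (A : DiffusionOperator EM M)
    (B : DiffusionOperator EP P)
    (h : ∀ u : P, A.symbolRange (p u) →ₗ[ℝ] TangentSpace 𝓘(ℝ, EP) u) : Prop :=
  ∀ (u : P) (ℓ : TangentSpace 𝓘(ℝ, EM) (p u) →L[ℝ] ℝ),
    h u ⟨A.symbol (p u) ℓ, LinearMap.mem_range_self _ ℓ⟩ =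
      B.symbol u (ℓ ∘L mfderiv 𝓘(ℝ, EP) 𝓘(ℝ, EM) p u)

/-- `B = A^H + B^V`, where `A^H` is the lift of `A` along the horizontal distribution `H` and
`B^V` is vertical. -/
structure IsDecomposition (p : C^∞⟮𝓘(ℝ, EP), P; 𝓘(ℝ, EM), M⟯) (A : DiffusionOperator EM M)
    (H : ∀ u : P, Submodule ℝ (TangentSpace 𝓘(ℝ, EP) u))
    (B AH BV : DiffusionOperator EP P) : Prop where
  sum : B.op = AH.op + BV.op
  lifts : IsOver p AH A
  horizontal : AH.IsAlong H
  vertical : BV.IsAlong (verticalSpace p)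


/-- `ϖ` is the semi-connection form of `H`: the `𝔤`-valued form, defined on `H + ker Tp` only,
which vanishes on `H` and satisfies `ϖ (A^*(u)) = A`. -/
def IsSemiConnectionForm (p : C^∞⟮𝓘(ℝ, EP), P; 𝓘(ℝ, EM), M⟯)
    (H : ∀ u : P, Submodule ℝ (TangentSpace 𝓘(ℝ, EP) u))
    (ϖ : ∀ u : P, ↥(H u ⊔ verticalSpace p u) →ₗ[ℝ] GroupLieAlgebra 𝓘(ℝ, EG) G) : Prop :=
  (∀ (u : P) (v : ↥(H u ⊔ verticalSpace p u)), (v : TangentSpace 𝓘(ℝ, EP) u) ∈ H u → ϖ u v = 0) ∧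
  ∀ (u : P) (X : GroupLieAlgebra 𝓘(ℝ, EG) G),
    ∃ hX : fundamental EG u X ∈ H u ⊔ verticalSpace p u, ϖ u ⟨fundamental EG u X, hX⟩ = X

/-- The covector `ℓ` at `u` extends the component `ϖ^l` (with respect to the basis `b` of `𝔤`) of
the partially defined form `ϖ`. -/
def ExtendsAt {n : ℕ} {p : C^∞⟮𝓘(ℝ, EP), P; 𝓘(ℝ, EM), M⟯}
    {H : ∀ u : P, Submodule ℝ (TangentSpace 𝓘(ℝ, EP) u)}
    (ϖ : ∀ u : P, ↥(H u ⊔ verticalSpace p u) →ₗ[ℝ] GroupLieAlgebra 𝓘(ℝ, EG) G)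
    (b : Basis (Fin n) ℝ (GroupLieAlgebra 𝓘(ℝ, EG) G)) (l : Fin n) (u : P)
    (ℓ : TangentSpace 𝓘(ℝ, EP) u →L[ℝ] ℝ) : Prop :=
  ∀ v : ↥(H u ⊔ verticalSpace p u), ℓ v = b.coord l (ϖ u v)

/-- `L = ∑ α^{ij} L_{A_i^*} L_{A_j^*} + ∑ β^k L_{A_k^*}` for the basis `A_i = b i` of `𝔤`. -/
def HasVerticalExpression {n : ℕ} (L : DiffusionOperator EP P)
    (b : Basis (Fin n) ℝ (GroupLieAlgebra 𝓘(ℝ, EG) G))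
    (α : Fin n → Fin n → P → ℝ) (β : Fin n → P → ℝ) : Prop :=
  ∀ (f : C^∞⟮𝓘(ℝ, EP), P; 𝓘(ℝ, ℝ), ℝ⟯) (u : P), L.op f u =
    ∑ i, ∑ j, α i j u * lieDeriv (E := EP) (fun u ↦ fundamental EG u (b i))
      (lieDeriv (E := EP) (fun u ↦ fundamental EG u (b j)) f) u +
    ∑ k, β k u * lieDeriv (E := EP) (fun u ↦ fundamental EG u (b k)) f u

end Principal

end EquivDiff

end

/-!
The operator `A` exists because, by equivariance, `B (f ∘ p)` is constant on the fibres; it is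
smooth by means of local sections (`IsPrincipalBundle.exists_isOver`). The Cauchy-Schwarz inequality
for the semi-definite form `σ^B` shows that `σ^B (ℓ ∘ Tp)` depends only on `σ^A ℓ`, which gives the
horizontal lift `h` and the semi-connection `H`. As `Tp ∘ h = id`, `H` is transverse to the fibres,
and the components `ϖ^k` of the semi-connection form have smooth extensions `ϑ^k`, built locally
from dual frames and glued by a partition of unity (`IsPrincipalBundle.exists_oneForm_extending`).

Everything else rests on two facts.

* `σ^B` maps a covector which annihilates `H` to a vertical vector, by symmetry
  (`IsHorizontalLiftMap.symbol_mem_verticalSpace`).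
* If `A` is cohesive, `δ^B θ = 0` for every `C^1` form `θ` which annihilates `H` and the vertical
  vectors (`IsHorizontalLiftMap.delta_eq_zero`). Indeed `θ` is locally a combination `∑ λ_i p^* ψ_i`
  of pull-backs of forms `ψ_i` which annihilate `Im σ^A`, and `σ^A ψ_i = 0`, `δ^A ψ_i = 0`.

Let `T φ = ∑ φ(A_k^*) ϑ^k` be the vertical part of a form `φ`. The decomposition is
`B^V f = δ^B (T df)` and `A^H f = δ^B (df - T df)`. Both are diffusion operators since `T df` and
`df - T df` are orthogonal for `σ^B` (`DiffusionOperator.twist` is the general construction). The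
first fact makes `B^V` vertical and the second one puts `A^H` along `H`. In any decomposition
`δ^{A^H}` vanishes on `T df` and `δ^{B^V}` on `df - T df`, so that `B^V f = δ^B (T df)` again; this
is uniqueness.

Expanding `δ^B (∑ (L_{A_k^*} f) ϑ^k)` by the Leibniz rule yields the expression of `B^V` with
`α^{kl} = ϑ^k (σ^B ϑ^l)` and `β^l = δ^B ϑ^l`. By the two facts these quantities depend only on the
values of the `ϑ^k` on `H` and on vertical vectors. That is why the extension does not matter, and
why the coefficients transform linearly when the forms `ϑ^k` are replaced by those of another basis,
or by their pull-backs under a right translation `R_a`, which extend the components of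
`Ad(a⁻¹) ∘ ϖ`.
-/

noncomputable section

open scoped Topology
open Bundle Module

set_option linter.unusedSectionVars false

namespace EquivDiff

/-! ### One-forms and vector fields near a point -/

section OneForms

variable {E : Type*} [NormedAddCommGroup E] [NormedSpace ℝ E]
  {M : Type*} [TopologicalSpace M] [ChartedSpace E M]

instance [FiniteDimensional ℝ E] (x : M) : FiniteDimensional ℝ (TangentSpace 𝓘(ℝ, E) x) :=
  inferInstanceAs (FiniteDimensional ℝ E)

instance (x : M) : T2Space (TangentSpace 𝓘(ℝ, E) x) :=
  inferInstanceAs (T2Space E)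

/-- `X` is a vector field of class `C^k` at `x`. -/
def IsFieldAt (k : ℕ∞ω) (X : ∀ x : M, TangentSpace 𝓘(ℝ, E) x) (x : M) [IsManifold 𝓘(ℝ, E) ∞ M] :
    Prop :=
  ContMDiffAt 𝓘(ℝ, E) 𝓘(ℝ, E).tangent k (fun y ↦ (⟨y, X y⟩ : TangentBundle 𝓘(ℝ, E) M)) x

/-- `φ` is a 1-form of class `C^k` at `x`. -/
def IsOneFormAt [IsManifold 𝓘(ℝ, E) ∞ M] (k : ℕ∞ω)
    (φ : ∀ x : M, TangentSpace 𝓘(ℝ, E) x →L[ℝ] ℝ) (x : M) : Prop :=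
  ContMDiffAt 𝓘(ℝ, E) (𝓘(ℝ, E).prod 𝓘(ℝ, E →L[ℝ] ℝ)) k
    (fun x ↦ TotalSpace.mk' (E →L[ℝ] ℝ)
      (E := fun x : M ↦ TangentSpace 𝓘(ℝ, E) x →L[ℝ] Trivial M ℝ x) x (φ x)) x

variable [IsManifold 𝓘(ℝ, E) ∞ M] {k : ℕ∞ω}
  {φ ψ : ∀ x : M, TangentSpace 𝓘(ℝ, E) x →L[ℝ] ℝ} {X Y : ∀ x : M, TangentSpace 𝓘(ℝ, E) x} {x : M}

lemma IsOneFormAt.apply (hφ : IsOneFormAt k φ x) (hX : IsFieldAt k X x) :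
    ContMDiffAt 𝓘(ℝ, E) 𝓘(ℝ, ℝ) k (fun y ↦ φ y (X y)) x := by
  have h := ContMDiffAt.clm_bundle_apply (b := fun y ↦ y) (v := X) hφ hX
  rwa [contMDiffAt_section] at h

lemma IsOneFormAt.of_le {k' : ℕ∞ω} (hφ : IsOneFormAt k φ x) (h : k' ≤ k) : IsOneFormAt k' φ x :=
  ContMDiffAt.of_le hφ h

lemma IsFieldAt.of_le {k' : ℕ∞ω} (hX : IsFieldAt k X x) (h : k' ≤ k) : IsFieldAt k' X x :=
  ContMDiffAt.of_le hX h

lemma IsOneFormAt.congr (hφ : IsOneFormAt k φ x) (h : ∀ᶠ y in 𝓝 x, ψ y = φ y) :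
    IsOneFormAt k ψ x := by
  refine ContMDiffAt.congr_of_eventuallyEq hφ ?_
  filter_upwards [h] with y hy
  rw [hy]

lemma IsFieldAt.congr (hX : IsFieldAt k X x) (h : ∀ᶠ y in 𝓝 x, Y y = X y) :
    IsFieldAt k Y x := by
  refine ContMDiffAt.congr_of_eventuallyEq hX ?_
  filter_upwards [h] with y hy
  rw [hy]

lemma IsOneFormAt.smul {f : M → ℝ} (hf : ContMDiffAt 𝓘(ℝ, E) 𝓘(ℝ, ℝ) k f x)
    (hφ : IsOneFormAt k φ x) : IsOneFormAt k (fun y ↦ f y • φ y) x :=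
  ContMDiffAt.smul_section hf hφ

lemma IsOneFormAt.sub (hφ : IsOneFormAt k φ x) (hψ : IsOneFormAt k ψ x) :
    IsOneFormAt k (fun y ↦ φ y - ψ y) x :=
  ContMDiffAt.sub_section hφ hψ

lemma IsOneFormAt.sum {ι : Type*} {s : Finset ι}
    {φ : ι → ∀ x : M, TangentSpace 𝓘(ℝ, E) x →L[ℝ] ℝ} (hφ : ∀ i ∈ s, IsOneFormAt k (φ i) x) :
    IsOneFormAt k (fun y ↦ ∑ i ∈ s, φ i y) x :=
  ContMDiffAt.sum_section hφ

lemma IsFieldAt.smul {f : M → ℝ} (hf : ContMDiffAt 𝓘(ℝ, E) 𝓘(ℝ, ℝ) k f x)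
    (hX : IsFieldAt k X x) : IsFieldAt k (fun y ↦ f y • X y) x :=
  ContMDiffAt.smul_section hf hX

lemma IsFieldAt.sum {ι : Type*} {s : Finset ι}
    {X : ι → ∀ x : M, TangentSpace 𝓘(ℝ, E) x} (hX : ∀ i ∈ s, IsFieldAt k (X i) x) :
    IsFieldAt k (fun y ↦ ∑ i ∈ s, X i y) x :=
  ContMDiffAt.sum_section hX

variable [FiniteDimensional ℝ E]

lemma isFieldAt_coordVector {k : ℕ∞ω} (hk : k ≤ ∞) (x : M) (i : Fin (finrank ℝ E)) {y : M}
    (hy : y ∈ (chartAt E x).source) : IsFieldAt k (coordVector (E := E) x i) y := by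
  have hv := contMDiffAt_localFrame_of_mem (I := 𝓘(ℝ, E)) ∞
    (trivializationAt E (TangentSpace 𝓘(ℝ, E)) x) (finBasis ℝ E) i (x := y) (by simpa using hy)
  have hv' : IsFieldAt ∞ (coordVector (E := E) x i) y := by
    refine hv.congr_of_eventuallyEq ?_
    filter_upwards [(chartAt E x).open_source.mem_nhds hy] with z hz
    have hz' : z ∈ (trivializationAt E (TangentSpace 𝓘(ℝ, E)) x).baseSet := by simpa using hz
    rw [Trivialization.localFrame_apply_of_mem_baseSet _ _ hz']
    simp [coordVector, Trivialization.basisAt, Trivialization.symmL_apply _ hz']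
  exact hv'.of_le hk

/-- In a chart, every vector is a combination of the coordinate vectors. -/
lemma vector_eq_sum_coordVector {x y : M} (hy : y ∈ (chartAt E x).source)
    (v : TangentSpace 𝓘(ℝ, E) y) : ∃ c : Fin (finrank ℝ E) → ℝ,
      v = ∑ i, c i • coordVector (E := E) x i y := by
  have hz' : y ∈ (trivializationAt E (TangentSpace 𝓘(ℝ, E)) x).baseSet := by simpa using hy
  let e := (trivializationAt E (TangentSpace 𝓘(ℝ, E)) x).continuousLinearEquivAt ℝ y hz'
  refine ⟨fun i ↦ (finBasis ℝ E).repr (e v) i, ?_⟩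
  have h : v = e.symm (e v) := (e.symm_apply_apply v).symm
  rw [h]
  conv_lhs => rw [← (finBasis ℝ E).sum_repr (e v)]
  rw [map_sum]
  refine Finset.sum_congr rfl fun i _ ↦ ?_
  rw [map_smul, e.apply_symm_apply]
  exact congrArg _ (congrFun (congrArg DFunLike.coe
    (Trivialization.symm_continuousLinearEquivAt_eq' _ hz')) _)

lemma covector_ext_coordVector {x y : M} (hy : y ∈ (chartAt E x).source)
    {l l' : TangentSpace 𝓘(ℝ, E) y →L[ℝ] ℝ}
    (h : ∀ i, l (coordVector x i y) = l' (coordVector x i y)) : l = l' := by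
  ext v
  obtain ⟨c, rfl⟩ := vector_eq_sum_coordVector (E := E) hy v
  simp only [map_sum, map_smul, h]

/-- A 1-form is `C^k` if its coefficients in a chart are. -/
lemma isOneFormAt_of_coeff
    (h : ∀ i, ContMDiffAt 𝓘(ℝ, E) 𝓘(ℝ, ℝ) k (fun y ↦ φ y (coordVector x i y)) x) :
    IsOneFormAt k φ x := by
  refine (contMDiffAt_hom_bundle _).2 ⟨contMDiffAt_id, ?_⟩
  have h1 : ContMDiffAt 𝓘(ℝ, E) 𝓘(ℝ, E →L[ℝ] ℝ) k
      (fun y ↦ ∑ i, (φ y (coordVector x i y)) •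
        (((finBasis ℝ E).coord i).toContinuousLinearMap : E →L[ℝ] ℝ)) x :=
    contMDiffAt_finsetSum fun i _ ↦ (h i).smul contMDiffAt_const
  refine h1.congr_of_eventuallyEq ?_
  filter_upwards [(chartAt E x).open_source.mem_nhds (mem_chart_source E x)] with y hy
  have hz' : y ∈ (trivializationAt E (TangentSpace 𝓘(ℝ, E)) x).baseSet := by simpa using hy
  refine ContinuousLinearMap.coe_injective ((finBasis ℝ E).ext fun j ↦ ?_)
  rw [ContinuousLinearMap.inCoordinates_eq hz' (by simp)]
  have : (∑ i, (φ y (coordVector x i y)) •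
        (((finBasis ℝ E).coord i).toContinuousLinearMap : E →L[ℝ] ℝ)) (finBasis ℝ E j) =
      φ y (coordVector x j y) := by
    simp [Finsupp.single_apply]
  refine Eq.trans ?_ this.symm
  exact congrArg (φ y) (congrFun (congrArg DFunLike.coe
    (Trivialization.symm_continuousLinearEquivAt_eq' _ hz')) _)

lemma IsOneFormAt.coeff (hφ : IsOneFormAt k φ x) (hk : k ≤ ∞) (i : Fin (finrank ℝ E)) :
    ContMDiffAt 𝓘(ℝ, E) 𝓘(ℝ, ℝ) k (fun y ↦ φ y (coordVector x i y)) x :=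
  hφ.apply (isFieldAt_coordVector hk x i (mem_chart_source E x))

lemma isOneFormAt_differential (f : C^∞⟮𝓘(ℝ, E), M; 𝓘(ℝ, ℝ), ℝ⟯) (x : M) :
    IsOneFormAt ∞ (fun y ↦ differential (E := E) f y) x := by
  refine isOneFormAt_of_coeff fun i ↦ ?_
  have hcs := chart_contDiffOn f x
  have hdc : ContDiffOn ℝ ∞ (fderiv ℝ fun z : E ↦ f ((extChartAt 𝓘(ℝ, E) x).symm z))
      (extChartAt 𝓘(ℝ, E) x).target :=
    hcs.fderiv_of_isOpen (isOpen_extChartAt_target x) (by simp)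
  have h2 := (hdc.clm_apply (contDiffOn_const (c := finBasis ℝ E i))).contDiffAt
    (extChartAt_target_mem_nhds (I := 𝓘(ℝ, E)) x)
  refine (h2.contMDiffAt.comp x (contMDiffAt_extChartAt (n := ∞))).congr_of_eventuallyEq ?_
  filter_upwards [(chartAt E x).open_source.mem_nhds (mem_chart_source E x)] with y hy
  exact differential_symmL f hy _

variable [T2Space M]

lemma differential_coordFun_coordVector (x : M) : ∀ᶠ y in 𝓝 x, ∀ i j,
    differential (E := E) (coordFun x (dualCovector x i)) y (coordVector x j y) =
      if i = j then 1 else 0 := by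
  have ht : ∀ᶠ y in 𝓝 x, ∀ᶠ z in 𝓝 y, ∀ i, coordFun x (dualCovector x i) z =
      (asDual (dualCovector x i)) (extChartAt 𝓘(ℝ, E) x z - extChartAt 𝓘(ℝ, E) x x) :=
    (Filter.eventually_all.2 fun i ↦ coordFun_eventuallyEq x (dualCovector x i)).eventually_nhds
  filter_upwards [ht, (chartAt E x).open_source.mem_nhds (mem_chart_source E x)] with y hy hs i j
  unfold coordVector
  rw [differential_symmL _ hs]
  have hy' : y ∈ (extChartAt 𝓘(ℝ, E) x).source := by simpa using hs
  have h : HasFDerivAt (fun z : E ↦ (asDual (dualCovector (E := E) x i)) (z - extChartAt 𝓘(ℝ, E) x x))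
      (asDual (dualCovector (E := E) x i)) (extChartAt 𝓘(ℝ, E) x y) := by
    simp only [map_sub]
    exact (asDual (dualCovector (E := E) x i)).hasFDerivAt.sub_const _
  have hc : Filter.Tendsto (extChartAt 𝓘(ℝ, E) x).symm (𝓝 (extChartAt 𝓘(ℝ, E) x y)) (𝓝 y) := by
    have := (continuousAt_extChartAt_symm' (I := 𝓘(ℝ, E)) hy').tendsto
    rwa [(extChartAt 𝓘(ℝ, E) x).left_inv hy'] at this
  have h2 := h.congr_of_eventuallyEq
    (f₁ := fun z : E ↦ coordFun x (dualCovector x i) ((extChartAt 𝓘(ℝ, E) x).symm z)) (by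
    filter_upwards [hc.eventually hy, extChartAt_target_mem_nhds' (I := 𝓘(ℝ, E))
      ((extChartAt 𝓘(ℝ, E) x).map_source hy')] with z hz hz'
    rw [hz, (extChartAt 𝓘(ℝ, E) x).right_inv hz'])
  rw [h2.fderiv]
  change (finBasis ℝ E).coord i (finBasis ℝ E j) = _
  simp [Finsupp.single_apply, eq_comm]

/-- Near `x`, a 1-form is the combination `∑ φ_i dx^i` of its coefficients in the chart. -/
lemma oneForm_eventually_eq_sum (φ : ∀ x : M, TangentSpace 𝓘(ℝ, E) x →L[ℝ] ℝ) (x : M) :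
    ∀ᶠ y in 𝓝 x, φ y =
      ∑ i, φ y (coordVector x i y) • differential (coordFun x (dualCovector x i)) y := by
  filter_upwards [differential_coordFun_coordVector (E := E) x,
    (chartAt E x).open_source.mem_nhds (mem_chart_source E x)] with y hy hs
  refine covector_ext_coordVector hs fun j ↦ ?_
  simp [sum_apply, hy]

/-- A vector field is `C^k` if the derivatives of the coordinate functions along it are. -/
lemma isFieldAt_of_coord (hk : k ≤ ∞)
    (h : ∀ i, ContMDiffAt 𝓘(ℝ, E) 𝓘(ℝ, ℝ) k
      (fun y ↦ differential (E := E) (coordFun x (dualCovector (E := E) x i)) y (X y)) x) :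
    IsFieldAt k X x := by
  refine (IsFieldAt.sum (s := Finset.univ) fun i _ ↦ (IsFieldAt.smul (h i)
    (isFieldAt_coordVector hk x i (mem_chart_source E x)))).congr ?_
  filter_upwards [differential_coordFun_coordVector (E := E) x,
    (chartAt E x).open_source.mem_nhds (mem_chart_source E x)] with y hy hs
  obtain ⟨c, hc⟩ := vector_eq_sum_coordVector (E := E) hs (X y)
  have : ∀ i, differential (E := E) (coordFun x (dualCovector (E := E) x i)) y (X y) = c i := fun i ↦ by
    rw [hc]; simp [hy]
  simp only [this]
  exact hc

/-- A smooth function defined near `x` has a smooth global extension. -/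
lemma exists_contMDiffMap_eventuallyEq {f : M → ℝ} {x : M} {U : Set M} (hU : U ∈ 𝓝 x)
    (hf : ∀ y ∈ U, ContMDiffAt 𝓘(ℝ, E) 𝓘(ℝ, ℝ) ∞ f y) :
    ∃ g : C^∞⟮𝓘(ℝ, E), M; 𝓘(ℝ, ℝ), ℝ⟯, ∀ᶠ y in 𝓝 x, g y = f y := by
  obtain ⟨b, -, hb⟩ := (SmoothBumpFunction.nhds_basis_tsupport (I := 𝓘(ℝ, E)) x).mem_iff.1 hU
  refine ⟨⟨fun y ↦ b y • f y, contMDiff_of_tsupport fun y hy ↦ ?_⟩, ?_⟩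
  · exact b.contMDiffAt.smul (hf y (hb (tsupport_smul_subset_left _ _ hy)))
  · filter_upwards [b.eventuallyEq_one] with y hy
    change b y • f y = f y
    rw [hy]; simp

/-- A smooth 1-form is locally a combination of differentials with globally smooth coefficients. -/
lemma exists_eventually_eq_sum_differential {U : Set M} (hU : U ∈ 𝓝 x)
    (hφ : ∀ y ∈ U, IsOneFormAt ∞ φ y) :
    ∃ f g : Fin (finrank ℝ E) → C^∞⟮𝓘(ℝ, E), M; 𝓘(ℝ, ℝ), ℝ⟯,
      ∀ᶠ y in 𝓝 x, φ y = ∑ i, f i y • differential (g i) y := by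
  have h : ∀ i, ∃ g : C^∞⟮𝓘(ℝ, E), M; 𝓘(ℝ, ℝ), ℝ⟯, ∀ᶠ y in 𝓝 x,
      g y = φ y (coordVector x i y) := fun i ↦
    exists_contMDiffMap_eventuallyEq (Filter.inter_mem hU
      ((chartAt E x).open_source.mem_nhds (mem_chart_source E x)))
      fun y hy ↦ (hφ y hy.1).apply (isFieldAt_coordVector le_rfl x i hy.2)
  choose f hf using h
  refine ⟨f, fun i ↦ coordFun x (dualCovector x i), ?_⟩
  filter_upwards [oneForm_eventually_eq_sum φ x, Filter.eventually_all.2 hf] with y h1 h2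
  rw [h1]
  simp only [h2]

end OneForms

/-! ### Calculus of the symbol and of `δ^L` -/

section Differential
variable {E : Type*} [NormedAddCommGroup E] [NormedSpace ℝ E]
  {M : Type*} [TopologicalSpace M] [ChartedSpace E M] {f g : M → ℝ} {x : M}

lemma differential_congr (h : ∀ᶠ y in 𝓝 x, f y = g y) :
    differential (E := E) f x = differential g x :=
  Filter.EventuallyEq.mfderiv_eq h

lemma differential_add (hf : MDifferentiableAt 𝓘(ℝ, E) 𝓘(ℝ, ℝ) f x)
    (hg : MDifferentiableAt 𝓘(ℝ, E) 𝓘(ℝ, ℝ) g x) :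
    differential (E := E) (fun y ↦ f y + g y) x = differential f x + differential g x :=
  (hf.hasMFDerivAt.add hg.hasMFDerivAt).mfderiv

lemma differential_mul (hf : MDifferentiableAt 𝓘(ℝ, E) 𝓘(ℝ, ℝ) f x)
    (hg : MDifferentiableAt 𝓘(ℝ, E) 𝓘(ℝ, ℝ) g x) :
    differential (E := E) (fun y ↦ f y * g y) x = f x • differential g x + g x • differential f x :=
  (hf.hasMFDerivAt.mul hg.hasMFDerivAt).mfderiv

lemma differential_const (c : ℝ) : differential (E := E) (fun _ : M ↦ c) x = 0 :=
  (hasMFDerivAt_const c x).mfderiv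

lemma differential_sum {ι : Type*} (s : Finset ι) {f : ι → M → ℝ}
    (hf : ∀ i ∈ s, MDifferentiableAt 𝓘(ℝ, E) 𝓘(ℝ, ℝ) (f i) x) :
    differential (E := E) (fun y ↦ ∑ i ∈ s, f i y) x = ∑ i ∈ s, differential (f i) x := by
  classical
  suffices h : MDifferentiableAt 𝓘(ℝ, E) 𝓘(ℝ, ℝ) (fun y ↦ ∑ i ∈ s, f i y) x ∧
      differential (E := E) (fun y ↦ ∑ i ∈ s, f i y) x = ∑ i ∈ s, differential (f i) x from h.2
  induction s using Finset.induction_on with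
  | empty =>
    simp only [Finset.sum_empty]
    exact ⟨mdifferentiableAt_const, differential_const 0⟩
  | insert a s ha ih =>
    simp only [Finset.sum_insert ha]
    have h := ih fun i hi ↦ hf i (Finset.mem_insert_of_mem hi)
    have ha' := hf a (Finset.mem_insert_self a s)
    exact ⟨ha'.add h.1, by rw [differential_add ha' h.1, h.2]⟩

lemma contMDiffMap_mul_differential (f g : C^∞⟮𝓘(ℝ, E), M; 𝓘(ℝ, ℝ), ℝ⟯) (x : M) :
    differential (E := E) (f * g) x = f x • differential g x + g x • differential f x :=
  differential_mul (mdiffAt f x) (mdiffAt g x)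

end Differential

section Symbol
variable {E : Type*} [NormedAddCommGroup E] [NormedSpace ℝ E]
  {M : Type*} [TopologicalSpace M] [ChartedSpace E M]
  [IsManifold 𝓘(ℝ, E) ∞ M] [FiniteDimensional ℝ E]

lemma vector_ext {x : M} {v w : TangentSpace 𝓘(ℝ, E) x}
    (h : ∀ l : TangentSpace 𝓘(ℝ, E) x →L[ℝ] ℝ, l v = l w) : v = w := by
  have h' : ∀ l : E →L[ℝ] ℝ, l (v : E) = l (w : E) := h
  have := (finBasis ℝ E).repr.injective (a₁ := v) (a₂ := w) (by
    ext i
    exact h' ((finBasis ℝ E).coord i).toContinuousLinearMap)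
  exact this

variable [T2Space M]

lemma vector_ext_differential {x : M} {v w : TangentSpace 𝓘(ℝ, E) x}
    (h : ∀ f : C^∞⟮𝓘(ℝ, E), M; 𝓘(ℝ, ℝ), ℝ⟯, differential f x v = differential f x w) : v = w :=
  vector_ext fun l ↦ by simpa [differential_coordFun] using h (coordFun x l)

namespace DiffusionOperator
variable (L : DiffusionOperator E M)

lemma differential_symbol_eq_gamma (f g : C^∞⟮𝓘(ℝ, E), M; 𝓘(ℝ, ℝ), ℝ⟯) (x : M) :
    differential f x (L.symbol x (differential g x)) = L.gamma f g x :=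
  L.differential_symbol f g x

lemma symbol_symm (x : M) (l l' : TangentSpace 𝓘(ℝ, E) x →L[ℝ] ℝ) :
    l (L.symbol x l') = l' (L.symbol x l) := by
  rw [← differential_coordFun x l, ← differential_coordFun x l', differential_symbol_eq_gamma,
    differential_symbol_eq_gamma, gamma_comm]

lemma symbol_nonneg (x : M) (l : TangentSpace 𝓘(ℝ, E) x →L[ℝ] ℝ) : 0 ≤ l (L.symbol x l) := by
  rw [← differential_coordFun x l, differential_symbol]
  exact L.semi_elliptic _ x

/-- The Cauchy-Schwarz inequality: the kernel of the symbol consists of the null covectors. -/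
lemma symbol_eq_zero {x : M} {l : TangentSpace 𝓘(ℝ, E) x →L[ℝ] ℝ} (h : l (L.symbol x l) = 0) :
    L.symbol x l = 0 := by
  refine vector_ext fun m ↦ ?_
  rw [map_zero]
  -- the quadratic polynomial `q (m + t l)` in `t` is affine and non-negative, hence constant
  have key : ∀ t : ℝ, 0 ≤ m (L.symbol x m) + t * (2 * m (L.symbol x l)) := by
    intro t
    have h1 := L.symbol_nonneg x (m + t • l)
    simp only [map_add, map_smul, add_apply, smul_apply, smul_eq_mul, h,
      L.symbol_symm x l m] at h1
    linarith
  by_contra hne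
  have h2 := key (-(m (L.symbol x m) + 1) / (2 * m (L.symbol x l)))
  rw [div_mul_cancel₀ _ (by simpa using hne)] at h2
  linarith

lemma isFieldAt_symbol_differential (g : C^∞⟮𝓘(ℝ, E), M; 𝓘(ℝ, ℝ), ℝ⟯) (x : M) :
    IsFieldAt ∞ (fun y ↦ L.symbol y (differential g y)) x := by
  refine isFieldAt_of_coord le_rfl fun i ↦ ?_
  simp only [differential_symbol_eq_gamma]
  exact (L.gamma _ g).contMDiff x

/-- The vector field `σ^L φ` of a smooth 1-form is smooth. -/
lemma isFieldAt_symbol {φ : ∀ x : M, TangentSpace 𝓘(ℝ, E) x →L[ℝ] ℝ} {x : M} {U : Set M}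
    (hU : U ∈ 𝓝 x) (hφ : ∀ y ∈ U, IsOneFormAt ∞ φ y) :
    IsFieldAt ∞ (fun y ↦ L.symbol y (φ y)) x := by
  obtain ⟨f, g, hfg⟩ := exists_eventually_eq_sum_differential hU hφ
  refine (IsFieldAt.sum (s := Finset.univ) fun i _ ↦
    ((f i).contMDiff x).smul_section (L.isFieldAt_symbol_differential (g i) x)).congr ?_
  filter_upwards [hfg] with y hy
  rw [hy, map_sum]
  simp only [map_smul]
  rfl

lemma delta_congr {φ ψ : ∀ x : M, TangentSpace 𝓘(ℝ, E) x →L[ℝ] ℝ} {x : M}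
    (h : ∀ᶠ y in 𝓝 x, φ y = ψ y) : L.delta φ x = L.delta ψ x := by
  unfold delta
  refine Finset.sum_congr rfl fun i _ ↦ ?_
  rw [differential_congr (g := fun y ↦ ψ y (coordVector x i y)) (by
    filter_upwards [h] with y hy; rw [hy]), h.self_of_nhds]

lemma mdifferentiableAt_coeff' {φ : ∀ x : M, TangentSpace 𝓘(ℝ, E) x →L[ℝ] ℝ} {x : M}
    (hφ : IsOneFormAt 1 φ x) (i : Fin (finrank ℝ E)) :
    MDifferentiableAt 𝓘(ℝ, E) 𝓘(ℝ, ℝ) (fun y ↦ φ y (coordVector x i y)) x :=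
  (hφ.coeff (by exact WithTop.coe_le_coe.2 le_top) i).mdifferentiableAt (by simp)

lemma delta_add {φ ψ : ∀ x : M, TangentSpace 𝓘(ℝ, E) x →L[ℝ] ℝ} {x : M}
    (hφ : IsOneFormAt 1 φ x) (hψ : IsOneFormAt 1 ψ x) :
    L.delta (fun y ↦ φ y + ψ y) x = L.delta φ x + L.delta ψ x := by
  unfold delta
  rw [← Finset.sum_add_distrib]
  refine Finset.sum_congr rfl fun i _ ↦ ?_
  have := differential_add (mdifferentiableAt_coeff' hφ i) (mdifferentiableAt_coeff' hψ i)
  simp only [add_apply] at this ⊢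
  rw [this]
  simp only [add_apply]
  ring

/-- The Leibniz rule for `δ^L`, at a point. -/
lemma delta_smul_at {f : M → ℝ} {φ : ∀ x : M, TangentSpace 𝓘(ℝ, E) x →L[ℝ] ℝ} {x : M}
    (hf : MDifferentiableAt 𝓘(ℝ, E) 𝓘(ℝ, ℝ) f x) (hφ : IsOneFormAt 1 φ x) :
    L.delta (fun y ↦ f y • φ y) x =
      differential f x (L.symbol x (φ x)) + f x * L.delta φ x := by
  have h3 : differential f x (L.symbol x (φ x)) =
      ∑ i, φ x (coordVector x i x) * differential f x (L.symbol x (dualCovector x i)) := by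
    conv_lhs => rw [covector_eq_sum x (φ x)]
    simp only [map_sum, map_smul, smul_eq_mul]
  unfold delta
  rw [h3, Finset.mul_sum, ← Finset.sum_add_distrib]
  refine Finset.sum_congr rfl fun i _ ↦ ?_
  have := differential_mul hf (mdifferentiableAt_coeff' hφ i)
  simp only [smul_apply, smul_eq_mul] at this ⊢
  rw [this]
  simp only [add_apply, smul_apply, smul_eq_mul]
  ring

lemma delta_zero (x : M) : L.delta (fun _ ↦ 0) x = 0 := by
  unfold delta
  refine Finset.sum_eq_zero fun i _ ↦ ?_
  simp only [zero_apply, differential_const, zero_mul, add_zero]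

lemma delta_sum {ι : Type*} (s : Finset ι) {φ : ι → ∀ x : M, TangentSpace 𝓘(ℝ, E) x →L[ℝ] ℝ}
    {x : M} (hφ : ∀ i ∈ s, IsOneFormAt 1 (φ i) x) :
    L.delta (fun y ↦ ∑ i ∈ s, φ i y) x = ∑ i ∈ s, L.delta (φ i) x := by
  classical
  induction s using Finset.induction_on with
  | empty => simpa using L.delta_zero x
  | insert a s ha ih =>
    simp only [Finset.sum_insert ha]
    have h : ∀ i ∈ s, IsOneFormAt 1 (φ i) x := fun i hi ↦ hφ i (Finset.mem_insert_of_mem hi)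
    rw [L.delta_add (hφ a (Finset.mem_insert_self a s)) (IsOneFormAt.sum h), ih h]

lemma delta_sub {φ ψ : ∀ x : M, TangentSpace 𝓘(ℝ, E) x →L[ℝ] ℝ} {x : M}
    (hφ : IsOneFormAt 1 φ x) (hψ : IsOneFormAt 1 ψ x) :
    L.delta (fun y ↦ φ y - ψ y) x = L.delta φ x - L.delta ψ x := by
  have h := L.delta_add (hφ.sub hψ) hψ
  simp only [sub_add_cancel] at h
  linarith

lemma isOneFormAt_differential_one (f : C^∞⟮𝓘(ℝ, E), M; 𝓘(ℝ, ℝ), ℝ⟯) (x : M) :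
    IsOneFormAt 1 (fun y ↦ differential (E := E) f y) x :=
  (isOneFormAt_differential f x).of_le (by exact WithTop.coe_le_coe.2 le_top)

lemma delta_sum_smul_differential {ι : Type*} (s : Finset ι) {f : ι → M → ℝ}
    {g : ι → C^∞⟮𝓘(ℝ, E), M; 𝓘(ℝ, ℝ), ℝ⟯} {x : M}
    (hf : ∀ i ∈ s, ContMDiffAt 𝓘(ℝ, E) 𝓘(ℝ, ℝ) 1 (f i) x) :
    L.delta (fun y ↦ ∑ i ∈ s, f i y • differential (g i) y) x =
      ∑ i ∈ s, (differential (f i) x (L.symbol x (differential (g i) x)) +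
        f i x * L.op (g i) x) := by
  rw [L.delta_sum s fun i hi ↦ (isOneFormAt_differential_one (g i) x).smul (hf i hi)]
  refine Finset.sum_congr rfl fun i hi ↦ ?_
  rw [L.delta_smul_at ((hf i hi).mdifferentiableAt (by simp)) (isOneFormAt_differential_one _ x),
    delta_differential]

/-- `δ^L` maps smooth 1-forms to smooth functions. -/
lemma contMDiffAt_delta {φ : ∀ x : M, TangentSpace 𝓘(ℝ, E) x →L[ℝ] ℝ} {x : M} {U : Set M}
    (hU : U ∈ 𝓝 x) (hφ : ∀ y ∈ U, IsOneFormAt ∞ φ y) :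
    ContMDiffAt 𝓘(ℝ, E) 𝓘(ℝ, ℝ) ∞ (fun y ↦ L.delta φ y) x := by
  obtain ⟨f, g, hfg⟩ := exists_eventually_eq_sum_differential hU hφ
  have h : ContMDiffAt 𝓘(ℝ, E) 𝓘(ℝ, ℝ) ∞
      (fun y ↦ ∑ i, (L.gamma (f i) (g i) y + f i y * L.op (g i) y)) x :=
    contMDiffAt_finsetSum fun i _ ↦ ((L.gamma (f i) (g i)).contMDiff x).add
      (((f i).contMDiff x).mul ((L.op (g i)).contMDiff x))
  refine h.congr_of_eventuallyEq ?_
  filter_upwards [hfg.eventually_nhds] with y hy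
  rw [L.delta_congr hy, L.delta_sum_smul_differential Finset.univ fun i _ ↦
    ((f i).contMDiff y).of_le (by exact WithTop.coe_le_coe.2 le_top)]
  simp only [differential_symbol_eq_gamma]

variable {L} in
lemma symbol_of_op_eq_add {L₁ L₂ : DiffusionOperator E M} (h : L.op = L₁.op + L₂.op) (x : M)
    (l : TangentSpace 𝓘(ℝ, E) x →L[ℝ] ℝ) : L.symbol x l = L₁.symbol x l + L₂.symbol x l := by
  refine vector_ext_differential fun f ↦ ?_
  rw [← differential_coordFun x l, map_add]
  simp only [differential_symbol, h, LinearMap.add_apply, ContMDiffMap.coe_add, Pi.add_apply]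
  ring

variable {L} in
lemma delta_of_op_eq_add {L₁ L₂ : DiffusionOperator E M} (h : L.op = L₁.op + L₂.op)
    (φ : ∀ x : M, TangentSpace 𝓘(ℝ, E) x →L[ℝ] ℝ) (x : M) :
    L.delta φ x = L₁.delta φ x + L₂.delta φ x := by
  unfold delta
  rw [← Finset.sum_add_distrib]
  refine Finset.sum_congr rfl fun i _ ↦ ?_
  rw [symbol_of_op_eq_add h, h, LinearMap.add_apply, ContMDiffMap.coe_add, Pi.add_apply, map_add]
  ring

end DiffusionOperator
end Symbol

/-! ### Operators related by a smooth map -/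

section Related
variable {E : Type*} [NormedAddCommGroup E] [NormedSpace ℝ E]
  {M : Type*} [TopologicalSpace M] [ChartedSpace E M]
  {E' : Type*} [NormedAddCommGroup E'] [NormedSpace ℝ E']
  {N : Type*} [TopologicalSpace N] [ChartedSpace E' N]
  {F : C^∞⟮𝓘(ℝ, E'), N; 𝓘(ℝ, E), M⟯}

lemma differential_comp {f : M → ℝ} {u : N} (hf : MDifferentiableAt 𝓘(ℝ, E) 𝓘(ℝ, ℝ) f (F u)) :
    differential (E := E') (fun v ↦ f (F v)) u =
      (differential f (F u)).comp (mfderiv 𝓘(ℝ, E') 𝓘(ℝ, E) F u) :=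
  mfderiv_comp (I' := 𝓘(ℝ, E)) u hf (F.contMDiff.mdifferentiableAt (by simp))

/-- The pull-back of a 1-form. -/
def pullbackForm (F : C^∞⟮𝓘(ℝ, E'), N; 𝓘(ℝ, E), M⟯)
    (φ : ∀ x : M, TangentSpace 𝓘(ℝ, E) x →L[ℝ] ℝ) (u : N) : TangentSpace 𝓘(ℝ, E') u →L[ℝ] ℝ :=
  (φ (F u)).comp (mfderiv 𝓘(ℝ, E') 𝓘(ℝ, E) F u)

variable [IsManifold 𝓘(ℝ, E) ∞ M] [FiniteDimensional ℝ E] [T2Space M]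

/-- In coordinates `x^i` at `F u`, the pull-back of `∑ φ_i dx^i` is `∑ (φ_i ∘ F) d(x^i ∘ F)`. -/
lemma pullbackForm_eventually_eq {φ : ∀ x : M, TangentSpace 𝓘(ℝ, E) x →L[ℝ] ℝ} {u : N} :
    ∀ᶠ v in 𝓝 u, pullbackForm F φ v = ∑ i, φ (F v) (coordVector (F u) i (F v)) •
      differential ((coordFun (F u) (dualCovector (F u) i)).comp F) v := by
  filter_upwards [F.contMDiff.continuous.continuousAt.eventually
    (oneForm_eventually_eq_sum φ (F u))] with v hv
  unfold pullbackForm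
  conv_lhs => rw [hv]
  ext w
  simp only [ContinuousLinearMap.comp_apply, sum_apply, smul_apply]
  refine Finset.sum_congr rfl fun i _ ↦ ?_
  congr 1
  exact congrArg (fun l ↦ l w) (differential_comp (F := F) (mdiffAt (E := E) _ (F v))).symm

variable [IsManifold 𝓘(ℝ, E') ∞ N] [FiniteDimensional ℝ E'] [T2Space N]

lemma isOneFormAt_pullbackForm {k : ℕ∞ω} (hk : k ≤ ∞)
    {φ : ∀ x : M, TangentSpace 𝓘(ℝ, E) x →L[ℝ] ℝ} {u : N} (hφ : IsOneFormAt k φ (F u)) :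
    IsOneFormAt k (pullbackForm F φ) u := by
  have h : IsOneFormAt k (fun v ↦ ∑ i, φ (F v) (coordVector (F u) i (F v)) •
      differential (E := E') ((coordFun (F u) (dualCovector (F u) i)).comp F) v) u :=
    IsOneFormAt.sum fun i _ ↦ IsOneFormAt.smul (φ := fun v ↦
      differential (E := E') ((coordFun (F u) (dualCovector (F u) i)).comp F) v)
      ((hφ.coeff hk i).comp u ((F.contMDiff u).of_le hk))
      ((isOneFormAt_differential _ u).of_le hk)
  exact h.congr pullbackForm_eventually_eq

variable {L : DiffusionOperator E' N} {L' : DiffusionOperator E M}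

/-- Related operators have related symbols: `TF (σ^L (l ∘ TF)) = σ^{L'} l`. -/
lemma IsOver.mfderiv_symbol (h : IsOver F L L') (u : N)
    (l : TangentSpace 𝓘(ℝ, E) (F u) →L[ℝ] ℝ) :
    mfderiv 𝓘(ℝ, E') 𝓘(ℝ, E) F u (L.symbol u (l.comp (mfderiv 𝓘(ℝ, E') 𝓘(ℝ, E) F u))) =
      L'.symbol (F u) l := by
  have key : ∀ f : C^∞⟮𝓘(ℝ, E), M; 𝓘(ℝ, ℝ), ℝ⟯, differential (E := E') (f.comp F) u =
      (differential f (F u)).comp (mfderiv 𝓘(ℝ, E') 𝓘(ℝ, E) F u) :=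
    fun f ↦ differential_comp (F := F) (mdiffAt f (F u))
  refine vector_ext_differential fun f ↦ ?_
  rw [← ContinuousLinearMap.comp_apply, ← key, ← differential_coordFun (F u) l, ← key,
    DiffusionOperator.differential_symbol, DiffusionOperator.differential_symbol]
  have h1 : (f.comp F) * ((coordFun (F u) l).comp F) = (f * coordFun (F u) l).comp F := rfl
  rw [h1, h, h, h]
  rfl

/-- If `L` is over `L'`, then `δ^L (F^* φ) = (δ^{L'} φ) ∘ F`. -/
lemma IsOver.delta_pullbackForm (h : IsOver F L L')
    {φ : ∀ x : M, TangentSpace 𝓘(ℝ, E) x →L[ℝ] ℝ} {u : N} (hφ : IsOneFormAt 1 φ (F u)) :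
    L.delta (pullbackForm F φ) u = L'.delta φ (F u) := by
  have h1 : (1 : ℕ∞ω) ≤ ∞ := by exact WithTop.coe_le_coe.2 le_top
  rw [L.delta_congr pullbackForm_eventually_eq, L.delta_sum_smul_differential Finset.univ
    (f := fun i v ↦ φ (F v) (coordVector (F u) i (F v)))
    fun i _ ↦ (hφ.coeff h1 i).comp u ((F.contMDiff u).of_le h1)]
  unfold DiffusionOperator.delta
  refine Finset.sum_congr rfl fun i _ ↦ ?_
  have h2 := differential_comp (F := F) (u := u) ((hφ.coeff h1 i).mdifferentiableAt (by simp))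
  have h3 : differential (E := E') ((coordFun (F u) (dualCovector (F u) i)).comp F) u =
      (dualCovector (F u) i).comp (mfderiv 𝓘(ℝ, E') 𝓘(ℝ, E) F u) := by
    have := differential_comp (F := F) (mdiffAt (coordFun (F u) (dualCovector (E := E) (F u) i)) (F u))
    rw [differential_coordFun] at this
    exact this
  rw [h2, h3, h, ContinuousLinearMap.comp_apply, h.mfderiv_symbol]
  rfl

end Related

/-! ### Dual frames -/

section DualFrames
variable {E : Type*} [NormedAddCommGroup E] [NormedSpace ℝ E]
  {M : Type*} [TopologicalSpace M] [ChartedSpace E M] {ι : Type*} [Fintype ι] [DecidableEq ι]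

lemma contMDiffAt_matrix_det {k : ℕ∞ω} {m : M → Matrix ι ι ℝ} {x : M}
    (hm : ∀ i j, ContMDiffAt 𝓘(ℝ, E) 𝓘(ℝ, ℝ) k (fun y ↦ m y i j) x) :
    ContMDiffAt 𝓘(ℝ, E) 𝓘(ℝ, ℝ) k (fun y ↦ (m y).det) x := by
  simp only [Matrix.det_apply']
  exact contMDiffAt_finsetSum fun σ _ ↦ contMDiffAt_const.mul
    (contMDiffAt_finsetProd fun i _ ↦ hm _ _)

lemma contMDiffAt_matrix_inv {k : ℕ∞ω} {m : M → Matrix ι ι ℝ} {x : M}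
    (hm : ∀ i j, ContMDiffAt 𝓘(ℝ, E) 𝓘(ℝ, ℝ) k (fun y ↦ m y i j) x) (hdet : (m x).det ≠ 0)
    (i j : ι) : ContMDiffAt 𝓘(ℝ, E) 𝓘(ℝ, ℝ) k (fun y ↦ (m y)⁻¹ i j) x := by
  simp only [Matrix.inv_def, Ring.inverse_eq_inv', Matrix.smul_apply, smul_eq_mul,
    Matrix.adjugate_apply]
  refine ((contMDiffAt_matrix_det hm).inv₀ hdet).mul (contMDiffAt_matrix_det fun a b ↦ ?_)
  by_cases h : a = j
  · subst h
    simp only [Matrix.updateRow_self]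
    exact contMDiffAt_const
  · simp only [Matrix.updateRow_ne h]
    exact hm a b

variable [IsManifold 𝓘(ℝ, E) ∞ M] [FiniteDimensional ℝ E] {x : M} {U : Set M}

/-- Smooth 1-forms with dual vectors at one point have smooth dual vector fields near it. -/
lemma exists_dual_fields {θ : ι → ∀ x : M, TangentSpace 𝓘(ℝ, E) x →L[ℝ] ℝ}
    (hU : U ∈ 𝓝 x) (hθ : ∀ a, ∀ y ∈ U, IsOneFormAt ∞ (θ a) y)
    {z : ι → TangentSpace 𝓘(ℝ, E) x} (hz : ∀ a b, θ a x (z b) = if a = b then 1 else 0) :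
    ∃ V ∈ 𝓝 x, ∃ Z : ι → ∀ y : M, TangentSpace 𝓘(ℝ, E) y,
      (∀ a, ∀ y ∈ V, IsFieldAt ∞ (Z a) y) ∧
      ∀ y ∈ V, ∀ a b, θ a y (Z b y) = if a = b then 1 else 0 := by
  choose c hc using fun b ↦ vector_eq_sum_coordVector (E := E) (mem_chart_source E x) (z b)
  let Z₀ : ι → ∀ y : M, TangentSpace 𝓘(ℝ, E) y := fun b y ↦ ∑ i, c b i • coordVector (E := E) x i y
  have hZ₀ : ∀ b, ∀ y ∈ (chartAt E x).source, IsFieldAt ∞ (Z₀ b) y := fun b y hy ↦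
    IsFieldAt.sum fun i _ ↦ IsFieldAt.smul contMDiffAt_const (isFieldAt_coordVector le_rfl x i hy)
  let m : M → Matrix ι ι ℝ := fun y ↦ Matrix.of fun a b ↦ θ a y (Z₀ b y)
  have hsrc := (chartAt E x).open_source.mem_nhds (mem_chart_source E x)
  have hm : ∀ y ∈ U ∩ (chartAt E x).source, ∀ a b,
      ContMDiffAt 𝓘(ℝ, E) 𝓘(ℝ, ℝ) ∞ (fun y ↦ m y a b) y :=
    fun y hy a b ↦ (hθ a y hy.1).apply (hZ₀ b y hy.2)
  have hmx : m x = 1 := by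
    ext a b
    change θ a x (∑ i, c b i • coordVector (E := E) x i x) = _
    rw [← hc, hz, Matrix.one_apply]
  have hdet : ∀ᶠ y in 𝓝 x, (m y).det ≠ 0 :=
    (contMDiffAt_matrix_det (hm x ⟨mem_of_mem_nhds hU, mem_chart_source E x⟩)).continuousAt.eventually_ne
      (by simp [hmx])
  refine ⟨(U ∩ (chartAt E x).source) ∩ {y | (m y).det ≠ 0},
    Filter.inter_mem (Filter.inter_mem hU hsrc) hdet,
    fun b y ↦ ∑ d, (m y)⁻¹ d b • Z₀ d y, ?_, ?_⟩
  · rintro b y ⟨hy, hy'⟩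
    exact IsFieldAt.sum fun d _ ↦ IsFieldAt.smul (contMDiffAt_matrix_inv (hm y hy) hy' d b)
      (hZ₀ d y hy.2)
  · rintro y ⟨hy, hy'⟩ a b
    have h := congrFun (congrFun (Matrix.mul_nonsing_inv (m y) (Ne.isUnit hy')) a) b
    rw [Matrix.mul_apply, Matrix.one_apply] at h
    rw [← h, map_sum]
    refine Finset.sum_congr rfl fun d _ ↦ ?_
    rw [map_smul, smul_eq_mul, mul_comm]
    rfl

variable [T2Space M]

/-- Smooth vector fields which are linearly independent at a point have smooth dual 1-forms near
it. -/
lemma exists_dual_forms {W : ι → ∀ y : M, TangentSpace 𝓘(ℝ, E) y}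
    (hU : U ∈ 𝓝 x) (hW : ∀ a, ∀ y ∈ U, IsFieldAt ∞ (W a) y)
    (hli : LinearIndependent ℝ (fun a ↦ W a x)) :
    ∃ V ∈ 𝓝 x, ∃ η : ι → ∀ x : M, TangentSpace 𝓘(ℝ, E) x →L[ℝ] ℝ,
      (∀ a, ∀ y ∈ V, IsOneFormAt ∞ (η a) y) ∧
      ∀ y ∈ V, ∀ a b, η a y (W b y) = if a = b then 1 else 0 := by
  obtain ⟨T, hT⟩ := LinearMap.exists_leftInverse_of_injective
    (Fintype.linearCombination ℝ (fun a ↦ W a x))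
    (LinearMap.ker_eq_bot.2 (linearIndependent_iff_injective_fintypeLinearCombination.1 hli))
  let l : ι → TangentSpace 𝓘(ℝ, E) x →L[ℝ] ℝ := fun a ↦
    LinearMap.toContinuousLinearMap (LinearMap.proj a ∘ₗ T)
  have hl : ∀ a b, l a (W b x) = if a = b then 1 else 0 := fun a b ↦ by
    have h1 := congrArg (fun w ↦ w a) (congrArg (fun f ↦ f (Pi.single b 1)) hT)
    simp only [LinearMap.comp_apply, LinearMap.id_apply, Fintype.linearCombination_apply_single,
      one_smul] at h1
    change T (W b x) a = _
    rw [h1, Pi.single_apply]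
  let g : ι → C^∞⟮𝓘(ℝ, E), M; 𝓘(ℝ, ℝ), ℝ⟯ := fun a ↦ coordFun x (l a)
  let m : M → Matrix ι ι ℝ := fun y ↦ Matrix.of fun a b ↦ differential (E := E) (g a) y (W b y)
  have hm : ∀ y ∈ U, ∀ a b, ContMDiffAt 𝓘(ℝ, E) 𝓘(ℝ, ℝ) ∞ (fun y ↦ m y a b) y :=
    fun y hy a b ↦ (isOneFormAt_differential (g a) y).apply (hW b y hy)
  have hmx : m x = 1 := by
    ext a b
    change differential (E := E) (coordFun x (l a)) x (W b x) = _
    rw [differential_coordFun, hl, Matrix.one_apply]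
  have hdet : ∀ᶠ y in 𝓝 x, (m y).det ≠ 0 :=
    (contMDiffAt_matrix_det (hm x (mem_of_mem_nhds hU))).continuousAt.eventually_ne
      (by simp [hmx])
  refine ⟨U ∩ {y | (m y).det ≠ 0}, Filter.inter_mem hU hdet,
    fun a y ↦ ∑ d, (m y)⁻¹ a d • differential (g d) y, ?_, ?_⟩
  · rintro a y ⟨hy, hy'⟩
    exact IsOneFormAt.sum fun d _ ↦ IsOneFormAt.smul (contMDiffAt_matrix_inv (hm y hy) hy' a d)
      (isOneFormAt_differential (g d) y)
  · rintro y ⟨hy, hy'⟩ a b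
    have h := congrFun (congrFun (Matrix.nonsing_inv_mul (m y) (Ne.isUnit hy')) a) b
    rw [Matrix.mul_apply, Matrix.one_apply] at h
    rw [← h, sum_apply]
    rfl

/-- A smooth 1-form near a point has a global smooth multiple which agrees with it near the
point. -/
lemma exists_bump_smul (hU : U ∈ 𝓝 x) : ∃ χ : M → ℝ, (∀ᶠ y in 𝓝 x, χ y = 1) ∧
    (∀ y ∉ U, χ y = 0) ∧ ∀ φ : ∀ x : M, TangentSpace 𝓘(ℝ, E) x →L[ℝ] ℝ,
      (∀ y ∈ U, IsOneFormAt ∞ φ y) → IsOneForm ∞ (fun y ↦ χ y • φ y) := by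
  obtain ⟨b, -, hb⟩ := (SmoothBumpFunction.nhds_basis_tsupport (I := 𝓘(ℝ, E)) x).mem_iff.1
    (interior_mem_nhds.2 hU)
  refine ⟨b, b.eventuallyEq_one, fun y hy ↦ ?_, fun φ hφ ↦ ?_⟩
  · by_contra hne
    exact hy (interior_subset (hb (subset_tsupport _ hne)))
  · refine ContMDiffOn.smul_section_of_tsupport (s := φ) (ψ := b) b.contMDiff.contMDiffOn
      isOpen_interior hb fun y hy ↦ ?_
    exact (hφ y (interior_subset hy)).contMDiffWithinAt

end DualFrames

/-! ### Functions vanishing to second order -/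

section SecondOrder

/-- A function which is `o(‖z - a‖ ^ 2)` has vanishing first and second derivatives at `a`. The
trapezoid estimate for `c z - c a` reduces the second order part to `D² c (z - a) (z - a) =
o(‖z - a‖ ^ 2)`, so that the quadratic form, and by symmetry the bilinear form, vanishes. -/
lemma fderiv_fderiv_eq_zero_of_isLittleO {E : Type*} [NormedAddCommGroup E] [NormedSpace ℝ E]
    {c : E → ℝ} {a : E} (hc : ContDiffAt ℝ ∞ c a)
    (h : c =o[𝓝 a] (fun z ↦ ‖z - a‖ ^ 2)) :
    fderiv ℝ c a = 0 ∧ fderiv ℝ (fderiv ℝ c) a = 0 := by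
  have hca : c a = 0 := by
    have := (h.bound one_pos).self_of_nhds
    simpa using this
  have h1 : fderiv ℝ c a = 0 := by
    refine HasFDerivAt.fderiv (.of_isLittleO ?_)
    simp only [hca, zero_apply, sub_zero]
    refine h.trans_isBigO (Asymptotics.IsBigO.of_bound 1 ?_)
    filter_upwards [Metric.ball_mem_nhds a one_pos] with z hz
    rw [Metric.mem_ball, dist_eq_norm] at hz
    rw [norm_pow, norm_norm, one_mul, sq]
    exact mul_le_of_le_one_left (norm_nonneg _) hz.le
  refine ⟨h1, ?_⟩
  have hD : ContDiffAt ℝ ∞ (fderiv ℝ c) a := hc.fderiv_right (by simp)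
  set D2 := fderiv ℝ (fderiv ℝ c) a with hD2
  have e1 : (fun z ↦ fderiv ℝ c z (z - a)) =o[𝓝 a] (fun z ↦ ‖z - a‖ ^ 2) := by
    have := (h.sub (trapezoid_isLittleO hc)).const_mul_left 2
    refine this.congr_left fun z ↦ ?_
    simp only [hca, h1, zero_apply]
    ring
  have e2 : (fun z ↦ (fderiv ℝ c z - D2 (z - a)) (z - a)) =o[𝓝 a] (fun z ↦ ‖z - a‖ ^ 2) := by
    have h2 := (hD.differentiableAt (by simp)).hasFDerivAt.isLittleO
    simp only [h1, sub_zero] at h2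
    rw [Asymptotics.isLittleO_iff] at h2 ⊢
    intro ε hε
    filter_upwards [h2 hε] with z hz
    rw [norm_pow, norm_norm, sq, ← mul_assoc]
    exact (ContinuousLinearMap.le_opNorm _ _).trans
      (mul_le_mul_of_nonneg_right hz (norm_nonneg _))
  have e3 : (fun z ↦ D2 (z - a) (z - a)) =o[𝓝 a] (fun z ↦ ‖z - a‖ ^ 2) :=
    (e1.sub e2).congr_left fun z ↦ by simp
  -- a quadratic form which is `o(‖z - a‖ ^ 2)` vanishes on each line through `a`
  have hq : ∀ v, D2 v v = 0 := by
    intro v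
    have ht : Filter.Tendsto (fun t : ℝ ↦ a + t • v) (𝓝 0) (𝓝 a) := by
      have : ContinuousAt (fun t : ℝ ↦ a + t • v) 0 := by fun_prop
      simpa [ContinuousAt] using this
    have e4 := e3.comp_tendsto ht
    have e5 : (fun t : ℝ ↦ t ^ 2 * D2 v v) =o[𝓝 0] (fun t : ℝ ↦ t ^ 2) := by
      refine (e4.congr_left (f₂ := fun t ↦ t ^ 2 * D2 v v) fun t ↦ ?_).trans_isBigO
        (Asymptotics.IsBigO.of_bound (‖v‖ ^ 2) (.of_forall fun t ↦ ?_))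
      · simp only [Function.comp_apply, add_sub_cancel_left, map_smul, smul_apply, smul_eq_mul]
        ring
      · simp [norm_smul, mul_pow, mul_comm]
    by_contra hne
    have e6 := e5.bound (half_pos (norm_pos_iff.2 hne))
    obtain ⟨r, hr, hball⟩ := Metric.eventually_nhds_iff_ball.1 e6
    have h7 := hball (r / 2) (by simp [abs_of_pos hr, hr])
    rw [norm_mul] at h7
    have : 0 < ‖(r / 2) ^ 2‖ := norm_pos_iff.2 (pow_ne_zero _ (half_pos hr).ne')
    have : 0 < ‖D2 v v‖ := norm_pos_iff.2 hne
    nlinarith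
  have hsymm : ∀ v w, D2 v w = D2 w v := fun v w ↦
    ((hc.of_le (show (2 : ℕ∞ω) ≤ ∞ from WithTop.coe_le_coe.2 le_top)).isSymmSndFDerivAt
      (by simp)).eq v w
  ext v w
  have := hq (v + w)
  simp only [map_add, add_apply, hq, hsymm w v] at this
  simp only [zero_apply]
  linarith

variable {E : Type*} [NormedAddCommGroup E] [NormedSpace ℝ E]
  {M : Type*} [TopologicalSpace M] [ChartedSpace E M] [IsManifold 𝓘(ℝ, E) ∞ M]
  [FiniteDimensional ℝ E] [T2Space M]

/-- If `f` vanishes to second order at `x`, then `f` and its derivatives along vector fields are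
critical at `x`. -/
lemma differential_lieDeriv_eq_zero {f : C^∞⟮𝓘(ℝ, E), M; 𝓘(ℝ, ℝ), ℝ⟯} {x : M}
    (h : f =o[𝓝 x] (fun y ↦ ‖extChartAt 𝓘(ℝ, E) x y - extChartAt 𝓘(ℝ, E) x x‖ ^ 2)) :
    differential (E := E) f x = 0 ∧ ∀ X : ∀ y : M, TangentSpace 𝓘(ℝ, E) y, IsFieldAt 1 X x →
      differential (E := E) (lieDeriv X f) x = 0 := by
  set c : E → ℝ := fun z : E ↦ f ((extChartAt 𝓘(ℝ, E) x).symm z) with hc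
  set a := extChartAt 𝓘(ℝ, E) x x with ha
  have hcs : ContDiffAt ℝ ∞ c a :=
    (chart_contDiffOn f x).contDiffAt (extChartAt_target_mem_nhds (I := 𝓘(ℝ, E)) x)
  have ht : Filter.Tendsto (extChartAt 𝓘(ℝ, E) x).symm (𝓝 a) (𝓝 x) := by
    have := continuousAt_extChartAt_symm (I := 𝓘(ℝ, E)) x
    simpa [ContinuousAt, ha] using this
  have hlo : c =o[𝓝 a] (fun z ↦ ‖z - a‖ ^ 2) := by
    refine (h.comp_tendsto ht).congr' (.of_forall fun _ ↦ rfl) ?_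
    filter_upwards [extChartAt_target_mem_nhds (I := 𝓘(ℝ, E)) x] with z hz
    simp only [Function.comp_apply, (extChartAt 𝓘(ℝ, E) x).right_inv hz]
  obtain ⟨h1, h2⟩ := fderiv_fderiv_eq_zero_of_isLittleO hcs hlo
  have hd : differential (E := E) f x = 0 := by
    refine differential_eq_of_chart f.contMDiff.continuous.continuousAt ?_
    have := (hcs.differentiableAt (by simp)).hasFDerivAt
    rwa [h1] at this
  refine ⟨hd, fun X hX ↦ ?_⟩
  have hc1 := isOneFormAt_differential f x
  have hk : (1 : ℕ∞ω) ≤ ∞ := by exact WithTop.coe_le_coe.2 le_top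
  have hdi : ∀ i, differential (E := E)
      (fun y ↦ differential (E := E) f y (coordVector x i y)) x = 0 := by
    intro i
    refine differential_eq_of_chart (hc1.coeff le_rfl i).continuousAt ?_
    have h3 : HasFDerivAt (fun z ↦ fderiv ℝ c z (finBasis ℝ E i)) (0 : E →L[ℝ] ℝ) a := by
      have hD : ContDiffAt ℝ ∞ (fderiv ℝ c) a := hcs.fderiv_right (by simp)
      have := (hD.differentiableAt (by simp)).hasFDerivAt.clm_apply
        (hasFDerivAt_const (finBasis ℝ E i) a)
      rw [h2] at this
      convert! this using 1
      ext; simp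
    refine h3.congr_of_eventuallyEq ?_
    filter_upwards [extChartAt_target_mem_nhds (I := 𝓘(ℝ, E)) x] with z hz
    have hs : (extChartAt 𝓘(ℝ, E) x).symm z ∈ (chartAt E x).source := by
      simpa using (extChartAt 𝓘(ℝ, E) x).map_target hz
    refine (differential_symmL f hs _).trans ?_
    rw [(extChartAt 𝓘(ℝ, E) x).right_inv hz]
  have hco : ∀ i, MDifferentiableAt 𝓘(ℝ, E) 𝓘(ℝ, ℝ)
      (fun y ↦ differential (E := E) f y (coordVector x i y)) x := fun i ↦
    (hc1.coeff le_rfl i).mdifferentiableAt (by simp)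
  have hxi : ∀ i, MDifferentiableAt 𝓘(ℝ, E) 𝓘(ℝ, ℝ)
      (fun y ↦ differential (E := E) (coordFun x (dualCovector (E := E) x i)) y (X y)) x := fun i ↦
    (((isOneFormAt_differential _ x).of_le hk).apply hX).mdifferentiableAt (by simp)
  rw [differential_congr (g := fun y ↦ ∑ i, differential (E := E) f y (coordVector x i y) *
      differential (E := E) (coordFun x (dualCovector (E := E) x i)) y (X y)) (by
    filter_upwards [oneForm_eventually_eq_sum (fun y ↦ differential (E := E) f y) x] with y hy
    unfold lieDeriv
    conv_lhs => rw [hy]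
    rw [sum_apply]
    rfl), differential_sum _ (f := fun i y ↦ differential (E := E) f y (coordVector x i y) *
      differential (E := E) (coordFun x (dualCovector (E := E) x i)) y (X y))
      fun i _ ↦ (hco i).mul (hxi i)]
  refine Finset.sum_eq_zero fun i _ ↦ ?_
  rw [differential_mul (hco i) (hxi i), hdi, hd]
  simp

end SecondOrder

/-! ### Geometry of principal bundles -/

/-- The chain rule, with the tangent spaces identified with the model spaces. -/
lemma mfderiv_comp_apply_of_eq
    {E₁ H₁ : Type*} [NormedAddCommGroup E₁] [NormedSpace ℝ E₁] [TopologicalSpace H₁]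
    {I₁ : ModelWithCorners ℝ E₁ H₁} {M₁ : Type*} [TopologicalSpace M₁] [ChartedSpace H₁ M₁]
    {E₂ H₂ : Type*} [NormedAddCommGroup E₂] [NormedSpace ℝ E₂] [TopologicalSpace H₂]
    {I₂ : ModelWithCorners ℝ E₂ H₂} {M₂ : Type*} [TopologicalSpace M₂] [ChartedSpace H₂ M₂]
    {E₃ H₃ : Type*} [NormedAddCommGroup E₃] [NormedSpace ℝ E₃] [TopologicalSpace H₃]
    {I₃ : ModelWithCorners ℝ E₃ H₃} {M₃ : Type*} [TopologicalSpace M₃] [ChartedSpace H₃ M₃]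
    {g : M₂ → M₃} {f : M₁ → M₂} {x : M₁} (y : M₂)
    (hg : MDifferentiableAt I₂ I₃ g y) (hf : MDifferentiableAt I₁ I₂ f x) (hy : f x = y) (v : E₁) :
    (mfderiv I₁ I₃ (g ∘ f) x v : E₃) = mfderiv I₂ I₃ g y (mfderiv I₁ I₂ f x v : E₂) := by
  subst hy
  rw [mfderiv_comp (I' := I₂) x hg hf]
  rfl

section PrincipalGeometry
variable {EM : Type*} [NormedAddCommGroup EM] [NormedSpace ℝ EM]
  {M : Type*} [TopologicalSpace M] [ChartedSpace EM M]
  {EP : Type*} [NormedAddCommGroup EP] [NormedSpace ℝ EP]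
  {P : Type*} [TopologicalSpace P] [ChartedSpace EP P]
  {EG : Type*} [NormedAddCommGroup EG] [NormedSpace ℝ EG]
  {G : Type*} [TopologicalSpace G] [ChartedSpace EG G] [Group G]
  [LieGroup 𝓘(ℝ, EG) ∞ G] [MulAction Gᵐᵒᵖ P]
  {p : C^∞⟮𝓘(ℝ, EP), P; 𝓘(ℝ, EM), M⟯}

namespace IsPrincipalBundle
variable (hp : IsPrincipalBundle EG G p)
include hp

lemma contMDiff_orbit (u : P) :
    ContMDiff 𝓘(ℝ, EG) 𝓘(ℝ, EP) ∞ (fun g : G ↦ MulOpposite.op g • u) :=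
  hp.smooth_action.comp (contMDiff_const.prodMk contMDiff_id)

lemma proj_surjective : Function.Surjective p := by
  intro x
  obtain ⟨U, e, -, hx, hs, ht, -, -, h1, -⟩ := hp.locally_trivial x
  have hm : (x, (1 : G)) ∈ e.target := by rw [ht]; exact ⟨hx, trivial⟩
  refine ⟨e.symm (x, 1), ?_⟩
  rw [← h1 _ (e.map_target hm), e.right_inv hm]

/-- A local section `s` through `u₀`, and the map `γ` measuring the position relative to it. -/
lemma exists_local_section (u₀ : P) : ∃ (U : Set M) (s : M → P) (γ : P → G),
    IsOpen U ∧ p u₀ ∈ U ∧ ContMDiffOn 𝓘(ℝ, EM) 𝓘(ℝ, EP) ∞ s U ∧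
    ContMDiffOn 𝓘(ℝ, EP) 𝓘(ℝ, EG) ∞ γ (p ⁻¹' U) ∧ (∀ x ∈ U, p (s x) = x) ∧ s (p u₀) = u₀ ∧
    γ u₀ = 1 ∧ (∀ u, p u ∈ U → MulOpposite.op (γ u) • s (p u) = u) ∧
    ∀ u, p u ∈ U → ∀ g : G, γ (MulOpposite.op g • u) = γ u * g := by
  obtain ⟨U, e, hU, hx, hs, ht, he, he', h1, h2⟩ := hp.locally_trivial (p u₀)
  have hmt : ∀ x ∈ U, ∀ g : G, (x, g) ∈ e.target := fun x hx g ↦ by rw [ht]; exact ⟨hx, trivial⟩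
  have hms : ∀ u, p u ∈ U → u ∈ e.source := fun u hu ↦ by rw [hs]; exact hu
  have hps : ∀ x ∈ U, ∀ g : G, p (e.symm (x, g)) = x := fun x hx g ↦ by
    rw [← h1 _ (e.map_target (hmt x hx g)), e.right_inv (hmt x hx g)]
  have heq : ∀ u, p u ∈ U → e u = (p u, (e u).2) := fun u hu ↦ by rw [← h1 u (hms u hu)]
  refine ⟨U, fun x ↦ e.symm (x, (e u₀).2), fun u ↦ (e u₀).2⁻¹ * (e u).2, hU, hx, ?_, ?_,
    fun x hx ↦ hps x hx _, ?_, by simp, fun u hu ↦ ?_, fun u hu g ↦ ?_⟩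
  · exact he'.comp (contMDiffOn_id.prodMk contMDiffOn_const) fun x hx ↦ hmt x hx _
  · rw [← hs]
    exact contMDiffOn_const.mul (contMDiff_snd.comp_contMDiffOn he)
  · dsimp only
    rw [← heq u₀ hx, e.left_inv (hms u₀ hx)]
  · have hm' : e.symm (p u, (e u₀).2) ∈ e.source := e.map_target (hmt _ hu _)
    refine e.injOn (hms _ ?_) (hms u hu) ?_
    · rw [hp.proj_smul, hps _ hu]; exact hu
    · rw [h2 _ hm', e.right_inv (hmt _ hu _), heq u hu]
      simp
  · dsimp only
    rw [h2 u (hms u hu), mul_assoc]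

lemma exists_smul_eq {u v : P} (h : p u = p v) : ∃ g : G, v = MulOpposite.op g • u := by
  obtain ⟨U, s, γ, -, hx, -, -, -, hs, -, h1, -⟩ := hp.exists_local_section u
  refine ⟨γ v, ?_⟩
  have := h1 v (h ▸ hx)
  rw [← h, hs] at this
  exact this.symm

lemma mfderiv_proj_surjective (u : P) :
    Function.Surjective (mfderiv 𝓘(ℝ, EP) 𝓘(ℝ, EM) p u) := by
  obtain ⟨U, s, γ, hU, hx, hs, -, hps, hsu, -⟩ := hp.exists_local_section u
  have hsd : MDifferentiableAt 𝓘(ℝ, EM) 𝓘(ℝ, EP) s (p u) :=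
    (hs.contMDiffAt (hU.mem_nhds hx)).mdifferentiableAt (by simp)
  have hid : mfderiv 𝓘(ℝ, EM) 𝓘(ℝ, EM) (p ∘ s) (p u) = ContinuousLinearMap.id ℝ _ := by
    rw [Filter.EventuallyEq.mfderiv_eq (f := id) (by
      filter_upwards [hU.mem_nhds hx] with y hy using hps y hy)]
    exact mfderiv_id
  intro w
  refine ⟨mfderiv 𝓘(ℝ, EM) 𝓘(ℝ, EP) s (p u) w, ?_⟩
  exact (mfderiv_comp_apply_of_eq (g := p) u (p.contMDiff.mdifferentiableAt (by simp)) hsd hsu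
    w).symm.trans (congrArg (fun l : EM →L[ℝ] EM ↦ l w) hid)

lemma mfderiv_proj_fundamental (u : P) (X : GroupLieAlgebra 𝓘(ℝ, EG) G) :
    mfderiv 𝓘(ℝ, EP) 𝓘(ℝ, EM) p u (fundamental (EP := EP) EG u X) = 0 := by
  have h0 : mfderiv 𝓘(ℝ, EG) 𝓘(ℝ, EM) (p ∘ fun g : G ↦ MulOpposite.op g • u) 1 = 0 := by
    have : (p ∘ fun g : G ↦ MulOpposite.op g • u) = fun _ ↦ p u := by
      ext g; exact hp.proj_smul g u
    rw [this]
    exact mfderiv_const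
  exact (mfderiv_comp_apply_of_eq (g := p) u (p.contMDiff.mdifferentiableAt (by simp))
    ((hp.contMDiff_orbit u).mdifferentiableAt (by simp)) (by simp) X).symm.trans
    (congrArg (fun l : EG →L[ℝ] EM ↦ l X) h0)

/-- The derivative of the action at `(u, 1)`. -/
lemma mfderiv_action (u : P) (v : TangentSpace 𝓘(ℝ, EP) u) (X : GroupLieAlgebra 𝓘(ℝ, EG) G) :
    (mfderiv (𝓘(ℝ, EP).prod 𝓘(ℝ, EG)) 𝓘(ℝ, EP)
      (fun q : P × G ↦ MulOpposite.op q.2 • q.1) (u, 1) ((v, X) : EP × EG) : EP) =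
      v + fundamental (EP := EP) EG (G := G) u X := by
  have hd : MDifferentiableAt (𝓘(ℝ, EP).prod 𝓘(ℝ, EG)) 𝓘(ℝ, EP)
      (fun q : P × G ↦ MulOpposite.op q.2 • q.1) (u, 1) :=
    hp.smooth_action.mdifferentiableAt (by simp)
  have h7 := mfderiv_prod_eq_add_apply (v := ((v, X) : EP × EG)) hd
  refine h7.trans ?_
  have h8 : (fun z : P ↦ MulOpposite.op (1 : G) • z) = id := by ext z; simp
  have h9 : mfderiv 𝓘(ℝ, EP) 𝓘(ℝ, EP) (fun z : P ↦ MulOpposite.op (1 : G) • z) u =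
      ContinuousLinearMap.id ℝ EP := by
    rw [h8]; exact mfderiv_id
  exact congrArg (· + _) (congrArg (fun l : EP →L[ℝ] EP ↦ l v) h9)

/-- The fundamental vector fields are injectively parametrized by the Lie algebra, and span the
vertical vectors. -/
lemma fundamental_injective_and_range (u : P) :
    Function.Injective (fundamental (EP := EP) EG (G := G) u) ∧
      LinearMap.range (fundamental (EP := EP) EG (G := G) u).toLinearMap = verticalSpace p u := by
  obtain ⟨U, s, γ, hU, hx, hs, hγ, hps, hsu, hγu, hact, hγg⟩ := hp.exists_local_section u
  have hγd : MDifferentiableAt 𝓘(ℝ, EP) 𝓘(ℝ, EG) γ u :=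
    (hγ.contMDiffAt ((hU.preimage p.contMDiff.continuous).mem_nhds hx)).mdifferentiableAt (by simp)
  have hsd : MDifferentiableAt 𝓘(ℝ, EM) 𝓘(ℝ, EP) s (p u) :=
    (hs.contMDiffAt (hU.mem_nhds hx)).mdifferentiableAt (by simp)
  have hpd : MDifferentiableAt 𝓘(ℝ, EP) 𝓘(ℝ, EM) p u := p.contMDiff.mdifferentiableAt (by simp)
  constructor
  · have h0 : mfderiv 𝓘(ℝ, EG) 𝓘(ℝ, EG) (γ ∘ fun g : G ↦ MulOpposite.op g • u) 1 =
        ContinuousLinearMap.id ℝ _ := by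
      have : (γ ∘ fun g : G ↦ MulOpposite.op g • u) = id := by
        ext g
        exact (hγg u hx g).trans (by rw [hγu, one_mul]; rfl)
      rw [this]
      exact mfderiv_id
    have h2 : ∀ X : GroupLieAlgebra 𝓘(ℝ, EG) G,
        mfderiv 𝓘(ℝ, EP) 𝓘(ℝ, EG) γ u (fundamental (EP := EP) EG u X) = X := fun X ↦
      (mfderiv_comp_apply_of_eq u hγd ((hp.contMDiff_orbit u).mdifferentiableAt (by simp))
        (by simp) X).symm.trans (congrArg (fun l : EG →L[ℝ] EG ↦ l X) h0)
    intro X Y hXY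
    exact (h2 X).symm.trans ((congrArg _ hXY).trans (h2 Y))
  · refine le_antisymm ?_ fun v hv ↦ ?_
    · rintro _ ⟨X, rfl⟩
      exact hp.mfderiv_proj_fundamental u X
    · -- differentiate the identity `u' = s (p u') · γ u'` at `u' = u`
      have hv' : mfderiv 𝓘(ℝ, EP) 𝓘(ℝ, EM) p u v = 0 := hv
      have hsp : MDifferentiableAt 𝓘(ℝ, EP) 𝓘(ℝ, EP) (fun u' ↦ s (p u')) u :=
        MDifferentiableAt.comp (I' := 𝓘(ℝ, EM)) u hsd hpd
      have hactd : MDifferentiableAt (𝓘(ℝ, EP).prod 𝓘(ℝ, EG)) 𝓘(ℝ, EP)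
          (fun q : P × G ↦ MulOpposite.op q.2 • q.1) (u, 1) :=
        hp.smooth_action.mdifferentiableAt (by simp)
      have hid : mfderiv 𝓘(ℝ, EP) 𝓘(ℝ, EP)
          ((fun q : P × G ↦ MulOpposite.op q.2 • q.1) ∘ fun u' ↦ (s (p u'), γ u')) u =
          ContinuousLinearMap.id ℝ _ := by
        rw [Filter.EventuallyEq.mfderiv_eq (f := id) (by
          filter_upwards [(hU.preimage p.contMDiff.continuous).mem_nhds hx] with y hy
          exact hact y hy)]
        exact mfderiv_id
      have h2 : (mfderiv 𝓘(ℝ, EP) (𝓘(ℝ, EP).prod 𝓘(ℝ, EG)) (fun u' ↦ (s (p u'), γ u')) u v :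
          EP × EG) = (0, (mfderiv 𝓘(ℝ, EP) 𝓘(ℝ, EG) γ u v : EG)) := by
        have h4 : (mfderiv 𝓘(ℝ, EP) 𝓘(ℝ, EP) (fun u' ↦ s (p u')) u v : EP) = 0 := by
          refine (mfderiv_comp_apply_of_eq (p u) hsd hpd rfl v).trans ?_
          rw [hv']
          exact map_zero _
        refine (congrArg (fun l : EP →L[ℝ] EP × EG ↦ l v) (hsp.mfderiv_prod hγd)).trans ?_
        exact congrArg (fun w : EP ↦ (w, (mfderiv 𝓘(ℝ, EP) 𝓘(ℝ, EG) γ u v : EG))) h4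
      have h3 := (mfderiv_comp_apply_of_eq (u, (1 : G)) hactd (hsp.prodMk hγd)
        (by simp [hsu, hγu]) v).symm.trans (congrArg (fun l : EP →L[ℝ] EP ↦ l v) hid)
      rw [h2] at h3
      refine ⟨(mfderiv 𝓘(ℝ, EP) 𝓘(ℝ, EG) γ u v : EG), Eq.trans ?_ h3⟩
      exact ((hp.mfderiv_action u 0 _).trans (zero_add _)).symm

/-- Right translation by `a` sends `X^*` to `(Ad a⁻¹ X)^*`. -/
lemma mfderiv_rightTranslation_fundamental (a : G) (u : P) (X : GroupLieAlgebra 𝓘(ℝ, EG) G) :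
    mfderiv 𝓘(ℝ, EP) 𝓘(ℝ, EP) (hp.rightTranslation a) u (fundamental (EP := EP) EG u X) =
      fundamental (EP := EP) EG (MulOpposite.op a • u) (Ad EG a⁻¹ X) := by
  have hconj : ContMDiff 𝓘(ℝ, EG) 𝓘(ℝ, EG) ∞ (fun h : G ↦ a⁻¹ * h * a⁻¹⁻¹) :=
    (contMDiff_const.mul contMDiff_id).mul contMDiff_const
  have h3 : (hp.rightTranslation a ∘ fun g : G ↦ MulOpposite.op g • u) =
      ((fun g : G ↦ MulOpposite.op g • (MulOpposite.op a • u)) ∘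
        fun h : G ↦ a⁻¹ * h * a⁻¹⁻¹) := by
    ext g
    change MulOpposite.op a • MulOpposite.op g • u =
      MulOpposite.op (a⁻¹ * g * a⁻¹⁻¹) • MulOpposite.op a • u
    rw [smul_smul, smul_smul, ← MulOpposite.op_mul, ← MulOpposite.op_mul]
    simp [mul_assoc]
  refine (mfderiv_comp_apply_of_eq (g := hp.rightTranslation a) u
    ((hp.rightTranslation a).contMDiff.mdifferentiableAt (by simp))
    ((hp.contMDiff_orbit u).mdifferentiableAt (by simp)) (by simp) X).symm.trans ?_
  rw [h3]
  exact mfderiv_comp_apply_of_eq (g := fun g : G ↦ MulOpposite.op g • (MulOpposite.op a • u)) 1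
    ((hp.contMDiff_orbit _).mdifferentiableAt (by simp))
    (hconj.mdifferentiableAt (by simp)) (by simp) X

variable [IsManifold 𝓘(ℝ, EP) ∞ P]

lemma isFieldAt_fundamental (X : GroupLieAlgebra 𝓘(ℝ, EG) G) (u : P) :
    IsFieldAt ∞ (fun u : P ↦ fundamental (EP := EP) EG u X) u := by
  have : IsManifold 𝓘(ℝ, EG) ∞ G := ContMDiffMul.toIsManifold
  let fg : P → TangentBundle 𝓘(ℝ, EP) P := fun g ↦ TotalSpace.mk' EP g 0
  have sfg : ContMDiff 𝓘(ℝ, EP) 𝓘(ℝ, EP).tangent ∞ fg := contMDiff_zeroSection _ _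
  let fv : P → TangentBundle 𝓘(ℝ, EG) G := fun _ ↦ TotalSpace.mk' EG 1 X
  have sfv : ContMDiff 𝓘(ℝ, EP) 𝓘(ℝ, EG).tangent ∞ fv := contMDiff_const
  have S₁ := sfg.prodMk sfv
  have S₂ : ContMDiff (𝓘(ℝ, EP).tangent.prod 𝓘(ℝ, EG).tangent) (𝓘(ℝ, EP).prod 𝓘(ℝ, EG)).tangent ∞
      (equivTangentBundleProd 𝓘(ℝ, EP) P 𝓘(ℝ, EG) G).symm := contMDiff_equivTangentBundleProd_symm
  have S₃ := hp.smooth_action.contMDiff_tangentMap (m := ∞) (by simp)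
  have S := ((S₃.comp S₂).comp S₁) u
  refine ContMDiffAt.congr_of_eventuallyEq S (.of_forall fun v ↦ ?_)
  have h9 : (fundamental (EP := EP) EG v X : EP) = (mfderiv (𝓘(ℝ, EP).prod 𝓘(ℝ, EG)) 𝓘(ℝ, EP)
      (fun q : P × G ↦ MulOpposite.op q.2 • q.1) (v, 1) (((0 : EP), (X : EG)) : EP × EG) : EP) :=
    ((hp.mfderiv_action v 0 X).trans (zero_add _)).symm
  refine (congrArg (fun w : EP ↦ (⟨v, w⟩ : TangentBundle 𝓘(ℝ, EP) P)) h9).trans ?_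
  exact TotalSpace.ext (by simp [fg, fv, tangentMap]) HEq.rfl

end IsPrincipalBundle
end PrincipalGeometry

/-! ### The induced operator on the base -/

section Base
variable {EM : Type*} [NormedAddCommGroup EM] [NormedSpace ℝ EM]
  {M : Type*} [TopologicalSpace M] [ChartedSpace EM M]
  {EP : Type*} [NormedAddCommGroup EP] [NormedSpace ℝ EP]
  {P : Type*} [TopologicalSpace P] [ChartedSpace EP P]

/-- In charts, a smooth map is Lipschitz at each point. -/
lemma isBigO_extChartAt_comp (F : C^∞⟮𝓘(ℝ, EP), P; 𝓘(ℝ, EM), M⟯) (u : P) :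
    (fun v ↦ ‖extChartAt 𝓘(ℝ, EM) (F u) (F v) - extChartAt 𝓘(ℝ, EM) (F u) (F u)‖) =O[𝓝 u]
      (fun v ↦ ‖extChartAt 𝓘(ℝ, EP) u v - extChartAt 𝓘(ℝ, EP) u u‖) := by
  have h : MDifferentiableAt 𝓘(ℝ, EP) 𝓘(ℝ, EM) F u := F.contMDiff.mdifferentiableAt (by simp)
  have h2 := h.hasMFDerivAt.2
  rw [ModelWithCorners.range_eq_univ] at h2
  have h4 := HasFDerivWithinAt.hasFDerivAt (E := EP) (F := EM) h2 Filter.univ_mem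
  have h3 := (HasFDerivAt.isBigO_sub (E := EP) (F := EM) h4).comp_tendsto
    (continuousAt_extChartAt (I := 𝓘(ℝ, EP)) u)
  refine (h3.norm_left.norm_right).congr' ?_ (.of_forall fun _ ↦ rfl)
  filter_upwards [extChartAt_source_mem_nhds (I := 𝓘(ℝ, EP)) u] with v hv
  simp only [Function.comp_apply, writtenInExtChartAt, (extChartAt 𝓘(ℝ, EP) u).left_inv hv,
    extChartAt_to_inv]

variable {EG : Type*} [NormedAddCommGroup EG] [NormedSpace ℝ EG]
  {G : Type*} [TopologicalSpace G] [ChartedSpace EG G] [Group G]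
  [LieGroup 𝓘(ℝ, EG) ∞ G] [MulAction Gᵐᵒᵖ P]
  {p : C^∞⟮𝓘(ℝ, EP), P; 𝓘(ℝ, EM), M⟯} (hp : IsPrincipalBundle EG G p)
  {B : DiffusionOperator EP P} (hB : hp.IsEquivariant B)
include hB

namespace IsPrincipalBundle

/-- For an equivariant `B`, the function `B (f ∘ p)` is constant on the fibres. -/
lemma op_comp_proj_eq (f : C^∞⟮𝓘(ℝ, EM), M; 𝓘(ℝ, ℝ), ℝ⟯) {u v : P} (h : p u = p v) :
    B.op (f.comp p) u = B.op (f.comp p) v := by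
  obtain ⟨g, rfl⟩ := hp.exists_smul_eq h
  have h1 : (f.comp p).comp (hp.rightTranslation g) = f.comp p := by
    ext w
    exact congrArg f (hp.proj_smul g w)
  have h2 := hB g (f.comp p)
  rw [h1] at h2
  exact congrArg (fun F : C^∞⟮𝓘(ℝ, EP), P; 𝓘(ℝ, ℝ), ℝ⟯ ↦ F u) h2

/-- An equivariant diffusion operator on `P` lies over a diffusion operator on `M`, whose value at
`x` is that of `B (f ∘ p)` at any point above `x`. -/
lemma exists_isOver : ∃ A : DiffusionOperator EM M, IsOver p B A := by
  let q : M → P := Function.surjInv hp.proj_surjective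
  have hq : ∀ x, p (q x) = x := Function.surjInv_eq hp.proj_surjective
  have hval : ∀ (f : C^∞⟮𝓘(ℝ, EM), M; 𝓘(ℝ, ℝ), ℝ⟯) u,
      B.op (f.comp p) (q (p u)) = B.op (f.comp p) u := fun f u ↦ hp.op_comp_proj_eq hB f (hq _)
  have hsm : ∀ f : C^∞⟮𝓘(ℝ, EM), M; 𝓘(ℝ, ℝ), ℝ⟯,
      ContMDiff 𝓘(ℝ, EM) 𝓘(ℝ, ℝ) ∞ (fun x ↦ B.op (f.comp p) (q x)) := by
    intro f x
    obtain ⟨U, s, γ, hU, hx, hs, -, hps, -⟩ := hp.exists_local_section (q x)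
    rw [hq] at hx
    have h1 : ContMDiffAt 𝓘(ℝ, EM) 𝓘(ℝ, ℝ) ∞ (fun y ↦ B.op (f.comp p) (s y)) x :=
      ((B.op (f.comp p)).contMDiff _).comp x (hs.contMDiffAt (hU.mem_nhds hx))
    refine h1.congr_of_eventuallyEq ?_
    filter_upwards [hU.mem_nhds hx] with y hy
    exact hp.op_comp_proj_eq hB f ((hq y).trans (hps y hy).symm)
  refine ⟨{
    op :=
      { toFun := fun f ↦ ⟨fun x ↦ B.op (f.comp p) (q x), hsm f⟩
        map_add' := fun f g ↦ ?_
        map_smul' := fun c f ↦ ?_ }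
    order_two := fun f x hf ↦ ?_
    map_one := ?_
    semi_elliptic := fun f x ↦ ?_ }, ?_⟩
  · ext x
    have : (f + g).comp p = f.comp p + g.comp p := rfl
    change B.op ((f + g).comp p) (q x) = B.op (f.comp p) (q x) + B.op (g.comp p) (q x)
    rw [this, map_add]
    rfl
  · ext x
    have : (c • f).comp p = c • f.comp p := rfl
    change B.op ((c • f).comp p) (q x) = c • B.op (f.comp p) (q x)
    rw [this, map_smul]
    rfl
  · change B.op (f.comp p) (q x) = 0
    refine B.order_two _ _ ?_
    have h1 : f =o[𝓝 (p (q x))] (fun y ↦ ‖extChartAt 𝓘(ℝ, EM) (p (q x)) y -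
        extChartAt 𝓘(ℝ, EM) (p (q x)) (p (q x))‖ ^ 2) := by rw [hq]; exact hf
    exact (h1.comp_tendsto p.contMDiff.continuous.continuousAt).trans_isBigO
      ((isBigO_extChartAt_comp p (q x)).pow 2)
  · ext x
    have : (1 : C^∞⟮𝓘(ℝ, EM), M; 𝓘(ℝ, ℝ), ℝ⟯).comp p = 1 := rfl
    change B.op ((1 : C^∞⟮𝓘(ℝ, EM), M; 𝓘(ℝ, ℝ), ℝ⟯).comp p) (q x) = 0
    rw [this, B.map_one]
    rfl
  · have h := B.semi_elliptic (f.comp p) (q x)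
    have h1 : (f.comp p) (q x) = f x := congrArg f (hq x)
    rw [h1] at h
    exact h
  · intro f
    ext u
    exact (hval f u).symm

end IsPrincipalBundle
end Base

section BaseUnique
variable {EM : Type*} [NormedAddCommGroup EM] [NormedSpace ℝ EM]
  {M : Type*} [TopologicalSpace M] [ChartedSpace EM M]
  {EP : Type*} [NormedAddCommGroup EP] [NormedSpace ℝ EP]
  {P : Type*} [TopologicalSpace P] [ChartedSpace EP P]

lemma IsOver.unique {p : C^∞⟮𝓘(ℝ, EP), P; 𝓘(ℝ, EM), M⟯} (hp : Function.Surjective p)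
    {B : DiffusionOperator EP P} {A A' : DiffusionOperator EM M} (h : IsOver p B A)
    (h' : IsOver p B A') : A' = A := by
  ext f x
  obtain ⟨u, rfl⟩ := hp x
  exact congrArg (fun F : C^∞⟮𝓘(ℝ, EP), P; 𝓘(ℝ, ℝ), ℝ⟯ ↦ F u) ((h' f).symm.trans (h f))

end BaseUnique

/-! ### Local frames for the image of the symbol -/

section Frames
variable {E : Type*} [NormedAddCommGroup E] [NormedSpace ℝ E]
  {M : Type*} [TopologicalSpace M] [ChartedSpace E M]

lemma linearIndependent_of_dual {V ι : Type*} [AddCommGroup V] [Module ℝ V] [Fintype ι]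
    [DecidableEq ι] {W : ι → V} {F : Type*} [FunLike F V ℝ] [LinearMapClass F ℝ V ℝ] {η : ι → F}
    (h : ∀ a b, η a (W b) = if a = b then 1 else 0) : LinearIndependent ℝ W := by
  rw [Fintype.linearIndependent_iff]
  intro c hc a
  have h1 := congrArg (η a) hc
  simpa [map_sum, h] using h1

variable [IsManifold 𝓘(ℝ, E) ∞ M] [FiniteDimensional ℝ E] [T2Space M]

namespace DiffusionOperator

/-- If the symbol has constant rank, then near every point its image has a frame of gradients. -/
lemma exists_symbol_frame {L : DiffusionOperator E M} {r : ℕ}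
    (hr : ∀ x, finrank ℝ (L.symbolRange x) = r) (x₀ : M) :
    ∃ (U : Set M) (g : Fin r → C^∞⟮𝓘(ℝ, E), M; 𝓘(ℝ, ℝ), ℝ⟯), IsOpen U ∧ x₀ ∈ U ∧
      ∀ y ∈ U, LinearIndependent ℝ (fun i ↦ L.symbol y (differential (g i) y)) ∧
        Submodule.span ℝ (Set.range fun i ↦ L.symbol y (differential (g i) y)) =
          L.symbolRange y := by
  let b := finBasisOfFinrankEq ℝ (L.symbolRange x₀) (hr x₀)
  choose l hl using fun i ↦ (LinearMap.mem_range.1 (b i).2)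
  let g : Fin r → C^∞⟮𝓘(ℝ, E), M; 𝓘(ℝ, ℝ), ℝ⟯ := fun i ↦ coordFun x₀ (l i)
  have hg : ∀ i, L.symbol x₀ (differential (g i) x₀) = b i := fun i ↦ by
    rw [differential_coordFun, hl]
  have hli : LinearIndependent ℝ (fun i ↦ L.symbol x₀ (differential (E := E) (g i) x₀)) := by
    simp only [hg]
    exact b.linearIndependent.map' (L.symbolRange x₀).subtype (Submodule.ker_subtype _)
  obtain ⟨V, hV, η, -, hη⟩ := exists_dual_forms (U := Set.univ) Filter.univ_mem
    (fun i y _ ↦ L.isFieldAt_symbol_differential (g i) y) hli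
  refine ⟨interior V, g, isOpen_interior, mem_interior_iff_mem_nhds.2 hV, fun y hy ↦ ?_⟩
  have hli' : LinearIndependent ℝ (fun i ↦ L.symbol y (differential (E := E) (g i) y)) :=
    linearIndependent_of_dual (η := fun i ↦ η i y) fun a b ↦ hη y (interior_subset hy) a b
  refine ⟨hli', Submodule.eq_of_le_of_finrank_eq ?_ ?_⟩
  · rw [Submodule.span_le]
    rintro _ ⟨i, rfl⟩
    exact LinearMap.mem_range_self _ _
  · rw [hr y, finrank_span_eq_card hli', Fintype.card_fin]

end DiffusionOperator
end Frames

/-! ### The horizontal lift and the semi-connection -/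

section Horizontal
variable {EM : Type*} [NormedAddCommGroup EM] [NormedSpace ℝ EM]
  {M : Type*} [TopologicalSpace M] [ChartedSpace EM M]
  {EP : Type*} [NormedAddCommGroup EP] [NormedSpace ℝ EP]
  {P : Type*} [TopologicalSpace P] [ChartedSpace EP P]
  [IsManifold 𝓘(ℝ, EM) ∞ M] [IsManifold 𝓘(ℝ, EP) ∞ P]
  [FiniteDimensional ℝ EM] [FiniteDimensional ℝ EP] [T2Space M] [T2Space P]
  {p : C^∞⟮𝓘(ℝ, EP), P; 𝓘(ℝ, EM), M⟯} {B : DiffusionOperator EP P} {A : DiffusionOperator EM M}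

/-- The kernel of `σ^A` pulls back into the kernel of `σ^B`, since the two quadratic forms agree on
pulled back covectors. -/
lemma IsOver.symbol_comp_eq_zero (hBA : IsOver p B A) (u : P)
    {l : TangentSpace 𝓘(ℝ, EM) (p u) →L[ℝ] ℝ} (h : A.symbol (p u) l = 0) :
    B.symbol u (l.comp (mfderiv 𝓘(ℝ, EP) 𝓘(ℝ, EM) p u)) = 0 := by
  refine B.symbol_eq_zero ?_
  rw [ContinuousLinearMap.comp_apply, hBA.mfderiv_symbol, h, map_zero]

/-- The map `ℓ ↦ σ^B (ℓ ∘ Tp)` factors through `σ^A`. -/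
lemma IsOver.exists_isHorizontalLiftMap (hBA : IsOver p B A) :
    ∃ h : ∀ u : P, A.symbolRange (p u) →ₗ[ℝ] TangentSpace 𝓘(ℝ, EP) u,
      IsHorizontalLiftMap p A B h := by
  let f : ∀ u : P, (TangentSpace 𝓘(ℝ, EM) (p u) →L[ℝ] ℝ) →ₗ[ℝ] TangentSpace 𝓘(ℝ, EP) u := fun u ↦
    { toFun := fun l ↦ B.symbol u (l.comp (mfderiv 𝓘(ℝ, EP) 𝓘(ℝ, EM) p u))
      map_add' := fun l l' ↦ by rw [ContinuousLinearMap.add_comp, map_add]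
      map_smul' := fun c l ↦ by rw [ContinuousLinearMap.smul_comp, map_smul]; rfl }
  have hle : ∀ u, LinearMap.ker (A.symbol (p u)) ≤ LinearMap.ker (f u) := fun u l hl ↦
    hBA.symbol_comp_eq_zero u hl
  refine ⟨fun u ↦ ((LinearMap.ker (A.symbol (p u))).liftQ (f u) (hle u)) ∘ₗ (A.symbol (p u)).quotKerEquivRange.symm.toLinearMap, ?_⟩
  intro u l
  change ((LinearMap.ker (A.symbol (p u))).liftQ (f u) (hle u))
    ((A.symbol (p u)).quotKerEquivRange.symm ⟨A.symbol (p u) l, _⟩) = _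
  rw [LinearMap.quotKerEquivRange_symm_apply_image]
  rfl

variable {h : ∀ u : P, A.symbolRange (p u) →ₗ[ℝ] TangentSpace 𝓘(ℝ, EP) u}

lemma IsHorizontalLiftMap.unique {h' : ∀ u : P, A.symbolRange (p u) →ₗ[ℝ] TangentSpace 𝓘(ℝ, EP) u}
    (hh : IsHorizontalLiftMap p A B h) (hh' : IsHorizontalLiftMap p A B h') : h' = h := by
  funext u
  ext ⟨v, l, rfl⟩
  exact (hh' u l).trans (hh u l).symm

lemma IsHorizontalLiftMap.mfderiv_apply (hh : IsHorizontalLiftMap p A B h) (hBA : IsOver p B A)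
    (u : P) (v : A.symbolRange (p u)) :
    mfderiv 𝓘(ℝ, EP) 𝓘(ℝ, EM) p u (h u v) = v := by
  obtain ⟨v, l, rfl⟩ := v
  rw [hh u l, hBA.mfderiv_symbol]

lemma IsHorizontalLiftMap.mem_range (hh : IsHorizontalLiftMap p A B h) {u : P}
    {v : TangentSpace 𝓘(ℝ, EP) u} : v ∈ LinearMap.range (h u) ↔
      ∃ l : TangentSpace 𝓘(ℝ, EM) (p u) →L[ℝ] ℝ,
        v = B.symbol u (l.comp (mfderiv 𝓘(ℝ, EP) 𝓘(ℝ, EM) p u)) := by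
  constructor
  · rintro ⟨⟨w, l, rfl⟩, rfl⟩
    exact ⟨l, hh u l⟩
  · rintro ⟨l, rfl⟩
    exact ⟨_, hh u l⟩

lemma differential_comp_eq (f : C^∞⟮𝓘(ℝ, EM), M; 𝓘(ℝ, ℝ), ℝ⟯) (u : P) :
    differential (E := EP) (f.comp p) u =
      (differential f (p u)).comp (mfderiv 𝓘(ℝ, EP) 𝓘(ℝ, EM) p u) :=
  differential_comp (F := p) (mdiffAt f (p u))

/-- Lifts of a local frame of the image of `σ^A` form a local frame of the horizontal
distribution. -/
lemma IsHorizontalLiftMap.frame (hh : IsHorizontalLiftMap p A B h) (hBA : IsOver p B A)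
    {r : ℕ} {g : Fin r → C^∞⟮𝓘(ℝ, EM), M; 𝓘(ℝ, ℝ), ℝ⟯} {u : P}
    (hli : LinearIndependent ℝ (fun i ↦ A.symbol (p u) (differential (g i) (p u))))
    (hspan : Submodule.span ℝ (Set.range fun i ↦ A.symbol (p u) (differential (g i) (p u))) =
      A.symbolRange (p u)) :
    LinearIndependent ℝ (fun i ↦ B.symbol u (differential ((g i).comp p) u)) ∧
      Submodule.span ℝ (Set.range fun i ↦ B.symbol u (differential ((g i).comp p) u)) =
        LinearMap.range (h u) := by
  constructor
  · refine LinearIndependent.of_comp (mfderiv 𝓘(ℝ, EP) 𝓘(ℝ, EM) p u).toLinearMap ?_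
    convert! hli using 1
    funext i
    change mfderiv 𝓘(ℝ, EP) 𝓘(ℝ, EM) p u (B.symbol u (differential ((g i).comp p) u)) = _
    rw [differential_comp_eq, hBA.mfderiv_symbol]
  · refine le_antisymm (Submodule.span_le.2 ?_) fun v hv ↦ ?_
    · rintro _ ⟨i, rfl⟩
      exact hh.mem_range.2 ⟨_, by dsimp only; rw [differential_comp_eq]⟩
    · obtain ⟨⟨w, hw⟩, rfl⟩ := hv
      have hw' := hw
      rw [← hspan, Submodule.mem_span_range_iff_exists_fun] at hw'
      obtain ⟨c, rfl⟩ := hw'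
      have h1 : h u ⟨_, hw⟩ = ∑ i, c i • B.symbol u (differential ((g i).comp p) u) := by
        have h2 := hh u (∑ i, c i • differential (g i) (p u))
        have h3 : (⟨_, LinearMap.mem_range_self _ (∑ i, c i • differential (g i) (p u))⟩ :
            A.symbolRange (p u)) =
            ⟨∑ i, c i • A.symbol (p u) (differential (g i) (p u)), hw⟩ := by
          ext; simp only [map_sum, map_smul]
        rw [h3] at h2
        rw [h2]
        simp only [differential_comp_eq, ← map_smul, ← map_sum]
        congr 1
        ext w
        simp [sum_apply]
      rw [h1]
      exact Submodule.sum_mem _ fun i _ ↦ Submodule.smul_mem _ _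
        (Submodule.subset_span ⟨i, rfl⟩)

variable {EG : Type*} [NormedAddCommGroup EG] [NormedSpace ℝ EG]
  {G : Type*} [TopologicalSpace G] [ChartedSpace EG G] [Group G]
  [LieGroup 𝓘(ℝ, EG) ∞ G] [MulAction Gᵐᵒᵖ P]

lemma IsPrincipalBundle.isOver_rightTranslation (hp : IsPrincipalBundle EG G p)
    (hB : hp.IsEquivariant B) (a : G) : IsOver (hp.rightTranslation a) B B :=
  fun f ↦ hB a f

lemma IsPrincipalBundle.mfderiv_proj_rightTranslation (hp : IsPrincipalBundle EG G p) (a : G)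
    (u : P) (w : TangentSpace 𝓘(ℝ, EP) u) :
    (mfderiv 𝓘(ℝ, EP) 𝓘(ℝ, EM) p (MulOpposite.op a • u)
      (mfderiv 𝓘(ℝ, EP) 𝓘(ℝ, EP) (hp.rightTranslation a) u w) : EM) =
      mfderiv 𝓘(ℝ, EP) 𝓘(ℝ, EM) p u w := by
  refine (mfderiv_comp_apply_of_eq (g := p) (MulOpposite.op a • u)
    (p.contMDiff.mdifferentiableAt (by simp))
    ((hp.rightTranslation a).contMDiff.mdifferentiableAt (by simp)) rfl w).symm.trans ?_
  have : p ∘ hp.rightTranslation a = p := by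
    funext v; exact hp.proj_smul a v
  rw [this]

lemma IsHorizontalLiftMap.map_mfderiv_rightTranslation (hp : IsPrincipalBundle EG G p)
    (hB : hp.IsEquivariant B) (hh : IsHorizontalLiftMap p A B h) (a : G) (u : P) :
    (LinearMap.range (h u)).map (mfderiv 𝓘(ℝ, EP) 𝓘(ℝ, EP) (hp.rightTranslation a) u).toLinearMap =
      LinearMap.range (h (MulOpposite.op a • u)) := by
  have hR := hp.isOver_rightTranslation hB a
  have key : ∀ l : EM →L[ℝ] ℝ,
      mfderiv 𝓘(ℝ, EP) 𝓘(ℝ, EP) (hp.rightTranslation a) u (B.symbol u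
        (ContinuousLinearMap.comp (l : TangentSpace 𝓘(ℝ, EM) (p u) →L[ℝ] ℝ)
          (mfderiv 𝓘(ℝ, EP) 𝓘(ℝ, EM) p u))) =
      B.symbol (MulOpposite.op a • u)
        (ContinuousLinearMap.comp (l : TangentSpace 𝓘(ℝ, EM) (p (MulOpposite.op a • u)) →L[ℝ] ℝ)
          (mfderiv 𝓘(ℝ, EP) 𝓘(ℝ, EM) p (MulOpposite.op a • u))) := by
    intro l
    refine Eq.trans ?_ (hR.mfderiv_symbol u
      (ContinuousLinearMap.comp (l : TangentSpace 𝓘(ℝ, EM) (p (MulOpposite.op a • u)) →L[ℝ] ℝ)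
          (mfderiv 𝓘(ℝ, EP) 𝓘(ℝ, EM) p (MulOpposite.op a • u))))
    congr 2
    ext w
    exact congrArg l (hp.mfderiv_proj_rightTranslation a u w).symm
  ext v
  constructor
  · rintro ⟨w, hw, rfl⟩
    obtain ⟨l, rfl⟩ := hh.mem_range.1 hw
    exact hh.mem_range.2 ⟨(l : EM →L[ℝ] ℝ), key l⟩
  · intro hv
    obtain ⟨l, rfl⟩ := hh.mem_range.1 hv
    exact ⟨_, hh.mem_range.2 ⟨(l : EM →L[ℝ] ℝ), rfl⟩, key l⟩

lemma IsHorizontalLiftMap.isInvariantSemiConnection (hp : IsPrincipalBundle EG G p)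
    (hB : hp.IsEquivariant B) (hBA : IsOver p B A) (hh : IsHorizontalLiftMap p A B h)
    (hA : A.HasConstantRank) :
    IsInvariantSemiConnection hp A.symbolRange (fun u ↦ LinearMap.range (h u)) := by
  obtain ⟨r, hr⟩ := hA
  refine ⟨⟨r, fun x₀ ↦ ?_⟩, ⟨r, fun u₀ ↦ ?_⟩, fun u ↦ ⟨?_, ?_, ?_⟩,
    hh.map_mfderiv_rightTranslation hp hB⟩
  · obtain ⟨U, g, hU, hx, hg⟩ := DiffusionOperator.exists_symbol_frame hr x₀
    exact ⟨U, hU, hx, _, fun i y _ ↦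
      (A.isFieldAt_symbol_differential (g i) y).contMDiffWithinAt, hg⟩
  · obtain ⟨U, g, hU, hx, hg⟩ := DiffusionOperator.exists_symbol_frame hr (p u₀)
    exact ⟨p ⁻¹' U, hU.preimage p.contMDiff.continuous, hx,
      fun i u ↦ B.symbol u (differential ((g i).comp p) u), fun i y _ ↦
      (B.isFieldAt_symbol_differential _ y).contMDiffWithinAt,
      fun u hu ↦ hh.frame hBA (hg (p u) hu).1 (hg (p u) hu).2⟩
  · rintro _ ⟨v, rfl⟩
    rw [hh.mfderiv_apply hBA]
    exact v.2
  · rintro _ ⟨v, rfl⟩ _ ⟨w, rfl⟩ hvw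
    rw [hh.mfderiv_apply hBA, hh.mfderiv_apply hBA] at hvw
    rw [Subtype.ext hvw]
  · intro w hw
    exact ⟨h u ⟨w, hw⟩, ⟨_, rfl⟩, hh.mfderiv_apply hBA u _⟩

end Horizontal

/-! ### The semi-connection form -/

section Form
variable {EM : Type*} [NormedAddCommGroup EM] [NormedSpace ℝ EM]
  {M : Type*} [TopologicalSpace M] [ChartedSpace EM M]
  {EP : Type*} [NormedAddCommGroup EP] [NormedSpace ℝ EP]
  {P : Type*} [TopologicalSpace P] [ChartedSpace EP P]
  [IsManifold 𝓘(ℝ, EM) ∞ M] [IsManifold 𝓘(ℝ, EP) ∞ P]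
  [FiniteDimensional ℝ EM] [FiniteDimensional ℝ EP] [T2Space M] [T2Space P]
  {EG : Type*} [NormedAddCommGroup EG] [NormedSpace ℝ EG] [FiniteDimensional ℝ EG]
  {G : Type*} [TopologicalSpace G] [ChartedSpace EG G] [Group G]
  [LieGroup 𝓘(ℝ, EG) ∞ G] [MulAction Gᵐᵒᵖ P]
  {p : C^∞⟮𝓘(ℝ, EP), P; 𝓘(ℝ, EM), M⟯} (hp : IsPrincipalBundle EG G p)
  {H : ∀ u : P, Submodule ℝ (TangentSpace 𝓘(ℝ, EP) u)}
include hp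

namespace IsPrincipalBundle

lemma fundamental_mem_verticalSpace (u : P) (X : GroupLieAlgebra 𝓘(ℝ, EG) G) :
    fundamental (EP := EP) EG u X ∈ verticalSpace p u :=
  hp.mfderiv_proj_fundamental u X

lemma exists_fundamental_eq {u : P} {v : TangentSpace 𝓘(ℝ, EP) u} (hv : v ∈ verticalSpace p u) :
    ∃ X : GroupLieAlgebra 𝓘(ℝ, EG) G, fundamental (EP := EP) EG u X = v := by
  rw [← (hp.fundamental_injective_and_range u).2] at hv
  exact hv

/-- The fundamental vector fields stay independent modulo a distribution transverse to the
fibres. -/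
lemma mkQ_comp_fundamental_injective (u : P) (hH : Disjoint (H u) (verticalSpace p u)) :
    LinearMap.ker ((H u).mkQ ∘ₗ (fundamental (EP := EP) EG (G := G) u).toLinearMap) = ⊥ := by
  rw [LinearMap.ker_eq_bot']
  intro X hX
  have h1 : fundamental (EP := EP) EG u X ∈ H u := by
    simpa using hX
  have h2 := Submodule.disjoint_def.1 hH _ h1 (hp.fundamental_mem_verticalSpace u X)
  exact (hp.fundamental_injective_and_range u).1 (by rw [h2, map_zero])

/-- The form `ϖ` is the restriction of a left inverse of `X ↦ X^*(u)` modulo `H u`. -/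
lemma exists_isSemiConnectionForm (hH : ∀ u, Disjoint (H u) (verticalSpace p u)) :
    ∃ ϖ : ∀ u : P, ↥(H u ⊔ verticalSpace p u) →ₗ[ℝ] GroupLieAlgebra 𝓘(ℝ, EG) G,
      IsSemiConnectionForm p H ϖ := by
  choose g hg using fun u ↦
    LinearMap.exists_leftInverse_of_injective _ (hp.mkQ_comp_fundamental_injective u (hH u))
  refine ⟨fun u ↦ g u ∘ₗ (H u).mkQ ∘ₗ Submodule.subtype _, fun u v hv ↦ ?_, fun u X ↦
    ⟨Submodule.mem_sup_right (hp.fundamental_mem_verticalSpace u X), ?_⟩⟩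
  · have : (H u).mkQ v = 0 := by simpa using hv
    change g u ((H u).mkQ v) = 0
    rw [this, map_zero]
  · exact LinearMap.congr_fun (hg u) X

end IsPrincipalBundle

variable {ϖ ϖ' : ∀ u : P, ↥(H u ⊔ verticalSpace p u) →ₗ[ℝ] GroupLieAlgebra 𝓘(ℝ, EG) G}

lemma IsSemiConnectionForm.unique (h : IsSemiConnectionForm p H ϖ)
    (h' : IsSemiConnectionForm p H ϖ') : ϖ' = ϖ := by
  funext u
  ext ⟨v, hv⟩
  obtain ⟨x, hx, y, hy, rfl⟩ := Submodule.mem_sup.1 hv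
  obtain ⟨X, rfl⟩ := hp.exists_fundamental_eq hy
  have key : ∀ {τ : ∀ u : P, ↥(H u ⊔ verticalSpace p u) →ₗ[ℝ] GroupLieAlgebra 𝓘(ℝ, EG) G},
      IsSemiConnectionForm p H τ → τ u ⟨_, hv⟩ = X := by
    intro τ hτ
    obtain ⟨hX, hX'⟩ := hτ.2 u X
    have : (⟨_, hv⟩ : ↥(H u ⊔ verticalSpace p u)) =
      ⟨x, Submodule.mem_sup_left hx⟩ + ⟨_, hX⟩ := rfl
    rw [this, map_add, hX', hτ.1 u ⟨x, _⟩ hx, zero_add]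
  rw [key h, key h']

/-- A covector extends a component of `ϖ` if and only if it vanishes on `H` and takes the right
values on fundamental vector fields. -/
lemma IsSemiConnectionForm.extendsAt_iff (h : IsSemiConnectionForm p H ϖ) {n : ℕ}
    {b : Basis (Fin n) ℝ (GroupLieAlgebra 𝓘(ℝ, EG) G)} {l : Fin n} {u : P}
    {ℓ : TangentSpace 𝓘(ℝ, EP) u →L[ℝ] ℝ} :
    ExtendsAt ϖ b l u ℓ ↔ (∀ v ∈ H u, ℓ v = 0) ∧
      ∀ X : GroupLieAlgebra 𝓘(ℝ, EG) G, ℓ (fundamental EG u X) = b.coord l X := by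
  constructor
  · intro hℓ
    refine ⟨fun v hv ↦ ?_, fun X ↦ ?_⟩
    · have := hℓ ⟨v, Submodule.mem_sup_left hv⟩
      rwa [h.1 u ⟨v, _⟩ hv, map_zero] at this
    · obtain ⟨hX, hX'⟩ := h.2 u X
      have := hℓ ⟨_, hX⟩
      rwa [hX'] at this
  · rintro ⟨h1, h2⟩ ⟨v, hv⟩
    obtain ⟨x, hx, y, hy, rfl⟩ := Submodule.mem_sup.1 hv
    obtain ⟨X, rfl⟩ := hp.exists_fundamental_eq hy
    obtain ⟨hX, hX'⟩ := h.2 u X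
    have : (⟨_, hv⟩ : ↥(H u ⊔ verticalSpace p u)) =
      ⟨x, Submodule.mem_sup_left hx⟩ + ⟨_, hX⟩ := rfl
    rw [this, map_add, hX', h.1 u ⟨x, _⟩ hx, zero_add]
    change ℓ (x + fundamental EG u X) = _
    rw [map_add, h1 x hx, h2, zero_add]

/-- Every linear form `c` on the Lie algebra yields a smooth 1-form which vanishes on `H` and
equals `c X` on the fundamental vector field of `X`. Locally it is a combination of a coframe dual
to a frame of `H` and fundamental fields; the conditions on its values are convex, so that a
partition of unity applies. -/
lemma IsPrincipalBundle.exists_oneForm_extending [SigmaCompactSpace P]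
    (hH : ∀ u, Disjoint (H u) (verticalSpace p u)) (hHs : IsSmoothSubbundle H)
    (c : GroupLieAlgebra 𝓘(ℝ, EG) G →ₗ[ℝ] ℝ) :
    ∃ φ : ∀ u : P, TangentSpace 𝓘(ℝ, EP) u →L[ℝ] ℝ, IsOneForm ∞ φ ∧
      ∀ u, (∀ v ∈ H u, φ u v = 0) ∧
        ∀ X : GroupLieAlgebra 𝓘(ℝ, EG) G, φ u (fundamental EG u X) = c X := by
  have : FiniteDimensional ℝ (GroupLieAlgebra 𝓘(ℝ, EG) G) :=
    inferInstanceAs (FiniteDimensional ℝ EG)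
  let b := finBasis ℝ (GroupLieAlgebra 𝓘(ℝ, EG) G)
  obtain ⟨r, hr⟩ := hHs
  refine Exists.elim (exists_contMDiffSection_forall_mem_convex_of_local (I := 𝓘(ℝ, EP)) (n := ⊤)
    (F_fiber := EP →L[ℝ] ℝ)
    (fun x : P ↦ TangentSpace 𝓘(ℝ, EP) x →L[ℝ] Trivial P ℝ x)
    (fun u ↦ {φ : TangentSpace 𝓘(ℝ, EP) u →L[ℝ] ℝ | (∀ v ∈ H u, φ v = 0) ∧
        ∀ X : GroupLieAlgebra 𝓘(ℝ, EG) G, φ (fundamental EG u X) = c X})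
    (fun u φ hφ ψ hψ s t _ _ hst ↦ ⟨fun v hv ↦ ?_, fun X ↦ ?_⟩) (fun u₀ ↦ ?_))
    fun s hs ↦ ⟨s, s.contMDiff, hs⟩
  · change s * φ v + t * ψ v = 0
    rw [hφ.1 v hv, hψ.1 v hv]; ring
  · change s * φ _ + t * ψ _ = _
    rw [hφ.2, hψ.2, ← add_mul, hst, one_mul]
  · obtain ⟨U, hU, hu₀, X, hX, hXU⟩ := hr u₀
    let W : Fin r ⊕ Fin (finrank ℝ (GroupLieAlgebra 𝓘(ℝ, EG) G)) →
        ∀ u : P, TangentSpace 𝓘(ℝ, EP) u :=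
      Sum.elim X (fun k u ↦ fundamental (EP := EP) EG u (b k))
    have hW : ∀ a, ∀ u ∈ U, IsFieldAt ∞ (W a) u := by
      rintro (i | k) u hu
      · exact (hX i).contMDiffAt (hU.mem_nhds hu)
      · exact hp.isFieldAt_fundamental (b k) u
    have hli : LinearIndependent ℝ (fun a ↦ W a u₀) := by
      have : (fun a ↦ W a u₀) = Sum.elim (fun i ↦ X i u₀)
          (fun k ↦ fundamental (EP := EP) EG u₀ (b k)) := by
        funext a; cases a <;> rfl
      rw [this]
      refine LinearIndependent.sum_type (hXU u₀ hu₀).1 ?_ ?_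
      · exact b.linearIndependent.map' (fundamental (EP := EP) EG (G := G) u₀).toLinearMap
          (LinearMap.ker_eq_bot.2 (hp.fundamental_injective_and_range u₀).1)
      · rw [(hXU u₀ hu₀).2]
        refine (hH u₀).mono_right (Submodule.span_le.2 ?_)
        rintro _ ⟨k, rfl⟩
        exact hp.fundamental_mem_verticalSpace u₀ (b k)
    obtain ⟨V, hV, η, hη, hηW⟩ := exists_dual_forms (hU.mem_nhds hu₀) hW hli
    refine ⟨V ∩ U, Filter.inter_mem hV (hU.mem_nhds hu₀),
      fun u ↦ ∑ k, c (b k) • η (Sum.inr k) u, fun u hu ↦ ?_, fun u hu ↦ ⟨fun v hv ↦ ?_, fun Y ↦ ?_⟩⟩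
    · have : IsOneFormAt ∞ (fun u ↦ ∑ k, c (b k) • η (Sum.inr k) u) u :=
        IsOneFormAt.sum fun k _ ↦ IsOneFormAt.smul contMDiffAt_const (hη _ u hu.1)
      exact this.contMDiffWithinAt
    · rw [← (hXU u hu.2).2, Submodule.mem_span_range_iff_exists_fun] at hv
      obtain ⟨d, rfl⟩ := hv
      have h0 : ∀ k i, η (Sum.inr k) u (X i u) = 0 := fun k i ↦ by
        have := hηW u hu.1 (Sum.inr k) (Sum.inl i)
        simpa [W] using this
      change (∑ k, c (b k) • η (Sum.inr k) u : TangentSpace 𝓘(ℝ, EP) u →L[ℝ] ℝ) _ = 0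
      simp [sum_apply, h0]
    · have h0 : ∀ k j, η (Sum.inr k) u (fundamental EG u (b j)) = if k = j then 1 else 0 :=
        fun k j ↦ by
          have := hηW u hu.1 (Sum.inr k) (Sum.inr j)
          simpa [W] using this
      have h1 : ((∑ k, c (b k) • η (Sum.inr k) u : TangentSpace 𝓘(ℝ, EP) u →L[ℝ] ℝ).toLinearMap ∘ₗ
          (fundamental (EP := EP) EG (G := G) u).toLinearMap) = c := by
        refine b.ext fun j ↦ ?_
        change (∑ k, c (b k) • η (Sum.inr k) u : TangentSpace 𝓘(ℝ, EP) u →L[ℝ] ℝ)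
          (fundamental (EP := EP) EG (G := G) u (b j)) = _
        simp [sum_apply, h0]
      exact LinearMap.congr_fun h1 Y

end Form

/-! ### Forms annihilating the horizontal and the vertical directions -/

section Annihilator
variable {EM : Type*} [NormedAddCommGroup EM] [NormedSpace ℝ EM]
  {M : Type*} [TopologicalSpace M] [ChartedSpace EM M]
  {EP : Type*} [NormedAddCommGroup EP] [NormedSpace ℝ EP]
  {P : Type*} [TopologicalSpace P] [ChartedSpace EP P]
  [IsManifold 𝓘(ℝ, EM) ∞ M] [IsManifold 𝓘(ℝ, EP) ∞ P]
  [FiniteDimensional ℝ EM] [FiniteDimensional ℝ EP] [T2Space M] [T2Space P]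
  {p : C^∞⟮𝓘(ℝ, EP), P; 𝓘(ℝ, EM), M⟯} {B : DiffusionOperator EP P} {A : DiffusionOperator EM M}
  {h : ∀ u : P, A.symbolRange (p u) →ₗ[ℝ] TangentSpace 𝓘(ℝ, EP) u}

lemma IsHorizontalLiftMap.disjoint_verticalSpace (hh : IsHorizontalLiftMap p A B h)
    (hBA : IsOver p B A) (u : P) : Disjoint (LinearMap.range (h u)) (verticalSpace p u) := by
  rw [Submodule.disjoint_def]
  rintro _ ⟨w, rfl⟩ hw
  have h1 : mfderiv 𝓘(ℝ, EP) 𝓘(ℝ, EM) p u (h u w) = 0 := hw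
  rw [hh.mfderiv_apply hBA] at h1
  have : w = 0 := Subtype.ext h1
  rw [this, map_zero]

/-- By symmetry of `σ^B`, covectors which annihilate the horizontal space have vertical image. -/
lemma IsHorizontalLiftMap.symbol_mem_verticalSpace (hh : IsHorizontalLiftMap p A B h)
    {u : P} {ℓ : TangentSpace 𝓘(ℝ, EP) u →L[ℝ] ℝ} (hℓ : ∀ v ∈ LinearMap.range (h u), ℓ v = 0) :
    B.symbol u ℓ ∈ verticalSpace p u := by
  refine vector_ext fun m ↦ ?_
  change (m.comp (mfderiv 𝓘(ℝ, EP) 𝓘(ℝ, EM) p u)) (B.symbol u ℓ) = _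
  rw [B.symbol_symm, hℓ _ (hh.mem_range.2 ⟨m, rfl⟩), map_zero]

/-- Near every point of `M` the annihilator of the image of `σ^A` is spanned by smooth forms
which are defined, and annihilate this image, on all of `M`. They are obtained from the coordinate
differentials by subtracting their components along a frame of the image. -/
lemma DiffusionOperator.exists_annihilating_forms {r : ℕ}
    (hr : ∀ x, finrank ℝ (A.symbolRange x) = r) (x₀ : M) :
    ∃ ψ : Fin (finrank ℝ EM) → ∀ x : M, TangentSpace 𝓘(ℝ, EM) x →L[ℝ] ℝ,
      (∀ i, IsOneForm ∞ (ψ i)) ∧ (∀ i x, ∀ v ∈ A.symbolRange x, ψ i x v = 0) ∧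
      ∀ᶠ y in 𝓝 x₀, ∀ v : TangentSpace 𝓘(ℝ, EM) y, ∃ w ∈ A.symbolRange y,
        ∀ i, ψ i y v = differential (coordFun x₀ (dualCovector x₀ i)) y (v - w) := by
  obtain ⟨U, g, hU, hx₀, hg⟩ := DiffusionOperator.exists_symbol_frame hr x₀
  obtain ⟨V, hV, η, hη, hηX⟩ := exists_dual_forms (hU.mem_nhds hx₀)
    (fun a y _ ↦ A.isFieldAt_symbol_differential (g a) y) (hg x₀ hx₀).1
  let ξ : Fin (finrank ℝ EM) → C^∞⟮𝓘(ℝ, EM), M; 𝓘(ℝ, ℝ), ℝ⟯ := fun i ↦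
    coordFun x₀ (dualCovector x₀ i)
  let ψ₀ : Fin (finrank ℝ EM) → ∀ x : M, TangentSpace 𝓘(ℝ, EM) x →L[ℝ] ℝ := fun i y ↦
    differential (ξ i) y - ∑ a, differential (ξ i) y (A.symbol y (differential (g a) y)) • η a y
  have hψ₀ : ∀ i y v, ψ₀ i y v = differential (ξ i) y
      (v - ∑ a, η a y v • A.symbol y (differential (g a) y)) := fun i y v ↦ by
    simp [ψ₀, mul_comm]
  obtain ⟨χ, hχ1, hχ0, hχ⟩ := exists_bump_smul (E := EM) (Filter.inter_mem hV (hU.mem_nhds hx₀))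
  refine ⟨fun i y ↦ χ y • ψ₀ i y, fun i ↦ hχ _ fun y hy ↦ ?_, fun i y v hv ↦ ?_, ?_⟩
  · exact (isOneFormAt_differential (ξ i) y).sub (IsOneFormAt.sum fun a _ ↦ IsOneFormAt.smul
      ((isOneFormAt_differential (ξ i) y).apply (A.isFieldAt_symbol_differential (g a) y))
      (hη a y hy.1))
  · by_cases hy : y ∈ V ∩ U
    · rw [← (hg y hy.2).2, Submodule.mem_span_range_iff_exists_fun] at hv
      obtain ⟨c, rfl⟩ := hv
      have h0 : ∀ a, η a y (∑ b, c b • A.symbol y (differential (g b) y)) = c a := fun a ↦ by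
        simp [hηX y hy.1]
      change χ y * ψ₀ i y _ = 0
      rw [hψ₀]
      simp only [h0, sub_self, map_zero, mul_zero]
    · change χ y * _ = 0
      rw [hχ0 y hy, zero_mul]
  · filter_upwards [hχ1] with y hy v
    refine ⟨_, Submodule.sum_mem _ (t := Finset.univ) fun a _ ↦ Submodule.smul_mem _ (η a y v)
      (LinearMap.mem_range_self (A.symbol y) (differential (g a) y)), fun i ↦ ?_⟩
    rw [hy, one_smul, hψ₀]

/-- If `A` is cohesive and `B` lies over `A` then `δ^B` vanishes on the forms which annihilate
both the horizontal and the vertical vectors: locally such a form is a combination of pull-backs of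
forms on `M` which annihilate the image of `σ^A`. -/
lemma IsHorizontalLiftMap.delta_eq_zero {EG : Type*} [NormedAddCommGroup EG] [NormedSpace ℝ EG]
    {G : Type*} [TopologicalSpace G] [ChartedSpace EG G] [Group G]
    [LieGroup 𝓘(ℝ, EG) ∞ G] [MulAction Gᵐᵒᵖ P] (hp : IsPrincipalBundle EG G p)
    (hh : IsHorizontalLiftMap p A B h) (hBA : IsOver p B A) (hA : A.IsCohesive)
    {θ : ∀ u : P, TangentSpace 𝓘(ℝ, EP) u →L[ℝ] ℝ} (hθ : ∀ u, IsOneFormAt 1 θ u)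
    (hθH : ∀ u, ∀ v ∈ LinearMap.range (h u), θ u v = 0)
    (hθV : ∀ u, ∀ v ∈ verticalSpace p u, θ u v = 0) (u₀ : P) : B.delta θ u₀ = 0 := by
  obtain ⟨⟨r, -, hr⟩, hAal⟩ := hA
  have one_le : (1 : ℕ∞ω) ≤ ∞ := WithTop.coe_le_coe.2 le_top
  obtain ⟨ψ, hψ, hψE, hψξ⟩ := DiffusionOperator.exists_annihilating_forms hr (p u₀)
  have hp₀ : ContinuousAt p u₀ := p.contMDiff.continuous.continuousAt
  let ξ : Fin (finrank ℝ EM) → C^∞⟮𝓘(ℝ, EM), M; 𝓘(ℝ, ℝ), ℝ⟯ := fun i ↦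
    coordFun (p u₀) (dualCovector (p u₀) i)
  choose z hz using fun i ↦ hp.mfderiv_proj_surjective u₀ (coordVector (E := EM) (p u₀) i (p u₀))
  have hξ := differential_coordFun_coordVector (E := EM) (p u₀)
  obtain ⟨V, hV, Z, hZ, hZξ⟩ := exists_dual_fields
    (θ := fun i u ↦ differential (E := EP) ((ξ i).comp p) u)
    (Filter.univ_mem (f := 𝓝 u₀)) (fun i u _ ↦ isOneFormAt_differential _ u) (z := z)
    (fun i j ↦ by
      rw [differential_comp_eq, ContinuousLinearMap.comp_apply, hz]
      exact hξ.self_of_nhds i j)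
  let c : Fin (finrank ℝ EM) → P → ℝ := fun i u ↦ θ u (Z i u)
  have hc : ∀ i, ContMDiffAt 𝓘(ℝ, EP) 𝓘(ℝ, ℝ) 1 (c i) u₀ := fun i ↦
    (hθ u₀).apply ((hZ i u₀ (mem_of_mem_nhds hV)).of_le one_le)
  -- `v - ∑ d(ξ_i ∘ p)(v) Z_i` is vertical, hence annihilated by `θ`
  have hθsum : ∀ᶠ u in 𝓝 u₀, ∀ v : TangentSpace 𝓘(ℝ, EP) u,
      θ u v = ∑ i, differential (E := EP) ((ξ i).comp p) u v * c i u := by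
    filter_upwards [hV, hp₀.eventually hξ,
      hp₀.eventually ((chartAt EM (p u₀)).open_source.mem_nhds (mem_chart_source EM (p u₀)))]
      with u hu hξu hsrc v
    have hver : v - ∑ i, differential (E := EP) ((ξ i).comp p) u v • Z i u ∈
        verticalSpace p u := by
      set w := v - ∑ i, differential (E := EP) ((ξ i).comp p) u v • Z i u with hw
      obtain ⟨d, hd⟩ := vector_eq_sum_coordVector hsrc (mfderiv 𝓘(ℝ, EP) 𝓘(ℝ, EM) p u w)
      have hd0 : ∀ i, d i = 0 := fun i ↦ by
        have h1 : differential (E := EP) ((ξ i).comp p) u w = d i := by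
          rw [differential_comp_eq, ContinuousLinearMap.comp_apply, hd]
          simp [ξ, hξu]
        rw [← h1, hw]
        simp [hZξ u hu]
      change mfderiv 𝓘(ℝ, EP) 𝓘(ℝ, EM) p u w = 0
      rw [hd]
      simp [hd0]
    have h1 := hθV u _ hver
    rw [map_sub, sub_eq_zero] at h1
    rw [h1]
    simp [c]
  -- subtracting a horizontal vector changes `d(ξ_i ∘ p)` into `p^* ψ_i`, but does not affect `θ`
  have hθψ : ∀ᶠ u in 𝓝 u₀, θ u = ∑ i, c i u • pullbackForm p (ψ i) u := by
    filter_upwards [hθsum, hp₀.eventually hψξ] with u hu hψu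
    ext v
    obtain ⟨w, hw, hw'⟩ := hψu (mfderiv 𝓘(ℝ, EP) 𝓘(ℝ, EM) p u v)
    have h1 : θ u v = θ u (v - h u ⟨w, hw⟩) := by
      rw [map_sub, hθH u _ (LinearMap.mem_range_self _ _), sub_zero]
    rw [h1, hu, sum_apply]
    refine Finset.sum_congr rfl fun i _ ↦ ?_
    rw [differential_comp_eq, ContinuousLinearMap.comp_apply, map_sub, hh.mfderiv_apply hBA,
      ← hw' i, mul_comm]
    rfl
  have hpull : ∀ i, IsOneFormAt 1 (pullbackForm p (ψ i)) u₀ := fun i ↦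
    isOneFormAt_pullbackForm one_le ((hψ i (p u₀)).of_le one_le)
  rw [B.delta_congr hθψ, B.delta_sum _ fun i _ ↦ (hpull i).smul (hc i)]
  refine Finset.sum_eq_zero fun i _ ↦ ?_
  have hσ : B.symbol u₀ (pullbackForm p (ψ i) u₀) = 0 :=
    hBA.symbol_comp_eq_zero u₀ (A.symbol_eq_zero (hψE i _ _ (LinearMap.mem_range_self _ _)))
  rw [B.delta_smul_at ((hc i).mdifferentiableAt (by simp)) (hpull i), hσ, map_zero, zero_add,
    hBA.delta_pullbackForm ((hψ i (p u₀)).of_le one_le),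
    hAal (ψ i) ((hψ i).of_le one_le) (hψE i), mul_zero]

end Annihilator

/-! ### Composing `δ^L` with an endomorphism of the cotangent bundle -/

section Twist
variable {E : Type*} [NormedAddCommGroup E] [NormedSpace ℝ E]
  {M : Type*} [TopologicalSpace M] [ChartedSpace E M]
  [IsManifold 𝓘(ℝ, E) ∞ M] [FiniteDimensional ℝ E] [T2Space M]

namespace DiffusionOperator

/-- A smooth endomorphism `S` of the cotangent bundle for which `σ^L ∘ S` is again symmetric and
positive semi-definite, so that it can be the symbol of a diffusion operator. -/
structure IsAdapted (L : DiffusionOperator E M)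
    (S : ∀ x : M, (TangentSpace 𝓘(ℝ, E) x →L[ℝ] ℝ) →ₗ[ℝ] (TangentSpace 𝓘(ℝ, E) x →L[ℝ] ℝ)) :
    Prop where
  isOneFormAt : ∀ {k : ℕ∞ω} {φ : ∀ x : M, TangentSpace 𝓘(ℝ, E) x →L[ℝ] ℝ} {x : M}, k ≤ ∞ →
    IsOneFormAt k φ x → IsOneFormAt k (fun y ↦ S y (φ y)) x
  symm : ∀ (x : M) (l l' : TangentSpace 𝓘(ℝ, E) x →L[ℝ] ℝ),
    l' (L.symbol x (S x l)) = l (L.symbol x (S x l'))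
  nonneg : ∀ (x : M) (l : TangentSpace 𝓘(ℝ, E) x →L[ℝ] ℝ), 0 ≤ l (L.symbol x (S x l))

variable {L : DiffusionOperator E M}
  {S : ∀ x : M, (TangentSpace 𝓘(ℝ, E) x →L[ℝ] ℝ) →ₗ[ℝ] (TangentSpace 𝓘(ℝ, E) x →L[ℝ] ℝ)}

/-- The defect of `f ↦ δ^L (S (df))` from being a derivation is `2 df (σ^L (S (dg)))`. -/
lemma IsAdapted.delta_mul (hS : L.IsAdapted S) (f g : C^∞⟮𝓘(ℝ, E), M; 𝓘(ℝ, ℝ), ℝ⟯) (x : M) :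
    L.delta (fun y ↦ S y (differential (f * g) y)) x =
      differential f x (L.symbol x (S x (differential g x))) +
        f x * L.delta (fun y ↦ S y (differential g y)) x +
      (differential f x (L.symbol x (S x (differential g x))) +
        g x * L.delta (fun y ↦ S y (differential f y)) x) := by
  have one_le : (1 : ℕ∞ω) ≤ ∞ := WithTop.coe_le_coe.2 le_top
  have h1 : (fun y ↦ S y (differential (f * g) y)) =
      fun y ↦ f y • S y (differential g y) + g y • S y (differential f y) := by
    funext y
    rw [contMDiffMap_mul_differential, map_add, map_smul, map_smul]
  have hf := hS.isOneFormAt one_le (isOneFormAt_differential_one (E := E) f x)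
  have hg := hS.isOneFormAt one_le (isOneFormAt_differential_one (E := E) g x)
  rw [h1, L.delta_add (hg.smul ((f.contMDiff x).of_le one_le))
    (hf.smul ((g.contMDiff x).of_le one_le)), L.delta_smul_at (mdiffAt f x) hg,
    L.delta_smul_at (mdiffAt g x) hf, hS.symm x (differential f x)]

/-- The diffusion operator `f ↦ δ^L (S (df))`. Its symbol is `σ^L ∘ S`, see `symbol_twist`. -/
def twist (L : DiffusionOperator E M)
    (S : ∀ x : M, (TangentSpace 𝓘(ℝ, E) x →L[ℝ] ℝ) →ₗ[ℝ] (TangentSpace 𝓘(ℝ, E) x →L[ℝ] ℝ))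
    (hS : L.IsAdapted S) : DiffusionOperator E M where
  op :=
    { toFun := fun f ↦ ⟨fun x ↦ L.delta (fun y ↦ S y (differential f y)) x, fun x ↦
        L.contMDiffAt_delta Filter.univ_mem fun y _ ↦
          hS.isOneFormAt le_rfl (isOneFormAt_differential f y)⟩
      map_add' := fun f g ↦ by
        ext x
        change L.delta (fun y ↦ S y (differential (f + g : C^∞⟮𝓘(ℝ, E), M; 𝓘(ℝ, ℝ), ℝ⟯) y)) x =
          L.delta (fun y ↦ S y (differential f y)) x + L.delta (fun y ↦ S y (differential g y)) x
        have one_le : (1 : ℕ∞ω) ≤ ∞ := WithTop.coe_le_coe.2 le_top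
        rw [← L.delta_add (hS.isOneFormAt one_le (isOneFormAt_differential_one f x))
          (hS.isOneFormAt one_le (isOneFormAt_differential_one g x))]
        congr 1
        funext y
        rw [← map_add]
        exact congrArg _ (differential_add (mdiffAt f y) (mdiffAt g y))
      map_smul' := fun c f ↦ by
        ext x
        change L.delta (fun y ↦ S y (differential (c • f : C^∞⟮𝓘(ℝ, E), M; 𝓘(ℝ, ℝ), ℝ⟯) y)) x =
          c * L.delta (fun y ↦ S y (differential f y)) x
        have one_le : (1 : ℕ∞ω) ≤ ∞ := WithTop.coe_le_coe.2 le_top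
        have h1 := L.delta_smul_at (f := fun _ ↦ c) (mdifferentiableAt_const)
          (hS.isOneFormAt one_le (isOneFormAt_differential_one f x))
        rw [differential_const] at h1
        rw [zero_apply, zero_add] at h1
        rw [← h1]
        congr 1
        funext y
        rw [← map_smul]
        refine congrArg _ ((differential_mul (f := fun _ ↦ c) mdifferentiableAt_const
          (mdiffAt f y)).trans ?_)
        rw [differential_const, smul_zero, add_zero] }
  -- near `x`, `S (df) = ∑ (∂_i f) S (dx^i)`, and both `∂_i f` and its differential vanish at `x`
  order_two f x hf := by
    have one_le : (1 : ℕ∞ω) ≤ ∞ := WithTop.coe_le_coe.2 le_top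
    obtain ⟨h0, h1⟩ := differential_lieDeriv_eq_zero hf
    have hX : ∀ i, IsFieldAt 1 (coordVector (E := E) x i) x := fun i ↦
      isFieldAt_coordVector one_le x i (mem_chart_source E x)
    have hS' : ∀ i, IsOneFormAt 1
        (fun y ↦ S y (differential (E := E) (coordFun x (dualCovector x i)) y)) x := fun i ↦
      hS.isOneFormAt one_le (isOneFormAt_differential_one _ x)
    have hc : ∀ i, ContMDiffAt 𝓘(ℝ, E) 𝓘(ℝ, ℝ) 1
        (fun y ↦ differential (E := E) f y (coordVector x i y)) x := fun i ↦
      (isOneFormAt_differential_one f x).apply (hX i)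
    change L.delta (fun y ↦ S y (differential f y)) x = 0
    rw [L.delta_congr (ψ := fun y ↦ ∑ i, differential (E := E) f y (coordVector x i y) •
        S y (differential (coordFun x (dualCovector x i)) y)) ?_,
      L.delta_sum _ fun i _ ↦ (hS' i).smul (hc i)]
    · refine Finset.sum_eq_zero fun i _ ↦ ?_
      rw [L.delta_smul_at ((hc i).mdifferentiableAt (by simp)) (hS' i), h0]
      have h2 := h1 _ (hX i)
      unfold lieDeriv at h2
      rw [h2]
      simp
    · filter_upwards [oneForm_eventually_eq_sum (differential (E := E) f) x] with y hy
      conv_lhs => rw [hy]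
      rw [map_sum]
      simp only [map_smul]
  map_one := by
    ext x
    change L.delta (fun y ↦ S y (differential (fun _ ↦ (1 : ℝ)) y)) x = 0
    simp only [differential_const, map_zero]
    exact L.delta_zero x
  semi_elliptic f x := by
    change 0 ≤ (1 / 2 : ℝ) * L.delta (fun y ↦ S y (differential (f * f) y)) x -
      (1 / 2 : ℝ) * (L.delta (fun y ↦ S y (differential f y)) x * f x) -
      (1 / 2 : ℝ) * (f x * L.delta (fun y ↦ S y (differential f y)) x)
    rw [hS.delta_mul]
    have := hS.nonneg x (differential f x)
    linarith

lemma twist_op_apply (hS : L.IsAdapted S) (f : C^∞⟮𝓘(ℝ, E), M; 𝓘(ℝ, ℝ), ℝ⟯) (x : M) :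
    (L.twist S hS).op f x = L.delta (fun y ↦ S y (differential f y)) x := rfl

lemma symbol_twist (hS : L.IsAdapted S) (x : M) (l : TangentSpace 𝓘(ℝ, E) x →L[ℝ] ℝ) :
    (L.twist S hS).symbol x l = L.symbol x (S x l) := by
  refine vector_ext_differential fun f ↦ ?_
  have h1 := (L.twist S hS).differential_symbol_eq_gamma f (coordFun x l) x
  rw [differential_coordFun] at h1
  rw [h1, gamma_apply, twist_op_apply, hS.delta_mul, differential_coordFun, twist_op_apply,
    twist_op_apply]
  ring

lemma delta_twist (hS : L.IsAdapted S) {φ : ∀ x : M, TangentSpace 𝓘(ℝ, E) x →L[ℝ] ℝ} {x : M}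
    (hφ : IsOneFormAt 1 φ x) : (L.twist S hS).delta φ x = L.delta (fun y ↦ S y (φ y)) x := by
  have one_le : (1 : ℕ∞ω) ≤ ∞ := WithTop.coe_le_coe.2 le_top
  have hS' : ∀ i, IsOneFormAt 1
      (fun y ↦ S y (differential (E := E) (coordFun x (dualCovector x i)) y)) x := fun i ↦
    hS.isOneFormAt one_le (isOneFormAt_differential_one _ x)
  have hc := fun i ↦ hφ.coeff one_le i
  rw [L.delta_congr (ψ := fun y ↦ ∑ i, φ y (coordVector x i y) •
      S y (differential (coordFun x (dualCovector x i)) y)) ?_,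
    L.delta_sum _ fun i _ ↦ (hS' i).smul (hc i)]
  · refine Finset.sum_congr rfl fun i _ ↦ ?_
    rw [L.delta_smul_at ((hc i).mdifferentiableAt (by simp)) (hS' i), symbol_twist,
      twist_op_apply, differential_coordFun]
  · filter_upwards [oneForm_eventually_eq_sum φ x] with y hy
    conv_lhs => rw [hy]
    rw [map_sum]
    simp only [map_smul]

end DiffusionOperator
end Twist

/-! ### The decomposition -/

section Decomposition
variable {EM : Type*} [NormedAddCommGroup EM] [NormedSpace ℝ EM]
  {M : Type*} [TopologicalSpace M] [ChartedSpace EM M]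
  {EP : Type*} [NormedAddCommGroup EP] [NormedSpace ℝ EP]
  {P : Type*} [TopologicalSpace P] [ChartedSpace EP P]
  [IsManifold 𝓘(ℝ, EM) ∞ M] [IsManifold 𝓘(ℝ, EP) ∞ P]
  [FiniteDimensional ℝ EM] [FiniteDimensional ℝ EP] [T2Space M] [T2Space P]
  {EG : Type*} [NormedAddCommGroup EG] [NormedSpace ℝ EG] [FiniteDimensional ℝ EG]
  {G : Type*} [TopologicalSpace G] [ChartedSpace EG G] [Group G]
  [LieGroup 𝓘(ℝ, EG) ∞ G] [MulAction Gᵐᵒᵖ P]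
  {p : C^∞⟮𝓘(ℝ, EP), P; 𝓘(ℝ, EM), M⟯}

/-- The forms `ϑ k` extend the components of the semi-connection form of `H` with respect to the
basis `b` of the Lie algebra: they are smooth, vanish on `H`, and are dual to the fundamental
vector fields of `b`. -/
structure IsVerticalCoframe {n : ℕ} (H : ∀ u : P, Submodule ℝ (TangentSpace 𝓘(ℝ, EP) u))
    (b : Basis (Fin n) ℝ (GroupLieAlgebra 𝓘(ℝ, EG) G))
    (ϑ : Fin n → ∀ u : P, TangentSpace 𝓘(ℝ, EP) u →L[ℝ] ℝ) : Prop where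
  isOneForm : ∀ k, IsOneForm ∞ (ϑ k)
  horizontal : ∀ k u, ∀ v ∈ H u, ϑ k u v = 0
  apply_fundamental : ∀ k u (X : GroupLieAlgebra 𝓘(ℝ, EG) G),
    ϑ k u (fundamental (EP := EP) EG u X) = b.coord k X

/-- The vertical part `∑ ℓ(A_k^*) ϑ^k` of a covector `ℓ`, for the coframe `ϑ` dual to the
fundamental fields of the basis `A_k = b k`. -/
def verticalPart {n : ℕ} (b : Basis (Fin n) ℝ (GroupLieAlgebra 𝓘(ℝ, EG) G))
    (ϑ : Fin n → ∀ u : P, TangentSpace 𝓘(ℝ, EP) u →L[ℝ] ℝ) (u : P) :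
    (TangentSpace 𝓘(ℝ, EP) u →L[ℝ] ℝ) →ₗ[ℝ] (TangentSpace 𝓘(ℝ, EP) u →L[ℝ] ℝ) where
  toFun ℓ := ∑ k, ℓ (fundamental (EP := EP) EG u (b k)) • ϑ k u
  map_add' ℓ ℓ' := by simp [add_smul, Finset.sum_add_distrib]
  map_smul' c ℓ := by simp [mul_smul, Finset.smul_sum]

variable {H : ∀ u : P, Submodule ℝ (TangentSpace 𝓘(ℝ, EP) u)} {n : ℕ}
  {b : Basis (Fin n) ℝ (GroupLieAlgebra 𝓘(ℝ, EG) G)}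
  {ϑ : Fin n → ∀ u : P, TangentSpace 𝓘(ℝ, EP) u →L[ℝ] ℝ}

lemma verticalPart_apply (u : P) (ℓ : TangentSpace 𝓘(ℝ, EP) u →L[ℝ] ℝ) :
    verticalPart b ϑ u ℓ = ∑ k, ℓ (fundamental (EP := EP) EG u (b k)) • ϑ k u := rfl

lemma verticalPart_eq_zero (hp : IsPrincipalBundle EG G p) {u : P}
    {ℓ : TangentSpace 𝓘(ℝ, EP) u →L[ℝ] ℝ} (hℓ : ∀ v ∈ verticalSpace p u, ℓ v = 0) :
    verticalPart b ϑ u ℓ = 0 := by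
  rw [verticalPart_apply]
  exact Finset.sum_eq_zero fun k _ ↦ by
    rw [hℓ _ (hp.fundamental_mem_verticalSpace u (b k)), zero_smul]

namespace IsVerticalCoframe

variable (hϑ : IsVerticalCoframe H b ϑ)
include hϑ

lemma isOneFormAt_verticalPart (hp : IsPrincipalBundle EG G p) {k : ℕ∞ω} (hk : k ≤ ∞)
    {φ : ∀ u : P, TangentSpace 𝓘(ℝ, EP) u →L[ℝ] ℝ} {u : P} (hφ : IsOneFormAt k φ u) :
    IsOneFormAt k (fun v ↦ verticalPart b ϑ v (φ v)) u :=
  IsOneFormAt.sum (s := Finset.univ) fun i _ ↦ IsOneFormAt.smul (hφ.apply ((hp.isFieldAt_fundamental (b i) u).of_le hk))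
    ((hϑ.isOneForm i u).of_le hk)

lemma verticalPart_horizontal (u : P) (ℓ : TangentSpace 𝓘(ℝ, EP) u →L[ℝ] ℝ)
    {v : TangentSpace 𝓘(ℝ, EP) u} (hv : v ∈ H u) : verticalPart b ϑ u ℓ v = 0 := by
  simp [verticalPart_apply, hϑ.horizontal _ u v hv]

lemma verticalPart_vertical (hp : IsPrincipalBundle EG G p) (u : P)
    (ℓ : TangentSpace 𝓘(ℝ, EP) u →L[ℝ] ℝ) {v : TangentSpace 𝓘(ℝ, EP) u}
    (hv : v ∈ verticalSpace p u) : verticalPart b ϑ u ℓ v = ℓ v := by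
  obtain ⟨X, rfl⟩ := hp.exists_fundamental_eq hv
  have h1 : verticalPart b ϑ u ℓ (fundamental EG u X) =
      ∑ k, b.repr X k * ℓ (fundamental EG u (b k)) := by
    simp [verticalPart_apply, hϑ.apply_fundamental, mul_comm]
  rw [h1]
  conv_rhs => rw [← b.sum_repr X]
  simp only [map_sum, map_smul, smul_eq_mul]

end IsVerticalCoframe

variable {B : DiffusionOperator EP P} {A : DiffusionOperator EM M}
  {h : ∀ u : P, A.symbolRange (p u) →ₗ[ℝ] TangentSpace 𝓘(ℝ, EP) u}

section
variable (hp : IsPrincipalBundle EG G p) (hh : IsHorizontalLiftMap p A B h)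
  (hϑ : IsVerticalCoframe (fun u ↦ LinearMap.range (h u)) b ϑ)
include hp hh hϑ

/-- `σ^B` of a vertical part is a vertical vector, so that any covector may be replaced by its own
vertical part there. -/
lemma IsVerticalCoframe.apply_symbol_verticalPart (u : P)
    (l l' : TangentSpace 𝓘(ℝ, EP) u →L[ℝ] ℝ) :
    l' (B.symbol u (verticalPart b ϑ u l)) =
      verticalPart b ϑ u l' (B.symbol u (verticalPart b ϑ u l)) :=
  (hϑ.verticalPart_vertical hp u l' (hh.symbol_mem_verticalSpace fun _ hv ↦
    hϑ.verticalPart_horizontal u l hv)).symm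

lemma IsVerticalCoframe.isAdapted_verticalPart : B.IsAdapted (verticalPart b ϑ) where
  isOneFormAt hk hφ := hϑ.isOneFormAt_verticalPart hp hk hφ
  symm u l l' := by
    rw [hϑ.apply_symbol_verticalPart hp hh u l l', hϑ.apply_symbol_verticalPart hp hh u l' l,
      B.symbol_symm]
  nonneg u l := by
    rw [hϑ.apply_symbol_verticalPart hp hh u l l]
    exact B.symbol_nonneg u _

lemma IsVerticalCoframe.isAdapted_sub_verticalPart :
    B.IsAdapted (fun u ↦ LinearMap.id - verticalPart b ϑ u) := by
  refine ⟨fun {k φ x} hk hφ ↦ ?_, fun u l l' ↦ ?_, fun u l ↦ ?_⟩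
  · have h1 : IsOneFormAt k (fun y ↦ φ y - verticalPart b ϑ y (φ y)) x :=
      hφ.sub (hϑ.isOneFormAt_verticalPart hp hk hφ)
    exact h1
  · have h1 := (hϑ.isAdapted_verticalPart hp hh).symm u l l'
    simp only [LinearMap.sub_apply, LinearMap.id_apply, map_sub, h1]
    rw [B.symbol_symm]
  · -- the two parts of a covector are orthogonal for `σ^B`
    have h1 := hϑ.apply_symbol_verticalPart hp hh u l l
    have h2 := B.symbol_nonneg u (l - verticalPart b ϑ u l)
    have h3 := B.symbol_symm u (verticalPart b ϑ u l) l
    simp only [map_sub, sub_apply] at h2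
    simp only [LinearMap.sub_apply, LinearMap.id_apply, map_sub]
    linarith

/-- The decomposition is `B^V f = δ^B (T df)` and `A^H f = δ^B (df - T df)`, where `T` takes the
vertical part of a form. -/
lemma IsVerticalCoframe.isDecomposition (hBA : IsOver p B A) (hA : A.IsCohesive) :
    IsDecomposition p A (fun u ↦ LinearMap.range (h u)) B
      (B.twist _ (hϑ.isAdapted_sub_verticalPart hp hh))
      (B.twist _ (hϑ.isAdapted_verticalPart hp hh)) where
  sum := by
    have one_le : (1 : ℕ∞ω) ≤ ∞ := WithTop.coe_le_coe.2 le_top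
    ext f u
    have h1 : (B.twist _ (hϑ.isAdapted_sub_verticalPart hp hh)).op f u =
        B.delta (fun y ↦ differential f y - verticalPart b ϑ y (differential f y)) u :=
      DiffusionOperator.twist_op_apply _ f u
    have h2 := B.delta_sub (DiffusionOperator.isOneFormAt_differential_one f u)
      (hϑ.isOneFormAt_verticalPart hp one_le (DiffusionOperator.isOneFormAt_differential_one f u))
    rw [LinearMap.add_apply, ContMDiffMap.coe_add, Pi.add_apply, h1,
      DiffusionOperator.twist_op_apply, h2, sub_add_cancel, B.delta_differential]
  lifts f := by
    ext u
    rw [← hBA f, DiffusionOperator.twist_op_apply, ← B.delta_differential]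
    congr 1
    funext v
    rw [LinearMap.sub_apply, verticalPart_eq_zero hp fun w hw ↦ ?_, sub_zero, LinearMap.id_apply]
    rw [differential_comp_eq, ContinuousLinearMap.comp_apply]
    have : mfderiv 𝓘(ℝ, EP) 𝓘(ℝ, EM) p v w = 0 := hw
    rw [this, map_zero]
  horizontal φ hφ hφH u := by
    have one_le : (1 : ℕ∞ω) ≤ ∞ := WithTop.coe_le_coe.2 le_top
    have hφ' : ∀ v, IsOneFormAt 1 φ v := hφ
    rw [DiffusionOperator.delta_twist _ (hφ' u)]
    refine hh.delta_eq_zero hp hBA hA (fun v ↦ (hφ' v).sub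
      (hϑ.isOneFormAt_verticalPart hp one_le (hφ' v))) (fun v w hw ↦ ?_) (fun v w hw ↦ ?_) u
    · change φ v w - verticalPart b ϑ v (φ v) w = 0
      rw [hφH v w hw, hϑ.verticalPart_horizontal v _ hw, sub_zero]
    · change φ v w - verticalPart b ϑ v (φ v) w = 0
      rw [hϑ.verticalPart_vertical hp v _ hw, sub_self]
  vertical φ hφ hφV u := by
    rw [DiffusionOperator.delta_twist _ (hφ u)]
    simp only [verticalPart_eq_zero hp (hφV _)]
    exact B.delta_zero u

omit hh in
/-- For any decomposition, `δ^{B^V}` only sees the vertical part of a form and `δ^{A^H}` vanishes on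
it, so that `B^V f = δ^B (T df)`. -/
lemma IsVerticalCoframe.vertical_op_eq {AH BV : DiffusionOperator EP P}
    (hd : IsDecomposition p A (fun u ↦ LinearMap.range (h u)) B AH BV)
    (f : C^∞⟮𝓘(ℝ, EP), P; 𝓘(ℝ, ℝ), ℝ⟯) (u : P) :
    BV.op f u = B.delta (fun v ↦ verticalPart b ϑ v (differential f v)) u := by
  have one_le : (1 : ℕ∞ω) ≤ ∞ := WithTop.coe_le_coe.2 le_top
  have hf : ∀ v, IsOneFormAt 1 (fun y ↦ differential (E := EP) f y) v := fun v ↦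
    DiffusionOperator.isOneFormAt_differential_one f v
  have hTf : ∀ v, IsOneFormAt 1 (fun y ↦ verticalPart b ϑ y (differential (E := EP) f y)) v :=
    fun v ↦ hϑ.isOneFormAt_verticalPart hp one_le (hf v)
  have h1 := hd.horizontal (fun y ↦ verticalPart b ϑ y (differential f y)) hTf
    (fun v w hw ↦ hϑ.verticalPart_horizontal v _ hw) u
  have h2 := hd.vertical (fun y ↦ differential f y - verticalPart b ϑ y (differential f y))
    (fun v ↦ (hf v).sub (hTf v))
    (fun v w hw ↦ by rw [sub_apply, hϑ.verticalPart_vertical hp v _ hw, sub_self]) u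
  rw [BV.delta_sub (hf u) (hTf u), sub_eq_zero] at h2
  rw [DiffusionOperator.delta_of_op_eq_add hd.sum, h1, zero_add, ← h2]
  exact (BV.delta_differential f u).symm

omit hh in
lemma IsVerticalCoframe.isDecomposition_unique {AH BV AH' BV' : DiffusionOperator EP P}
    (hd : IsDecomposition p A (fun u ↦ LinearMap.range (h u)) B AH BV)
    (hd' : IsDecomposition p A (fun u ↦ LinearMap.range (h u)) B AH' BV') :
    AH' = AH ∧ BV' = BV := by
  have hV : BV'.op = BV.op := by
    ext f u
    rw [hϑ.vertical_op_eq hp hd, hϑ.vertical_op_eq hp hd']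
  refine ⟨DiffusionOperator.ext ?_, DiffusionOperator.ext hV⟩
  have := hd'.sum.symm.trans hd.sum
  rw [hV] at this
  exact add_right_cancel this

end
end Decomposition

/-! ### The vertical part in terms of fundamental vector fields -/

section VerticalPart
variable {EM : Type*} [NormedAddCommGroup EM] [NormedSpace ℝ EM]
  {M : Type*} [TopologicalSpace M] [ChartedSpace EM M]
  {EP : Type*} [NormedAddCommGroup EP] [NormedSpace ℝ EP]
  {P : Type*} [TopologicalSpace P] [ChartedSpace EP P]
  [IsManifold 𝓘(ℝ, EM) ∞ M] [IsManifold 𝓘(ℝ, EP) ∞ P]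
  [FiniteDimensional ℝ EM] [FiniteDimensional ℝ EP] [T2Space M] [T2Space P]
  {EG : Type*} [NormedAddCommGroup EG] [NormedSpace ℝ EG] [FiniteDimensional ℝ EG]
  {G : Type*} [TopologicalSpace G] [ChartedSpace EG G] [Group G]
  [LieGroup 𝓘(ℝ, EG) ∞ G] [MulAction Gᵐᵒᵖ P]
  {p : C^∞⟮𝓘(ℝ, EP), P; 𝓘(ℝ, EM), M⟯} (hp : IsPrincipalBundle EG G p)
  {H : ∀ u : P, Submodule ℝ (TangentSpace 𝓘(ℝ, EP) u)} {n : ℕ}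
  {b : Basis (Fin n) ℝ (GroupLieAlgebra 𝓘(ℝ, EG) G)}
  {ϑ : Fin n → ∀ u : P, TangentSpace 𝓘(ℝ, EP) u →L[ℝ] ℝ}
  {B : DiffusionOperator EP P}
include hp

lemma IsVerticalCoframe.vertical_eq_sum (hϑ : IsVerticalCoframe H b ϑ) {u : P}
    {v : TangentSpace 𝓘(ℝ, EP) u} (hv : v ∈ verticalSpace p u) :
    v = ∑ k, ϑ k u v • fundamental (EP := EP) EG u (b k) := by
  obtain ⟨X, rfl⟩ := hp.exists_fundamental_eq hv
  conv_lhs => rw [← b.sum_repr X]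
  simp only [map_sum, map_smul, hϑ.apply_fundamental, Basis.coord_apply]

/-- The coefficients `α, β` of a vertical expression are determined by the operator: evaluate it on
a product of two functions, and on one function, which vanish at `u` and have prescribed
derivatives along the fundamental fields there. -/
lemma IsVerticalCoframe.hasVerticalExpression_unique (hϑ : IsVerticalCoframe H b ϑ)
    {L : DiffusionOperator EP P} {α α' : Fin n → Fin n → P → ℝ} {β β' : Fin n → P → ℝ}
    (hα : ∀ i j, α i j = α j i) (hα' : ∀ i j, α' i j = α' j i)
    (hL : HasVerticalExpression L b α β) (hL' : HasVerticalExpression L b α' β') :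
    (∀ i j, α' i j = α i j) ∧ ∀ k, β' k = β k := by
  let D : Fin n → (P → ℝ) → P → ℝ := fun k f u ↦
    lieDeriv (E := EP) (fun u ↦ fundamental EG u (b k)) f u
  have hLD : ∀ (f : C^∞⟮𝓘(ℝ, EP), P; 𝓘(ℝ, ℝ), ℝ⟯) (u : P), L.op f u =
    ∑ i, ∑ j, α i j u * D i (D j f) u + ∑ k, β k u * D k f u := hL
  have hLD' : ∀ (f : C^∞⟮𝓘(ℝ, EP), P; 𝓘(ℝ, ℝ), ℝ⟯) (u : P), L.op f u =
    ∑ i, ∑ j, α' i j u * D i (D j f) u + ∑ k, β' k u * D k f u := hL'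
  have hdiff : ∀ k (f : C^∞⟮𝓘(ℝ, EP), P; 𝓘(ℝ, ℝ), ℝ⟯) (u : P),
      MDifferentiableAt 𝓘(ℝ, EP) 𝓘(ℝ, ℝ) (D k f) u := fun k f u ↦
    ((isOneFormAt_differential f u).apply (hp.isFieldAt_fundamental (b k) u)).mdifferentiableAt
      (by simp)
  let t : P → Fin n → C^∞⟮𝓘(ℝ, EP), P; 𝓘(ℝ, ℝ), ℝ⟯ := fun u k ↦ coordFun u (ϑ k u)
  have ht0 : ∀ u k, t u k u = 0 := fun u k ↦ coordFun_self u _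
  have ht1 : ∀ u k j, D j (t u k) u = if j = k then 1 else 0 := fun u k j ↦ by
    change differential (E := EP) (t u k) u (fundamental EG u (b j)) = _
    rw [differential_coordFun, hϑ.apply_fundamental, Basis.coord_apply, Basis.repr_self,
      Finsupp.single_apply]
  have hprod : ∀ (f g : C^∞⟮𝓘(ℝ, EP), P; 𝓘(ℝ, ℝ), ℝ⟯) j,
      D j (f * g : C^∞⟮𝓘(ℝ, EP), P; 𝓘(ℝ, ℝ), ℝ⟯) = fun v ↦ f v * D j g v + g v * D j f v :=
    fun f g j ↦ by
      funext v
      change differential (E := EP) (f * g : C^∞⟮𝓘(ℝ, EP), P; 𝓘(ℝ, ℝ), ℝ⟯) v _ = _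
      rw [contMDiffMap_mul_differential]
      rfl
  have hprod2 : ∀ u k l i j,
      D i (D j (t u k * t u l : C^∞⟮𝓘(ℝ, EP), P; 𝓘(ℝ, ℝ), ℝ⟯)) u =
      (if i = k then 1 else 0) * (if j = l then 1 else 0) +
      (if i = l then 1 else 0) * (if j = k then 1 else 0) := fun u k l i j ↦ by
    rw [hprod]
    change differential (E := EP) (fun v ↦ t u k v * D j (t u l) v + t u l v * D j (t u k) v) u
      (fundamental EG u (b i)) = _
    rw [differential_add (f := fun v ↦ t u k v * D j (t u l) v)
      (g := fun v ↦ t u l v * D j (t u k) v) ((mdiffAt (t u k) u).mul (hdiff j (t u l) u))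
      ((mdiffAt (t u l) u).mul (hdiff j (t u k) u)), differential_mul (mdiffAt (t u k) u)
      (hdiff j (t u l) u), differential_mul (mdiffAt (t u l) u) (hdiff j (t u k) u),
      ht0, ht0, zero_smul, zero_smul, zero_add, zero_add, ht1, ht1, add_apply, smul_apply,
      smul_apply]
    have h1 : ∀ k, differential (E := EP) (t u k) u (fundamental EG u (b i)) =
      if i = k then 1 else 0 := fun k ↦ ht1 u k i
    rw [h1, h1, smul_eq_mul, smul_eq_mul]
    ring
  have hα_eq : ∀ k l, α' k l = α k l := fun k l ↦ by
    funext u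
    have h1 := (hLD' (t u k * t u l) u).symm.trans (hLD (t u k * t u l) u)
    simp only [hprod2] at h1
    simp only [hprod, ht0, zero_mul, add_zero, mul_zero, Finset.sum_const_zero, mul_add,
      Finset.sum_add_distrib, mul_ite, mul_one, Finset.sum_ite_eq',
      Finset.mem_univ, if_true] at h1
    rw [hα l k, hα' l k] at h1
    linarith
  refine ⟨hα_eq, fun k ↦ ?_⟩
  funext u
  have h1 := (hLD' (t u k) u).symm.trans (hLD (t u k) u)
  simp only [hα_eq] at h1
  have h2 := add_left_cancel h1
  simpa [ht1] using h2

variable {A : DiffusionOperator EM M}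
  {h : ∀ u : P, A.symbolRange (p u) →ₗ[ℝ] TangentSpace 𝓘(ℝ, EP) u}

/-- The expression of the vertical part: apply the Leibniz rule to `δ^B (∑ (L_{A_k^*} f) ϑ^k)` and
expand the vertical vectors `σ^B ϑ^k` in the fundamental fields. -/
lemma IsVerticalCoframe.hasVerticalExpression (hh : IsHorizontalLiftMap p A B h)
    (hϑ : IsVerticalCoframe (fun u ↦ LinearMap.range (h u)) b ϑ) {AH BV : DiffusionOperator EP P}
    (hd : IsDecomposition p A (fun u ↦ LinearMap.range (h u)) B AH BV) :
    HasVerticalExpression BV b (fun i j u ↦ ϑ i u (B.symbol u (ϑ j u)))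
      (fun k u ↦ B.delta (ϑ k) u) := by
  have one_le : (1 : ℕ∞ω) ≤ ∞ := WithTop.coe_le_coe.2 le_top
  intro f u
  have hc : ∀ k, ContMDiffAt 𝓘(ℝ, EP) 𝓘(ℝ, ℝ) 1
      (lieDeriv (E := EP) (fun u ↦ fundamental EG u (b k)) f) u := fun k ↦
    (DiffusionOperator.isOneFormAt_differential_one f u).apply
      ((hp.isFieldAt_fundamental (b k) u).of_le one_le)
  have hϑ1 : ∀ k, IsOneFormAt 1 (ϑ k) u := fun k ↦ (hϑ.isOneForm k u).of_le one_le
  have h1 : BV.op f u = B.delta (fun v ↦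
      ∑ k, lieDeriv (E := EP) (fun u ↦ fundamental EG u (b k)) f v • ϑ k v) u :=
    hϑ.vertical_op_eq hp hd f u
  rw [h1, B.delta_sum _ fun k _ ↦ (hϑ1 k).smul (hc k)]
  simp only [B.delta_smul_at ((hc _).mdifferentiableAt (by simp)) (hϑ1 _)]
  rw [Finset.sum_add_distrib, Finset.sum_comm (γ := Fin n)]
  congr 1
  · refine Finset.sum_congr rfl fun j _ ↦ ?_
    have h2 := hϑ.vertical_eq_sum hp
      (hh.symbol_mem_verticalSpace (ℓ := ϑ j u) fun v hv ↦ hϑ.horizontal j u v hv)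
    conv_lhs => rw [h2]
    simp only [map_sum, map_smul, smul_eq_mul]
    rfl
  · exact Finset.sum_congr rfl fun k _ ↦ mul_comm _ _

/-- `σ^B`, restricted to covectors which annihilate the horizontal vectors, depends only on the
values of the covectors on vertical vectors. -/
lemma IsHorizontalLiftMap.apply_symbol_congr (hh : IsHorizontalLiftMap p A B h) {u : P}
    {l₁ l₂ m₁ m₂ : TangentSpace 𝓘(ℝ, EP) u →L[ℝ] ℝ}
    (hl₁ : ∀ v ∈ LinearMap.range (h u), l₁ v = 0) (hm₂ : ∀ v ∈ LinearMap.range (h u), m₂ v = 0)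
    (hl : ∀ X : GroupLieAlgebra 𝓘(ℝ, EG) G,
      l₁ (fundamental (EP := EP) EG u X) = l₂ (fundamental (EP := EP) EG u X))
    (hm : ∀ X : GroupLieAlgebra 𝓘(ℝ, EG) G,
      m₁ (fundamental (EP := EP) EG u X) = m₂ (fundamental (EP := EP) EG u X)) :
    m₁ (B.symbol u l₁) = m₂ (B.symbol u l₂) := by
  have h1 : ∀ {k₁ k₂ : TangentSpace 𝓘(ℝ, EP) u →L[ℝ] ℝ} {v : TangentSpace 𝓘(ℝ, EP) u},
      (∀ X : GroupLieAlgebra 𝓘(ℝ, EG) G,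
        k₁ (fundamental (EP := EP) EG u X) = k₂ (fundamental (EP := EP) EG u X)) →
      v ∈ verticalSpace p u → k₁ v = k₂ v := fun hk hv ↦ by
    obtain ⟨X, rfl⟩ := hp.exists_fundamental_eq hv
    exact hk X
  rw [h1 hm (hh.symbol_mem_verticalSpace hl₁), B.symbol_symm,
    h1 hl (hh.symbol_mem_verticalSpace hm₂), B.symbol_symm]

/-- `δ^B` of a form which annihilates the horizontal vectors depends only on its values on vertical
vectors. -/
lemma IsHorizontalLiftMap.delta_congr (hh : IsHorizontalLiftMap p A B h) (hBA : IsOver p B A)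
    (hA : A.IsCohesive) {φ ψ : ∀ u : P, TangentSpace 𝓘(ℝ, EP) u →L[ℝ] ℝ}
    (hφ : ∀ u, IsOneFormAt 1 φ u) (hψ : ∀ u, IsOneFormAt 1 ψ u)
    (hφH : ∀ u, ∀ v ∈ LinearMap.range (h u), φ u v = 0)
    (hψH : ∀ u, ∀ v ∈ LinearMap.range (h u), ψ u v = 0)
    (hφψ : ∀ u (X : GroupLieAlgebra 𝓘(ℝ, EG) G),
      φ u (fundamental (EP := EP) EG u X) = ψ u (fundamental (EP := EP) EG u X)) (u : P) :
    B.delta φ u = B.delta ψ u := by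
  rw [← sub_eq_zero, ← B.delta_sub (hφ u) (hψ u)]
  refine hh.delta_eq_zero hp hBA hA (fun v ↦ (hφ v).sub (hψ v)) (fun v w hw ↦ ?_)
    (fun v w hw ↦ ?_) u
  · rw [sub_apply, hφH v w hw, hψH v w hw, sub_zero]
  · obtain ⟨X, rfl⟩ := hp.exists_fundamental_eq hw
    rw [sub_apply, hφψ, sub_self]

end VerticalPart

/-! ### Change of basis and equivariance of the coefficients -/

section Coefficients

/-- Change of basis for a 2-tensor, combined with a linear map: the matrix of `(T ⊗ T) s` in the
basis `b` in terms of the matrix of `s` in the basis `b₀`. -/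
lemma sum_smul_tmul_eq_map {V : Type*} [AddCommGroup V] [Module ℝ V] {ι κ : Type*} [Fintype ι]
    [Fintype κ] (b : Basis ι ℝ V) (b₀ : Basis κ ℝ V) (T : V →ₗ[ℝ] V) (s : κ → κ → ℝ) :
    ∑ i, ∑ j, (∑ k, ∑ l, b.coord i (T (b₀ k)) * (b.coord j (T (b₀ l)) * s k l)) •
      (b i ⊗ₜ[ℝ] b j) = TensorProduct.map T T (∑ k, ∑ l, s k l • (b₀ k ⊗ₜ[ℝ] b₀ l)) := by
  have h1 : ∀ k l, T (b₀ k) ⊗ₜ[ℝ] T (b₀ l) = ∑ i, ∑ j,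
      (b.coord i (T (b₀ k)) * b.coord j (T (b₀ l))) • (b i ⊗ₜ[ℝ] b j) := fun k l ↦ by
    conv_lhs => rw [← b.sum_repr (T (b₀ k)), ← b.sum_repr (T (b₀ l))]
    simp only [TensorProduct.sum_tmul, TensorProduct.tmul_sum, TensorProduct.smul_tmul_smul,
      Basis.coord_apply]
    exact Finset.sum_comm
  simp only [map_sum, map_smul, TensorProduct.map_tmul, h1, Finset.sum_smul, Finset.smul_sum,
    smul_smul]
  calc _ = ∑ i, ∑ k, ∑ j, ∑ l, (b.coord i (T (b₀ k)) * (b.coord j (T (b₀ l)) * s k l)) •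
        (b i ⊗ₜ[ℝ] b j) := Finset.sum_congr rfl fun _ _ ↦ Finset.sum_comm
    _ = ∑ k, ∑ i, ∑ l, ∑ j, (b.coord i (T (b₀ k)) * (b.coord j (T (b₀ l)) * s k l)) •
        (b i ⊗ₜ[ℝ] b j) := by
      rw [Finset.sum_comm]
      exact Finset.sum_congr rfl fun _ _ ↦ Finset.sum_congr rfl fun _ _ ↦ Finset.sum_comm
    _ = _ := by
      refine Finset.sum_congr rfl fun _ _ ↦ Finset.sum_comm.trans ?_
      refine Finset.sum_congr rfl fun _ _ ↦ Finset.sum_congr rfl fun _ _ ↦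
        Finset.sum_congr rfl fun _ _ ↦ ?_
      congr 1
      ring

lemma sum_smul_eq_map {V : Type*} [AddCommGroup V] [Module ℝ V] {ι κ : Type*} [Fintype ι]
    [Fintype κ] (b : Basis ι ℝ V) (b₀ : Basis κ ℝ V) (T : V →ₗ[ℝ] V) (s : κ → ℝ) :
    ∑ j, (∑ l, b.coord j (T (b₀ l)) * s l) • b j = T (∑ l, s l • b₀ l) := by
  simp only [map_sum, map_smul, Finset.sum_smul]
  rw [Finset.sum_comm]
  refine Finset.sum_congr rfl fun l _ ↦ ?_
  conv_rhs => rw [← b.sum_repr (T (b₀ l)), Finset.smul_sum]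
  exact Finset.sum_congr rfl fun j _ ↦ by rw [smul_smul, mul_comm, Basis.coord_apply]

variable {EM : Type*} [NormedAddCommGroup EM] [NormedSpace ℝ EM]
  {M : Type*} [TopologicalSpace M] [ChartedSpace EM M]
  {EP : Type*} [NormedAddCommGroup EP] [NormedSpace ℝ EP]
  {P : Type*} [TopologicalSpace P] [ChartedSpace EP P]
  [IsManifold 𝓘(ℝ, EM) ∞ M] [IsManifold 𝓘(ℝ, EP) ∞ P]
  [FiniteDimensional ℝ EM] [FiniteDimensional ℝ EP] [T2Space M] [T2Space P]
  {EG : Type*} [NormedAddCommGroup EG] [NormedSpace ℝ EG] [FiniteDimensional ℝ EG]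
  {G : Type*} [TopologicalSpace G] [ChartedSpace EG G] [Group G]
  [LieGroup 𝓘(ℝ, EG) ∞ G] [MulAction Gᵐᵒᵖ P]
  {p : C^∞⟮𝓘(ℝ, EP), P; 𝓘(ℝ, EM), M⟯} (hp : IsPrincipalBundle EG G p)
  {n m : ℕ} {b : Basis (Fin n) ℝ (GroupLieAlgebra 𝓘(ℝ, EG) G)}
  {ϑ : Fin n → ∀ u : P, TangentSpace 𝓘(ℝ, EP) u →L[ℝ] ℝ}
  {b₀ : Basis (Fin m) ℝ (GroupLieAlgebra 𝓘(ℝ, EG) G)}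
  {ϑ₀ : Fin m → ∀ u : P, TangentSpace 𝓘(ℝ, EP) u →L[ℝ] ℝ}
  {B : DiffusionOperator EP P} {A : DiffusionOperator EM M}
  {h : ∀ u : P, A.symbolRange (p u) →ₗ[ℝ] TangentSpace 𝓘(ℝ, EP) u}

lemma IsPrincipalBundle.exists_isVerticalCoframe (hp : IsPrincipalBundle EG G p)
    [SigmaCompactSpace P]
    {H : ∀ u : P, Submodule ℝ (TangentSpace 𝓘(ℝ, EP) u)}
    (hH : ∀ u, Disjoint (H u) (verticalSpace p u)) (hHs : IsSmoothSubbundle H)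
    (b : Basis (Fin n) ℝ (GroupLieAlgebra 𝓘(ℝ, EG) G)) :
    ∃ ϑ : Fin n → ∀ u : P, TangentSpace 𝓘(ℝ, EP) u →L[ℝ] ℝ, IsVerticalCoframe H b ϑ := by
  choose ϑ h1 h2 using fun k ↦ hp.exists_oneForm_extending hH hHs (b.coord k)
  exact ⟨ϑ, h1, fun k u ↦ (h2 k u).1, fun k u ↦ (h2 k u).2⟩

/-- The tensor `∑ ϑ^i (σ^B ϑ^j) A_i ⊗ A_j`, for the basis `A_i = b i` of the Lie algebra. -/
def symbolTensor (B : DiffusionOperator EP P)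
    (b : Basis (Fin n) ℝ (GroupLieAlgebra 𝓘(ℝ, EG) G))
    (ϑ : Fin n → ∀ u : P, TangentSpace 𝓘(ℝ, EP) u →L[ℝ] ℝ) (u : P) :
    GroupLieAlgebra 𝓘(ℝ, EG) G ⊗[ℝ] GroupLieAlgebra 𝓘(ℝ, EG) G :=
  ∑ i, ∑ j, ϑ i u (B.symbol u (ϑ j u)) • (b i ⊗ₜ[ℝ] b j)

/-- The vector `∑ δ^B(ϑ^k) A_k`, for the basis `A_k = b k` of the Lie algebra. -/
def driftVector (B : DiffusionOperator EP P)
    (b : Basis (Fin n) ℝ (GroupLieAlgebra 𝓘(ℝ, EG) G))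
    (ϑ : Fin n → ∀ u : P, TangentSpace 𝓘(ℝ, EP) u →L[ℝ] ℝ) (u : P) :
    GroupLieAlgebra 𝓘(ℝ, EG) G :=
  ∑ k, B.delta (ϑ k) u • b k

/-- A linear form `c` on the Lie algebra is extended by `∑ c(A_l) ϑ^l`. -/
lemma IsVerticalCoframe.sum_smul_fundamental {H : ∀ u : P, Submodule ℝ (TangentSpace 𝓘(ℝ, EP) u)}
    (hϑ₀ : IsVerticalCoframe H b₀ ϑ₀) (c : GroupLieAlgebra 𝓘(ℝ, EG) G →ₗ[ℝ] ℝ) (u : P)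
    (X : GroupLieAlgebra 𝓘(ℝ, EG) G) :
    (∑ l, c (b₀ l) • ϑ₀ l u) (fundamental (EP := EP) EG u X) = c X := by
  conv_rhs => rw [← b₀.sum_repr X]
  simp only [sum_apply, smul_apply, hϑ₀.apply_fundamental, map_sum, map_smul, smul_eq_mul,
    Basis.coord_apply, mul_comm]

section
variable (hh : IsHorizontalLiftMap p A B h)
  (hϑ₀ : IsVerticalCoframe (fun u ↦ LinearMap.range (h u)) b₀ ϑ₀)
include hp hh hϑ₀

/-- If the covectors `ℓ^i` extend the components of `T ∘ ϖ` in the basis `b`, the tensor formed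
with them is the image under `T ⊗ T` of the one formed with the components of `ϖ`. -/
lemma IsVerticalCoframe.sum_symbol_smul_tmul (T : GroupLieAlgebra 𝓘(ℝ, EG) G →ₗ[ℝ]
    GroupLieAlgebra 𝓘(ℝ, EG) G) {u : P} {ℓ : Fin n → TangentSpace 𝓘(ℝ, EP) u →L[ℝ] ℝ}
    (hℓ : ∀ i, ∀ v ∈ LinearMap.range (h u), ℓ i v = 0)
    (hℓT : ∀ i (X : GroupLieAlgebra 𝓘(ℝ, EG) G),
      ℓ i (fundamental (EP := EP) EG u X) = b.coord i (T X)) :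
    ∑ i, ∑ j, ℓ i (B.symbol u (ℓ j)) • (b i ⊗ₜ[ℝ] b j) =
      TensorProduct.map T T (symbolTensor B b₀ ϑ₀ u) := by
  rw [symbolTensor, ← sum_smul_tmul_eq_map b b₀ T]
  refine Finset.sum_congr rfl fun i _ ↦ Finset.sum_congr rfl fun j _ ↦ ?_
  congr 1
  have h1 := hϑ₀.sum_smul_fundamental (c := b.coord j ∘ₗ T) (u := u)
  have h2 := hϑ₀.sum_smul_fundamental (c := b.coord i ∘ₗ T) (u := u)
  rw [hh.apply_symbol_congr hp (hℓ j) (m₂ := ∑ k, (b.coord i ∘ₗ T) (b₀ k) • ϑ₀ k u)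
    (l₂ := ∑ k, (b.coord j ∘ₗ T) (b₀ k) • ϑ₀ k u) (fun v hv ↦ ?_)
    (fun X ↦ (hℓT j X).trans (h1 X).symm) (fun X ↦ (hℓT i X).trans (h2 X).symm)]
  · -- it remains to compare two orders of summation
    simp only [sum_apply, smul_apply, map_sum, map_smul, smul_eq_mul, Finset.mul_sum,
      LinearMap.comp_apply]
    rw [Finset.sum_comm]
    refine Finset.sum_congr rfl fun k _ ↦ Finset.sum_congr rfl fun l _ ↦ ?_
    ring
  · simp [sum_apply, hϑ₀.horizontal _ u v hv]

/-- If the forms `φ^j` extend the components of `T ∘ ϖ` in the basis `b`, the vector formed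
with them is the image under `T` of the one formed with the components of `ϖ`. -/
lemma IsVerticalCoframe.sum_delta_smul (hBA : IsOver p B A) (hA : A.IsCohesive)
    (T : GroupLieAlgebra 𝓘(ℝ, EG) G →ₗ[ℝ] GroupLieAlgebra 𝓘(ℝ, EG) G)
    {φ : Fin n → ∀ u : P, TangentSpace 𝓘(ℝ, EP) u →L[ℝ] ℝ}
    (hφ : ∀ i u, IsOneFormAt 1 (φ i) u)
    (hφH : ∀ i u, ∀ v ∈ LinearMap.range (h u), φ i u v = 0)
    (hφT : ∀ i u (X : GroupLieAlgebra 𝓘(ℝ, EG) G),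
      φ i u (fundamental (EP := EP) EG u X) = b.coord i (T X)) (u : P) :
    ∑ j, B.delta (φ j) u • b j = T (driftVector B b₀ ϑ₀ u) := by
  have one_le : (1 : ℕ∞ω) ≤ ∞ := WithTop.coe_le_coe.2 le_top
  have hϑ1 : ∀ l v, IsOneFormAt 1 (ϑ₀ l) v := fun l v ↦ (hϑ₀.isOneForm l v).of_le one_le
  rw [driftVector, ← sum_smul_eq_map b b₀ T]
  refine Finset.sum_congr rfl fun j _ ↦ ?_
  congr 1
  rw [hh.delta_congr hp hBA hA (hφ j) (ψ := fun v ↦ ∑ k, (b.coord j ∘ₗ T) (b₀ k) • ϑ₀ k v)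
    (fun v ↦ IsOneFormAt.sum fun k _ ↦ (hϑ1 k v).smul contMDiffAt_const) (hφH j)
    (fun v w hw ↦ by simp [sum_apply, hϑ₀.horizontal _ v w hw])
    (fun v X ↦ (hφT j v X).trans (hϑ₀.sum_smul_fundamental (b.coord j ∘ₗ T) v X).symm),
    B.delta_sum _ fun k _ ↦ (hϑ1 k u).smul contMDiffAt_const]
  refine Finset.sum_congr rfl fun k _ ↦ ?_
  rw [B.delta_smul_at mdifferentiableAt_const (hϑ1 k u), differential_const, zero_apply, zero_add,
    LinearMap.comp_apply]

lemma IsVerticalCoframe.symbolTensor_eq (hϑ : IsVerticalCoframe (fun u ↦ LinearMap.range (h u)) b ϑ)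
    (u : P) : symbolTensor B b ϑ u = symbolTensor B b₀ ϑ₀ u :=
  (hϑ₀.sum_symbol_smul_tmul hp hh LinearMap.id (fun i ↦ hϑ.horizontal i u)
    fun i ↦ hϑ.apply_fundamental i u).trans (by rw [TensorProduct.map_id, LinearMap.id_apply])

lemma IsVerticalCoframe.driftVector_eq (hBA : IsOver p B A) (hA : A.IsCohesive)
    (hϑ : IsVerticalCoframe (fun u ↦ LinearMap.range (h u)) b ϑ) (u : P) :
    driftVector B b ϑ u = driftVector B b₀ ϑ₀ u :=
  hϑ₀.sum_delta_smul hp hh hBA hA LinearMap.id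
    (fun i v ↦ (hϑ.isOneForm i v).of_le (WithTop.coe_le_coe.2 le_top)) hϑ.horizontal
    hϑ.apply_fundamental u

variable (hB : hp.IsEquivariant B) (a : G)
include hB

lemma IsVerticalCoframe.pullbackForm_horizontal (k : Fin m) (u : P) {v : TangentSpace 𝓘(ℝ, EP) u}
    (hv : v ∈ LinearMap.range (h u)) : pullbackForm (hp.rightTranslation a) (ϑ₀ k) u v = 0 := by
  refine hϑ₀.horizontal k (MulOpposite.op a • u) _ ?_
  rw [← hh.map_mfderiv_rightTranslation hp hB a u]
  exact ⟨v, hv, rfl⟩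

omit hh hB in
/-- The pull-back of `ϑ^k` by `R_a` extends the `k`-th component of `Ad(a⁻¹) ∘ ϖ`. -/
lemma IsVerticalCoframe.pullbackForm_fundamental (k : Fin m) (u : P)
    (X : GroupLieAlgebra 𝓘(ℝ, EG) G) :
    pullbackForm (hp.rightTranslation a) (ϑ₀ k) u (fundamental (EP := EP) EG u X) =
      b₀.coord k (Ad EG a⁻¹ X) := by
  rw [← hϑ₀.apply_fundamental k (MulOpposite.op a • u), ← hp.mfderiv_rightTranslation_fundamental]
  rfl

lemma IsVerticalCoframe.symbolTensor_smul (u : P) :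
    symbolTensor B b₀ ϑ₀ (MulOpposite.op a • u) =
      TensorProduct.map (Ad EG a⁻¹).toLinearMap (Ad EG a⁻¹).toLinearMap
        (symbolTensor B b₀ ϑ₀ u) := by
  rw [← hϑ₀.sum_symbol_smul_tmul hp hh _
    (ℓ := fun k ↦ pullbackForm (hp.rightTranslation a) (ϑ₀ k) u)
    (fun k v hv ↦ hϑ₀.pullbackForm_horizontal hp hh hB a k u hv)
    (fun k X ↦ hϑ₀.pullbackForm_fundamental hp a k u X)]
  refine Finset.sum_congr rfl fun i _ ↦ Finset.sum_congr rfl fun j _ ↦ ?_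
  congr 1
  exact congrArg (ϑ₀ i (MulOpposite.op a • u))
    ((hp.isOver_rightTranslation hB a).mfderiv_symbol u (ϑ₀ j (MulOpposite.op a • u))).symm

lemma IsVerticalCoframe.driftVector_smul (hBA : IsOver p B A) (hA : A.IsCohesive) (u : P) :
    driftVector B b₀ ϑ₀ (MulOpposite.op a • u) = Ad EG a⁻¹ (driftVector B b₀ ϑ₀ u) := by
  have one_le : (1 : ℕ∞ω) ≤ ∞ := WithTop.coe_le_coe.2 le_top
  have hϑ1 : ∀ l v, IsOneFormAt 1 (ϑ₀ l) v := fun l v ↦ (hϑ₀.isOneForm l v).of_le one_le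
  refine Eq.trans ?_ (hϑ₀.sum_delta_smul hp hh hBA hA (Ad EG a⁻¹).toLinearMap
    (φ := fun k ↦ pullbackForm (hp.rightTranslation a) (ϑ₀ k))
    (fun k v ↦ isOneFormAt_pullbackForm one_le (hϑ1 k _))
    (fun k v w hw ↦ hϑ₀.pullbackForm_horizontal hp hh hB a k v hw)
    (fun k v X ↦ hϑ₀.pullbackForm_fundamental hp a k v X) u)
  refine Finset.sum_congr rfl fun k _ ↦ ?_
  congr 1
  exact ((hp.isOver_rightTranslation hB a).delta_pullbackForm (hϑ1 k _)).symm

end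
end Coefficients

end EquivDiff

end

/-- Decomposition of equivariant diffusion operators on a principal bundle. -/
theorem mainTheorem4
    {EM : Type*} [NormedAddCommGroup EM] [NormedSpace ℝ EM] [FiniteDimensional ℝ EM]
    {M : Type*} [TopologicalSpace M] [ChartedSpace EM M] [IsManifold 𝓘(ℝ, EM) ∞ M]
    [T2Space M] [SigmaCompactSpace M]
    {EP : Type*} [NormedAddCommGroup EP] [NormedSpace ℝ EP] [FiniteDimensional ℝ EP]
    {P : Type*} [TopologicalSpace P] [ChartedSpace EP P] [IsManifold 𝓘(ℝ, EP) ∞ P]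
    [T2Space P] [SigmaCompactSpace P]
    {EG : Type*} [NormedAddCommGroup EG] [NormedSpace ℝ EG] [FiniteDimensional ℝ EG]
    {G : Type*} [TopologicalSpace G] [ChartedSpace EG G] [Group G] [LieGroup 𝓘(ℝ, EG) ∞ G]
    [MulAction Gᵐᵒᵖ P]
    (p : C^∞⟮𝓘(ℝ, EP), P; 𝓘(ℝ, EM), M⟯) (hp : EquivDiff.IsPrincipalBundle EG G p)
    (B : EquivDiff.DiffusionOperator EP P) (hB : hp.IsEquivariant B) :
    -- the induced operator on the base
    ∃ A : EquivDiff.DiffusionOperator EM M,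
      (EquivDiff.IsOver p B A ∧
        ∀ A' : EquivDiff.DiffusionOperator EM M, EquivDiff.IsOver p B A' → A' = A) ∧
      -- the invariant semi-connection
      (A.HasConstantRank →
        ∃ h : ∀ u : P, A.symbolRange (p u) →ₗ[ℝ] TangentSpace 𝓘(ℝ, EP) u,
          EquivDiff.IsHorizontalLiftMap p A B h ∧
          (∀ h', EquivDiff.IsHorizontalLiftMap p A B h' → h' = h) ∧
          (∀ (u : P) (v : A.symbolRange (p u)),
            mfderiv 𝓘(ℝ, EP) 𝓘(ℝ, EM) p u (h u v) = v) ∧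
          EquivDiff.IsInvariantSemiConnection hp A.symbolRange
            (fun u ↦ LinearMap.range (h u)) ∧
          -- the decomposition of `B`
          (A.IsCohesive →
            ∃ AH BV : EquivDiff.DiffusionOperator EP P,
              EquivDiff.IsDecomposition p A (fun u ↦ LinearMap.range (h u)) B AH BV ∧
              (∀ AH' BV' : EquivDiff.DiffusionOperator EP P,
                EquivDiff.IsDecomposition p A (fun u ↦ LinearMap.range (h u)) B AH' BV' →
                  AH' = AH ∧ BV' = BV) ∧
              -- the semi-connection form
              ∃ ϖ : ∀ u : P, ↥(LinearMap.range (h u) ⊔ EquivDiff.verticalSpace p u) →ₗ[ℝ]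
                  GroupLieAlgebra 𝓘(ℝ, EG) G,
                EquivDiff.IsSemiConnectionForm p (fun u ↦ LinearMap.range (h u)) ϖ ∧
                (∀ ϖ', EquivDiff.IsSemiConnectionForm p (fun u ↦ LinearMap.range (h u)) ϖ' →
                  ϖ' = ϖ) ∧
                -- the vertical part; the tensors do not depend on the basis `b`
                ∃ (αT : P → GroupLieAlgebra 𝓘(ℝ, EG) G ⊗[ℝ] GroupLieAlgebra 𝓘(ℝ, EG) G)
                  (βT : P → GroupLieAlgebra 𝓘(ℝ, EG) G),
                  (∀ (n : ℕ) (b : Module.Basis (Fin n) ℝ (GroupLieAlgebra 𝓘(ℝ, EG) G)),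
                    ∃ (α : Fin n → Fin n → C^∞⟮𝓘(ℝ, EP), P; 𝓘(ℝ, ℝ), ℝ⟯)
                      (β : Fin n → C^∞⟮𝓘(ℝ, EP), P; 𝓘(ℝ, ℝ), ℝ⟯),
                      EquivDiff.HasVerticalExpression BV b (fun i j ↦ α i j) (fun k ↦ β k) ∧
                      (∀ i j, α i j = α j i) ∧
                      (∀ (α' : Fin n → Fin n → P → ℝ) (β' : Fin n → P → ℝ),
                        (∀ i j, α' i j = α' j i) →
                        EquivDiff.HasVerticalExpression BV b α' β' →
                          (∀ i j, α' i j = α i j) ∧ ∀ k, β' k = β k) ∧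
                      (∀ (k l : Fin n) (u : P) (ℓ : TangentSpace 𝓘(ℝ, EP) u →L[ℝ] ℝ),
                        EquivDiff.ExtendsAt ϖ b l u ℓ →
                          ∃ hℓ : B.symbol u ℓ ∈
                              LinearMap.range (h u) ⊔ EquivDiff.verticalSpace p u,
                            α k l u = b.coord k (ϖ u ⟨B.symbol u ℓ, hℓ⟩)) ∧
                      (∀ l : Fin n,
                        ∃ φ : ∀ u : P, TangentSpace 𝓘(ℝ, EP) u →L[ℝ] ℝ,
                          EquivDiff.IsOneForm ∞ φ ∧
                            ∀ u, EquivDiff.ExtendsAt ϖ b l u (φ u)) ∧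
                      (∀ (l : Fin n) (φ : ∀ u : P, TangentSpace 𝓘(ℝ, EP) u →L[ℝ] ℝ),
                        EquivDiff.IsOneForm 1 φ →
                        (∀ u, EquivDiff.ExtendsAt ϖ b l u (φ u)) →
                          ∀ u, β l u = B.delta φ u) ∧
                      (∀ u, αT u = ∑ i, ∑ j, α i j u • (b i ⊗ₜ[ℝ] b j)) ∧
                      (∀ u, βT u = ∑ k, β k u • b k)) ∧
                  (∀ (u : P) (g : G), αT (MulOpposite.op g • u) =
                    TensorProduct.map (EquivDiff.Ad EG g⁻¹).toLinearMap
                      (EquivDiff.Ad EG g⁻¹).toLinearMap (αT u)) ∧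
                  (∀ (u : P) (g : G), βT (MulOpposite.op g • u) =
                    EquivDiff.Ad EG g⁻¹ (βT u)))) := by
  have one_le : (1 : ℕ∞ω) ≤ ∞ := WithTop.coe_le_coe.2 le_top
  have : FiniteDimensional ℝ (GroupLieAlgebra 𝓘(ℝ, EG) G) :=
    inferInstanceAs (FiniteDimensional ℝ EG)
  obtain ⟨A, hBA⟩ := hp.exists_isOver hB
  refine ⟨A, ⟨hBA, fun A' hA' ↦ hBA.unique hp.proj_surjective hA'⟩, fun hA ↦ ?_⟩
  obtain ⟨h, hh⟩ := hBA.exists_isHorizontalLiftMap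
  have hconn := hh.isInvariantSemiConnection hp hB hBA hA
  refine ⟨h, hh, fun h' hh' ↦ hh.unique hh', hh.mfderiv_apply hBA, hconn, fun hcoh ↦ ?_⟩
  have hdisj := hh.disjoint_verticalSpace hBA
  have hcoframe : ∀ (n : ℕ) (b : Module.Basis (Fin n) ℝ (GroupLieAlgebra 𝓘(ℝ, EG) G)),
      ∃ ϑ : Fin n → ∀ u : P, TangentSpace 𝓘(ℝ, EP) u →L[ℝ] ℝ,
        EquivDiff.IsVerticalCoframe (fun u ↦ LinearMap.range (h u)) b ϑ := fun n b ↦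
    hp.exists_isVerticalCoframe hdisj hconn.subbundle b
  let b₀ := Module.finBasis ℝ (GroupLieAlgebra 𝓘(ℝ, EG) G)
  obtain ⟨ϑ₀, hϑ₀⟩ := hcoframe _ b₀
  have hd := hϑ₀.isDecomposition hp hh hBA hcoh
  obtain ⟨ϖ, hϖ⟩ := hp.exists_isSemiConnectionForm hdisj
  refine ⟨_, _, hd, fun AH' BV' hd' ↦ hϑ₀.isDecomposition_unique hp hd hd', ϖ, hϖ,
    fun ϖ' hϖ' ↦ hϖ.unique hp hϖ', EquivDiff.symbolTensor B b₀ ϑ₀,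
    EquivDiff.driftVector B b₀ ϑ₀, fun n b ↦ ?_,
    fun u g ↦ hϑ₀.symbolTensor_smul hp hh hB g u,
    fun u g ↦ hϑ₀.driftVector_smul hp hh hB g hBA hcoh u⟩
  obtain ⟨ϑ, hϑ⟩ := hcoframe n b
  have hext : ∀ k u, EquivDiff.ExtendsAt ϖ b k u (ϑ k u) := fun k u ↦
    (hϖ.extendsAt_iff hp).2 ⟨hϑ.horizontal k u, hϑ.apply_fundamental k u⟩
  have hexpr := hϑ.hasVerticalExpression hp hh hd
  have hsymm : ∀ i j u, ϑ i u (B.symbol u (ϑ j u)) = ϑ j u (B.symbol u (ϑ i u)) :=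
    fun i j u ↦ B.symbol_symm u _ _
  refine ⟨fun i j ↦ ⟨fun u ↦ ϑ i u (B.symbol u (ϑ j u)), fun u ↦
      EquivDiff.IsOneFormAt.apply (hϑ.isOneForm i u)
        (B.isFieldAt_symbol Filter.univ_mem fun v _ ↦ hϑ.isOneForm j v)⟩,
    fun k ↦ ⟨fun u ↦ B.delta (ϑ k) u, fun u ↦
      B.contMDiffAt_delta Filter.univ_mem fun v _ ↦ hϑ.isOneForm k v⟩,
    hexpr, fun i j ↦ ContMDiffMap.ext fun u ↦ hsymm i j u, fun α' β' hα' hα'β' ↦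
      hϑ.hasVerticalExpression_unique hp (fun i j ↦ funext fun u ↦ hsymm i j u) hα' hexpr hα'β',
    fun k l u ℓ hℓ ↦ ?_, fun l ↦ ⟨ϑ l, hϑ.isOneForm l, hext l⟩, fun l φ hφ hφext u ↦ ?_,
    fun u ↦ (hϑ₀.symbolTensor_eq hp hh hϑ u).symm,
    fun u ↦ (hϑ₀.driftVector_eq hp hh hBA hcoh hϑ u).symm⟩
  · obtain ⟨hℓH, hℓV⟩ := (hϖ.extendsAt_iff hp).1 hℓ
    refine ⟨Submodule.mem_sup_right (hh.symbol_mem_verticalSpace hℓH), ?_⟩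
    rw [← hext k u ⟨_, _⟩]
    exact hh.apply_symbol_congr hp (hϑ.horizontal l u) (hϑ.horizontal k u)
      (fun X ↦ (hϑ.apply_fundamental l u X).trans (hℓV X).symm) fun _ ↦ rfl
  · have hφ' := fun v ↦ (hϖ.extendsAt_iff hp).1 (hφext v)
    exact hh.delta_congr hp hBA hcoh (fun v ↦ (hϑ.isOneForm l v).of_le one_le) hφ
      (hϑ.horizontal l) (fun v ↦ (hφ' v).1)
      (fun v X ↦ (hϑ.apply_fundamental l v X).trans ((hφ' v).2 X).symm) u
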